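/- Let $\Omega\subset\mathbb R^2$ be a bounded Lipschitz domain (open, connected) with Lipschitz constant $M>0$, let $\sigma$ be arc length on $\partial\Omega$, and let $m\in\mathbb N$; all functions are $\mathbb R^m$-valued and repeated indices are summed. *Domain.* For $x\in\partial\Omega$ and $r>0$ let $Z_r(x)=\{y:|y_1-x_1|<r,\ |y_2-x_2|<(3M+1)r\}$, in a Cartesian coordinate system obtained by a rotation; it is a coordinate rectangle if, for some Lipschitz function $g$ with constant $M$, inside $Z_r(x)$ the set $\Omega$ is $\{y_2>g(y_1)\}$ and $\partial\Omega$ is $\{y_2=g(y_1)\}$. Every $x\in\partial\Omega$ is the center of a coordinate rectangle. Fix a finite cover of $\partial\Omega$ by rectangles $Z_{r_i}(x_i)$ such that each $Z_{100r_i}(x_i)$ is a coordinate rectangle, and put $r_0=\min_i r_i$. For $x\in\bar\Omega$ and $0<\rho<r_0$ fix a local domain $\Omega_\rho(x)$: the disk $B_\rho(x)$ if $\operatorname{dist}(x,\partial\Omega)>\rho$; otherwise $Z_\rho(\hat x)\cap\Omega$, formed in the coordinates of some $i$ with $x\in Z_{5r_i}(x_i)$, where $\hat x=(x_1,g_i(x_1))$.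 *Spaces.* For $D\subset\partial\Omega$, $W^{1,2}_D(\Omega)$ is the closure, in the functions with weak gradient in $L^2(\Omega)$, of the functions that are smooth on $\bar\Omega$ and vanish in a neighborhood of $D$, with the homogeneous norm $\|u\|_{W^{1,2}_D(\Omega)}=\|\nabla u\|_{L^2(\Omega)}$ (the convergence also includes convergence of the functions themselves in $L^1_{loc}(\Omega)$, so elements are functions and not classes modulo constants). $W^{-1,2}_\emptyset(\Omega)$ is the dual of $W^{1,2}_\emptyset(\Omega)$. $W^{1/2,2}_\emptyset(\partial\Omega)$ is the image of $W^{1,2}_\emptyset(\Omega)$ under the trace map, with the norm $\inf\{\|\nabla u\|_{L^2(\Omega)}: u|_{\partial\Omega}=g\}$, and $W^{-1/2,2}_\emptyset(\partial\Omega)$ is its dual. The dual pairings are $\langle\cdot,\cdot\rangle$ and $\langle\cdot,\cdot\rangle_{\partial\Omega}$. *Operator.* Let $a^{ij}_{\alpha\beta}$ ($i,j=1,2$; $\alpha,\beta=1,\dots,m$) be real measurable functions on $\Omega$ with $|a^{ij}_{\alpha\beta}|\le M$ a.e., and let $$A(u,\phi)=\int_\Omega a^{ij}_{\alpha\beta}\,\frac{\partial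 u^\beta}{\partial x_j}\,\frac{\partial\phi^\alpha}{\partial x_i}\,dx .$$ Suppose that for all $x\in\bar\Omega$, $\rho\in(0,r_0)$, $u\in W^{1,2}_\emptyset(\Omega)$ and $c\in\mathbb R^m$ $$M^{-1}\int_{\Omega_\rho(x)}|\nabla u|^2\,dy\le\int_{\Omega_\rho(x)}a^{ij}_{\alpha\beta}\frac{\partial u^\beta}{\partial y_j}\frac{\partial u^\alpha}{\partial y_i}+\rho^{-2}|u-c|^2\,dy ,$$ and that $M^{-1}\int_\Omega|\nabla u|^2\,dy\le A(u,u)$ for all $u\in W^{1,2}_{\partial\Omega}(\Omega)$. Put $$\mathcal V=\{v\in W^{1,2}_\emptyset(\Omega):A(v,\phi)=0\ \ \forall\phi\in W^{1,2}_\emptyset(\Omega)\},\qquad \mathcal V^*=\{v\in W^{1,2}_\emptyset(\Omega):A(\phi,v)=0\ \ \forall\phi\in W^{1,2}_\emptyset(\Omega)\}.$$ **Theorem.** There is a constant $C$, independent of $f$ and $f_N$, such that the following holds. If $f\in W^{-1,2}_\emptyset(\Omega)$ and $f_N\in W^{-1/2,2}_\emptyset(\partial\Omega)$ satisfy $\langle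 f_N,v\rangle_{\partial\Omega}-\langle f,v\rangle=0$ for all $v\in\mathcal V^*$, then there is exactly one (up to equality a.e.) $u\in W^{1,2}_\emptyset(\Omega)$ with $$A(u,\phi)=-\langle f,\phi\rangle+\langle f_N,\phi\rangle_{\partial\Omega}\quad\text{for all }\phi\in W^{1,2}_\emptyset(\Omega),\qquad \int_{\partial\Omega}u^\alpha v^\alpha\,d\sigma=0\quad\text{for all }v\in\mathcal V ,$$ and it lies in $L^2(\Omega)$ and satisfies $$\|u\|_{L^2(\Omega)}+\|\nabla u\|_{L^2(\Omega)}\le C\left(\|f\|_{W^{-1,2}_\emptyset(\Omega)}+\|f_N\|_{W^{-1/2,2}_\emptyset(\partial\Omega)}\right).$$ -/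

import Mathlib

open MeasureTheory Filter Topology Set
open scoped ENNReal ContDiff

noncomputable section

namespace NeumannProblem

/-! ### The plane, vector values, and Lipschitz domains -/

/-- The Euclidean plane. -/
abbrev Plane : Type := EuclideanSpace ℝ (Fin 2)

/-- The target space `ℝ^m` with its Euclidean norm. -/
abbrev Vec (m : ℕ) : Type := EuclideanSpace ℝ (Fin m)

/-- Values of gradients: the entry at `(i, α)` is the derivative in direction `i` of the component
`α`. The norm is the Euclidean (Frobenius) norm. -/
abbrev GradVec (m : ℕ) : Type := EuclideanSpace ℝ (Fin 2 × Fin m)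

/-- The rectangle `Z_r(x)` attached to the constant `M`, in the Cartesian coordinates given by
`T` (the coordinates of the point `y` are `T y 0` and `T y 1`). -/
def rect (M : ℝ) (T : Plane ≃ₗᵢ[ℝ] Plane) (x : Plane) (r : ℝ) : Set Plane :=
  {y | |T y 0 - T x 0| < r ∧ |T y 1 - T x 1| < (3 * M + 1) * r}

/-- `Z_r(x)` is a coordinate rectangle for `Ω`: inside it, `Ω` is the part above the graph of the
Lipschitz function `g` (with constant `M`), and the boundary of `Ω` is that graph. -/
structure IsCoordRect (Ω : Set Plane) (M : ℝ) (T : Plane ≃ₗᵢ[ℝ] Plane) (g : ℝ → ℝ)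
    (x : Plane) (r : ℝ) : Prop where
  lipschitz : ∀ s t, |g s - g t| ≤ M * |s - t|
  domain : Ω ∩ rect M T x r = {y | g (T y 0) < T y 1} ∩ rect M T x r
  boundary : frontier Ω ∩ rect M T x r = {y | T y 1 = g (T y 0)} ∩ rect M T x r

/-- Bounded Lipschitz domains with constant `M`. -/
structure IsLipschitzDomain (Ω : Set Plane) (M : ℝ) : Prop where
  isOpen : IsOpen Ω
  isConnected : IsConnected Ω
  isBounded : Bornology.IsBounded Ω
  coord : ∀ x ∈ frontier Ω, ∃ (T : Plane ≃ₗᵢ[ℝ] Plane) (g : ℝ → ℝ) (r : ℝ),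
    0 < r ∧ IsCoordRect Ω M T g x r

/-- A finite cover of the boundary by coordinate rectangles `Z_{r_i}(x_i)` for which the enlarged
rectangles `Z_{100 r_i}(x_i)` are still coordinate rectangles. -/
structure CoordCover (Ω : Set Plane) (M : ℝ) where
  n : ℕ
  center : Fin n → Plane
  radius : Fin n → ℝ
  frame : Fin n → (Plane ≃ₗᵢ[ℝ] Plane)
  graph : Fin n → ℝ → ℝ
  center_mem : ∀ i, center i ∈ frontier Ω
  radius_pos : ∀ i, 0 < radius i
  isCoordRect : ∀ i, IsCoordRect Ω M (frame i) (graph i) (center i) (100 * radius i)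
  covers : frontier Ω ⊆ ⋃ i, rect M (frame i) (center i) (radius i)

/-- The characteristic length `r₀ = min r_i`. -/
def CoordCover.r₀ {Ω : Set Plane} {M : ℝ} (𝒞 : CoordCover Ω M) : ℝ := ⨅ i, 𝒞.radius i

/-- The projection `x ↦ (x₁, g(x₁))` onto the graph in the `i`-th coordinate system. -/
def CoordCover.proj {Ω : Set Plane} {M : ℝ} (𝒞 : CoordCover Ω M) (i : Fin 𝒞.n) (x : Plane) :
    Plane :=
  (𝒞.frame i).symm !₂[𝒞.frame i x 0, 𝒞.graph i (𝒞.frame i x 0)]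

/-- `U` is one of the local domains `Ω_ρ(x)`. Away from the boundary it is the disk. Near the
boundary one picks a coordinate rectangle of the cover that contains `x` (every point at distance
less than `4 r₀` from the boundary lies in some `Z_{5 r_i}(x_i)`), projects `x` to the point `x̂` of
the boundary, and takes `Z_ρ(x̂) ∩ Ω`. -/
def CoordCover.IsLocalDomain {Ω : Set Plane} {M : ℝ} (𝒞 : CoordCover Ω M) (x : Plane) (ρ : ℝ)
    (U : Set Plane) : Prop :=
  (ρ < Metric.infDist x (frontier Ω) ∧ U = Metric.ball x ρ) ∨
  (Metric.infDist x (frontier Ω) ≤ ρ ∧ ∃ i, x ∈ rect M (𝒞.frame i) (𝒞.center i) (5 * 𝒞.radius i) ∧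
    U = rect M (𝒞.frame i) (𝒞.proj i x) ρ ∩ Ω)

/-! ### Sobolev functions -/

/-- `i`-th partial derivative of a (differentiable) scalar function. -/
def partialDeriv (i : Fin 2) (ψ : Plane → ℝ) (x : Plane) : ℝ :=
  fderiv ℝ ψ x (EuclideanSpace.single i 1)

/-- The classical gradient of a (differentiable) vector-valued function. -/
def classicalGrad {m : ℕ} (φ : Plane → Vec m) (x : Plane) : GradVec m :=
  WithLp.toLp 2 fun p => fderiv ℝ φ x (EuclideanSpace.single p.1 1) p.2

/-- `u` is integrable on the compact subsets of `Ω`. -/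
def LocInt {m : ℕ} (Ω : Set Plane) (u : Plane → Vec m) : Prop :=
  ∀ K ⊆ Ω, IsCompact K → IntegrableOn u K

/-- `G` is the weak gradient of `u` in `Ω`. -/
def IsWeakGrad {m : ℕ} (Ω : Set Plane) (u : Plane → Vec m) (G : Plane → GradVec m) : Prop :=
  ∀ ψ : Plane → ℝ, ContDiff ℝ ∞ ψ → HasCompactSupport ψ → tsupport ψ ⊆ Ω →
    ∀ (i : Fin 2) (α : Fin m),
      ∫ x in Ω, u x α * partialDeriv i ψ x = - ∫ x in Ω, G x (i, α) * ψ x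

/-- The functions `φ k` converge to `f` in `L^p(μ)`. -/
def ConvLp {F : Type*} [NormedAddCommGroup F] (p : ℝ≥0∞) (μ : Measure Plane)
    (φ : ℕ → Plane → F) (f : Plane → F) : Prop :=
  Tendsto (fun k => eLpNorm (fun x => φ k x - f x) p μ) atTop (𝓝 0)

/-- The functions `φ k` converge to `u`, with gradient `G`, in the Sobolev space: the gradients
converge in `L²(Ω)`, and the functions converge in `L¹` on compact subsets of `Ω` (which fixes
the additive constant that the gradient does not see). -/
structure SobolevConv {m : ℕ} (Ω : Set Plane) (φ : ℕ → Plane → Vec m)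
    (u : Plane → Vec m) (G : Plane → GradVec m) : Prop where
  grad : ConvLp 2 (volume.restrict Ω) (fun k => classicalGrad (φ k)) G
  loc : ∀ K ⊆ Ω, IsCompact K → ConvLp 1 (volume.restrict K) φ u

/-- Pairs of a locally integrable function on `Ω` and its weak gradient, the latter in `L²(Ω)`,
up to equality almost everywhere in `Ω`, which are limits of functions that are smooth up to the
boundary and vanish in a neighborhood of `D`. -/
structure MemSobolev {m : ℕ} (Ω D : Set Plane)
    (p : (Plane →ₘ[volume.restrict Ω] Vec m) × Lp (GradVec m) 2 (volume.restrict Ω)) : Prop where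
  locInt : LocInt Ω p.1
  isWeakGrad : IsWeakGrad Ω p.1 p.2
  approx : ∃ φ : ℕ → Plane → Vec m, (∀ k, ContDiff ℝ ∞ (φ k)) ∧ (∀ k, φ k =ᶠ[𝓝ˢ D] 0) ∧
    SobolevConv Ω φ p.1 p.2

lemma ae_eq_mono {F : Type*} {K Ω : Set Plane} {f h : Plane → F} (hK : K ⊆ Ω)
    (hh : f =ᵐ[volume.restrict Ω] h) : f =ᵐ[volume.restrict K] h :=
  ae_restrict_of_ae_restrict_of_subset hK hh

section Linearity

variable {F : Type*} [NormedAddCommGroup F] {p : ℝ≥0∞} {μ : Measure Plane}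

lemma ConvLp.add {φ χ : ℕ → Plane → F} {f g h : Plane → F} (hp : 1 ≤ p)
    (hφ : ∀ k, AEStronglyMeasurable (φ k) μ) (hχ : ∀ k, AEStronglyMeasurable (χ k) μ)
    (hf : AEStronglyMeasurable f μ) (hg : AEStronglyMeasurable g μ)
    (h1 : ConvLp p μ φ f) (h2 : ConvLp p μ χ g) (hh : h =ᵐ[μ] f + g) :
    ConvLp p μ (fun k => φ k + χ k) h := by
  have h3 := Tendsto.add h1 h2
  rw [add_zero] at h3
  refine tendsto_of_tendsto_of_tendsto_of_le_of_le tendsto_const_nhds h3 (fun _ => zero_le) ?_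
  intro k
  refine le_trans (le_of_eq (eLpNorm_congr_ae ?_))
    (eLpNorm_add_le ((hφ k).sub hf) ((hχ k).sub hg) hp)
  filter_upwards [hh] with x hx
  simp only [hx, Pi.add_apply]
  abel

lemma ConvLp.smul [NormedSpace ℝ F] {φ : ℕ → Plane → F} {f h : Plane → F} (c : ℝ)
    (h1 : ConvLp p μ φ f) (hh : h =ᵐ[μ] c • f) : ConvLp p μ (fun k => c • φ k) h := by
  have h3 := ENNReal.Tendsto.const_mul (a := ‖c‖ₑ) h1 (Or.inr (by simp))
  rw [mul_zero] at h3
  refine tendsto_of_tendsto_of_tendsto_of_le_of_le tendsto_const_nhds h3 (fun _ => zero_le) ?_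
  intro k
  refine le_of_eq (Eq.trans (eLpNorm_congr_ae ?_) (eLpNorm_const_smul c _ p μ))
  filter_upwards [hh] with x hx
  simp only [hx, Pi.smul_apply, smul_sub]

lemma ConvLp.zero {h : Plane → F} (hh : h =ᵐ[μ] 0) : ConvLp p μ (fun _ _ => (0 : F)) h := by
  unfold ConvLp
  have e : eLpNorm (fun x => (0 : F) - h x) p μ = 0 := by
    rw [eLpNorm_congr_ae (g := 0), eLpNorm_zero]
    filter_upwards [hh] with x hx
    simp [hx]
  refine tendsto_const_nhds.congr (fun _ => e.symm)

variable {m : ℕ}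

lemma classicalGrad_add {φ χ : Plane → Vec m} (hφ : Differentiable ℝ φ)
    (hχ : Differentiable ℝ χ) : classicalGrad (φ + χ) = classicalGrad φ + classicalGrad χ := by
  funext x
  ext p
  simp [classicalGrad, fderiv_add (hφ x) (hχ x)]

lemma classicalGrad_smul {φ : Plane → Vec m} (c : ℝ) (hφ : Differentiable ℝ φ) :
    classicalGrad (c • φ) = c • classicalGrad φ := by
  funext x
  ext p
  simp [classicalGrad, fderiv_const_smul (hφ x) c]

lemma classicalGrad_zero : classicalGrad (0 : Plane → Vec m) = 0 := by
  funext x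
  ext p
  simp [classicalGrad]

lemma continuous_classicalGrad {φ : Plane → Vec m} (hφ : ContDiff ℝ ∞ φ) :
    Continuous (classicalGrad φ) := by
  have h := hφ.continuous_fderiv (by simp)
  unfold classicalGrad
  fun_prop

lemma IsWeakGrad.integrable_left {Ω : Set Plane} {u : Plane → Vec m} (hu : LocInt Ω u)
    {ψ : Plane → ℝ} (hψ : ContDiff ℝ ∞ ψ) (hc : HasCompactSupport ψ) (hs : tsupport ψ ⊆ Ω)
    (i : Fin 2) (α : Fin m) :
    Integrable (fun x => u x α * partialDeriv i ψ x) (volume.restrict Ω) := by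
  have hcont : Continuous (partialDeriv i ψ) := by
    have h := hψ.continuous_fderiv (by simp)
    unfold partialDeriv
    fun_prop
  have hsupp : ∀ x, x ∉ tsupport ψ → partialDeriv i ψ x = 0 := by
    intro x hx
    have : fderiv ℝ ψ x = 0 := by
      by_contra h
      exact hx (tsupport_fderiv_subset ℝ (subset_tsupport _ h))
    simp [partialDeriv, this]
  obtain ⟨C, hC⟩ := hc.isCompact.exists_bound_of_continuousOn hcont.continuousOn
  have h1 : IntegrableOn (fun x => u x α) (tsupport ψ) :=
    (EuclideanSpace.proj (𝕜 := ℝ) α).integrable_comp (hu _ hs hc.isCompact)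
  have h2 : IntegrableOn (fun x => u x α * partialDeriv i ψ x) (tsupport ψ) := by
    refine Integrable.mul_bdd (c := C) h1 hcont.aestronglyMeasurable ?_
    exact (ae_restrict_iff' (isClosed_tsupport ψ).measurableSet).2 (Eventually.of_forall hC)
  refine (integrableOn_iff_integrable_of_support_subset ?_).1 h2 |>.integrableOn
  intro x hx
  by_contra h
  exact hx (by simp [hsupp x h])

lemma IsWeakGrad.integrable_right {Ω : Set Plane} {G : Plane → GradVec m}
    (hG : MemLp G 2 (volume.restrict Ω)) {ψ : Plane → ℝ} (hψ : ContDiff ℝ ∞ ψ)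
    (hc : HasCompactSupport ψ) (i : Fin 2) (α : Fin m) :
    Integrable (fun x => G x (i, α) * ψ x) (volume.restrict Ω) := by
  have h1 : MemLp (fun x => G x (i, α)) 2 (volume.restrict Ω) :=
    (EuclideanSpace.proj (𝕜 := ℝ) (i, α)).comp_memLp' hG
  have h2 : MemLp ψ 2 (volume.restrict Ω) :=
    (hψ.continuous.memLp_of_hasCompactSupport hc).restrict Ω
  exact h1.integrable_mul h2

end Linearity

/-- The space `W_D(Ω)` as a linear space of pairs (function, weak gradient). -/
def sobolevSubmodule (Ω D : Set Plane) (m : ℕ) :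
    Submodule ℝ ((Plane →ₘ[volume.restrict Ω] Vec m) × Lp (GradVec m) 2 (volume.restrict Ω)) where
  carrier := {p | MemSobolev Ω D p}
  zero_mem' := by
    have h0 : (((0 : (Plane →ₘ[volume.restrict Ω] Vec m) ×
        Lp (GradVec m) 2 (volume.restrict Ω)).1 : Plane →ₘ[volume.restrict Ω] Vec m) :
        Plane → Vec m) =ᵐ[volume.restrict Ω] 0 := AEEqFun.coeFn_zero
    have h0' : (((0 : (Plane →ₘ[volume.restrict Ω] Vec m) ×
        Lp (GradVec m) 2 (volume.restrict Ω)).2 : Lp (GradVec m) 2 (volume.restrict Ω)) :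
        Plane → GradVec m) =ᵐ[volume.restrict Ω] 0 := Lp.coeFn_zero _ _ _
    refine ⟨?_, ?_, fun _ => 0, fun _ => contDiff_const, fun _ => EventuallyEq.rfl, ?_, ?_⟩
    · intro K hK _
      exact (integrable_zero _ _ _).congr (ae_eq_mono hK h0).symm
    · intro ψ _ _ _ i α
      refine Eq.trans (integral_eq_zero_of_ae ?_)
        (Eq.trans neg_zero.symm (congrArg Neg.neg (integral_eq_zero_of_ae ?_).symm))
      · filter_upwards [h0] with x hx
        rw [hx]
        simp
      · filter_upwards [h0'] with x hx
        rw [hx]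
        simp
    · have := ConvLp.zero (p := 2) h0'
      simp only [classicalGrad_zero]
      exact this
    · intro K hK _
      exact ConvLp.zero (ae_eq_mono hK h0)
  add_mem' := by
    rintro p q ⟨hp1, hp2, φ, hφ, hφD, hφc⟩ ⟨hq1, hq2, χ, hχ, hχD, hχc⟩
    have h0 := AEEqFun.coeFn_add p.1 q.1
    have h0' := Lp.coeFn_add p.2 q.2
    refine ⟨?_, ?_, fun k => φ k + χ k, fun k => (hφ k).add (hχ k), fun k => ?_, ?_, ?_⟩
    · intro K hK hKc
      exact ((hp1 K hK hKc).add (hq1 K hK hKc)).congr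
        (ae_eq_mono hK h0).symm
    · intro ψ h1 h2 h3 i α
      have e1 := integral_add (IsWeakGrad.integrable_left hp1 h1 h2 h3 i α)
        (IsWeakGrad.integrable_left hq1 h1 h2 h3 i α)
      have e2 := integral_add (IsWeakGrad.integrable_right (Lp.memLp p.2) h1 h2 i α)
        (IsWeakGrad.integrable_right (Lp.memLp q.2) h1 h2 i α)
      rw [hp2 ψ h1 h2 h3 i α, hq2 ψ h1 h2 h3 i α, ← neg_add, ← e2] at e1
      refine Eq.trans (integral_congr_ae ?_) (e1.trans (congrArg Neg.neg (integral_congr_ae ?_)))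
      · filter_upwards [h0] with x hx
        simp only [Prod.fst_add, hx, Pi.add_apply, PiLp.add_apply]
        ring
      · filter_upwards [h0'] with x hx
        simp only [Prod.snd_add, hx, Pi.add_apply, PiLp.add_apply]
        ring
    · filter_upwards [hφD k, hχD k] with x hx hx'
      simp [hx, hx']
    · have h := ConvLp.add (by norm_num)
        (fun k => (continuous_classicalGrad (hφ k)).aestronglyMeasurable)
        (fun k => (continuous_classicalGrad (hχ k)).aestronglyMeasurable)
        (Lp.aestronglyMeasurable p.2) (Lp.aestronglyMeasurable q.2) hφc.grad hχc.grad h0'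
      have e : ∀ k, classicalGrad (φ k + χ k) = classicalGrad (φ k) + classicalGrad (χ k) :=
        fun k => classicalGrad_add ((hφ k).differentiable (by simp))
          ((hχ k).differentiable (by simp))
      simp only [e]
      exact h
    · intro K hK hKc
      exact ConvLp.add le_rfl (fun k => (hφ k).continuous.aestronglyMeasurable)
        (fun k => (hχ k).continuous.aestronglyMeasurable)
        p.1.stronglyMeasurable.aestronglyMeasurable q.1.stronglyMeasurable.aestronglyMeasurable
        (hφc.loc K hK hKc) (hχc.loc K hK hKc) (ae_eq_mono hK h0)
  smul_mem' := by
    rintro c p ⟨hp1, hp2, φ, hφ, hφD, hφc⟩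
    have h0 := AEEqFun.coeFn_smul c p.1
    have h0' := Lp.coeFn_smul c p.2
    refine ⟨?_, ?_, fun k => c • φ k, fun k => contDiff_const.smul (hφ k), fun k => ?_, ?_, ?_⟩
    · intro K hK hKc
      exact (Integrable.smul c (hp1 K hK hKc)).congr
        (ae_eq_mono hK h0).symm
    · intro ψ h1 h2 h3 i α
      have e := congrArg (c * ·) (hp2 ψ h1 h2 h3 i α)
      simp only [mul_neg, ← integral_const_mul] at e
      refine Eq.trans (integral_congr_ae ?_) (e.trans (congrArg Neg.neg (integral_congr_ae ?_)))
      · filter_upwards [h0] with x hx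
        simp only [Prod.smul_fst, hx, Pi.smul_apply, PiLp.smul_apply, smul_eq_mul]
        ring
      · filter_upwards [h0'] with x hx
        simp only [Prod.smul_snd, hx, Pi.smul_apply, PiLp.smul_apply, smul_eq_mul]
        ring
    · filter_upwards [hφD k] with x hx
      simp [hx]
    · have e : ∀ k, classicalGrad (c • φ k) = c • classicalGrad (φ k) :=
        fun k => classicalGrad_smul c ((hφ k).differentiable (by simp))
      simp only [e]
      exact hφc.grad.smul c h0'
    · intro K hK hKc
      exact (hφc.loc K hK hKc).smul c (ae_eq_mono hK h0)

/-- The space `W_D(Ω)` of `ℝ^m`-valued functions with gradient in `L²(Ω)` that vanish on `D` in the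
Sobolev sense. An element is a function on `Ω` (up to equality a.e.) together with its weak gradient,
which it determines. The norm, defined below, is `‖∇u‖_{L²(Ω)}`. -/
def W (Ω D : Set Plane) (m : ℕ) : Type := sobolevSubmodule Ω D m

namespace W

variable {Ω D : Set Plane} {m : ℕ}

instance : AddCommGroup (W Ω D m) := inferInstanceAs (AddCommGroup (sobolevSubmodule Ω D m))

instance : Module ℝ (W Ω D m) := inferInstanceAs (Module ℝ (sobolevSubmodule Ω D m))

/-- The underlying function (a representative). -/
def fn (u : W Ω D m) : Plane → Vec m := u.1.1

/-- The weak gradient, as a linear map into `L²(Ω)`. -/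
def gradL : W Ω D m →ₗ[ℝ] Lp (GradVec m) 2 (volume.restrict Ω) :=
  (LinearMap.snd ℝ (Plane →ₘ[volume.restrict Ω] Vec m) _).comp (sobolevSubmodule Ω D m).subtype

/-- The weak gradient (a representative). -/
def grad (u : W Ω D m) : Plane → GradVec m := gradL u

/-- The homogeneous norm `‖u‖ = ‖∇u‖_{L²(Ω)}`; it is a seminorm, constants have norm zero. -/
instance : SeminormedAddCommGroup (W Ω D m) :=
  SeminormedAddCommGroup.induced (W Ω D m) (Lp (GradVec m) 2 (volume.restrict Ω)) gradL

instance : NormedSpace ℝ (W Ω D m) :=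
  NormedSpace.induced ℝ (W Ω D m) (Lp (GradVec m) 2 (volume.restrict Ω)) gradL

lemma norm_def (u : W Ω D m) : ‖u‖ = ‖gradL u‖ := rfl

end W

/-! ### Traces -/

/-- Arc length on the boundary of `Ω`. -/
def arcLength (Ω : Set Plane) : Measure Plane :=
  (Measure.hausdorffMeasure 1).restrict (frontier Ω)

/-- `g` is the trace of `u` on the boundary: there are functions, smooth up to the boundary, that
converge to `u` in the Sobolev space and whose boundary values converge to `g` in `L²(∂Ω)`. (On a
Lipschitz domain every `u` has exactly one trace.) -/
def IsTrace {Ω : Set Plane} {m : ℕ} (u : W Ω ∅ m) (g : Lp (Vec m) 2 (arcLength Ω)) : Prop :=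
  ∃ φ : ℕ → Plane → Vec m, (∀ k, ContDiff ℝ ∞ (φ k)) ∧ SobolevConv Ω φ u.fn u.grad ∧
    ConvLp 2 (arcLength Ω) φ g

section TraceLinearity

variable {Ω : Set Plane} {m : ℕ}

lemma IsTrace.add {u v : W Ω ∅ m} {g h : Lp (Vec m) 2 (arcLength Ω)} (hu : IsTrace u g)
    (hv : IsTrace v h) : IsTrace (u + v) (g + h) := by
  obtain ⟨φ, hφ, hφc, hφb⟩ := hu
  obtain ⟨χ, hχ, hχc, hχb⟩ := hv
  refine ⟨fun k => φ k + χ k, fun k => (hφ k).add (hχ k), ⟨?_, ?_⟩, ?_⟩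
  · have h := ConvLp.add (by norm_num)
      (fun k => (continuous_classicalGrad (hφ k)).aestronglyMeasurable)
      (fun k => (continuous_classicalGrad (hχ k)).aestronglyMeasurable)
      (Lp.aestronglyMeasurable (W.gradL u)) (Lp.aestronglyMeasurable (W.gradL v)) hφc.grad hχc.grad
      (Lp.coeFn_add (W.gradL u) (W.gradL v))
    have e : ∀ k, classicalGrad (φ k + χ k) = classicalGrad (φ k) + classicalGrad (χ k) :=
      fun k => classicalGrad_add ((hφ k).differentiable (by simp))
        ((hχ k).differentiable (by simp))
    simp only [e]
    exact h
  · intro K hK hKc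
    exact ConvLp.add le_rfl (fun k => (hφ k).continuous.aestronglyMeasurable)
      (fun k => (hχ k).continuous.aestronglyMeasurable)
      u.1.1.stronglyMeasurable.aestronglyMeasurable v.1.1.stronglyMeasurable.aestronglyMeasurable
      (hφc.loc K hK hKc) (hχc.loc K hK hKc)
      (ae_eq_mono hK (AEEqFun.coeFn_add u.1.1 v.1.1))
  · exact ConvLp.add (by norm_num) (fun k => (hφ k).continuous.aestronglyMeasurable)
      (fun k => (hχ k).continuous.aestronglyMeasurable)
      (Lp.aestronglyMeasurable g) (Lp.aestronglyMeasurable h) hφb hχb (Lp.coeFn_add g h)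

lemma IsTrace.smul (c : ℝ) {u : W Ω ∅ m} {g : Lp (Vec m) 2 (arcLength Ω)} (hu : IsTrace u g) :
    IsTrace (c • u) (c • g) := by
  obtain ⟨φ, hφ, hφc, hφb⟩ := hu
  refine ⟨fun k => c • φ k, fun k => contDiff_const.smul (hφ k), ⟨?_, ?_⟩, ?_⟩
  · have e : ∀ k, classicalGrad (c • φ k) = c • classicalGrad (φ k) :=
      fun k => classicalGrad_smul c ((hφ k).differentiable (by simp))
    simp only [e]
    exact hφc.grad.smul c (Lp.coeFn_smul c (W.gradL u))
  · intro K hK hKc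
    exact (hφc.loc K hK hKc).smul c
      (ae_eq_mono hK (AEEqFun.coeFn_smul c u.1.1))
  · exact hφb.smul c (Lp.coeFn_smul c g)

lemma IsTrace.zero : IsTrace (0 : W Ω ∅ m) 0 := by
  refine ⟨fun _ => 0, fun _ => contDiff_const, ⟨?_, ?_⟩, ?_⟩
  · have := ConvLp.zero (p := 2) (Lp.coeFn_zero (GradVec m) 2 (volume.restrict Ω))
    simp only [classicalGrad_zero]
    exact this
  · intro K hK _
    exact ConvLp.zero (ae_eq_mono hK AEEqFun.coeFn_zero)
  · exact ConvLp.zero (Lp.coeFn_zero (Vec m) 2 (arcLength Ω))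

end TraceLinearity

/-- The image of the trace map on `W_∅(Ω)`, as a linear subspace of `L²(∂Ω)`. -/
def traceSubmodule (Ω : Set Plane) (m : ℕ) : Submodule ℝ (Lp (Vec m) 2 (arcLength Ω)) where
  carrier := {g | ∃ u : W Ω ∅ m, IsTrace u g}
  zero_mem' := ⟨0, IsTrace.zero⟩
  add_mem' := by
    rintro g h ⟨u, hu⟩ ⟨v, hv⟩
    exact ⟨u + v, hu.add hv⟩
  smul_mem' := by
    rintro c g ⟨u, hu⟩
    exact ⟨c • u, hu.smul c⟩

/-- The trace space `W^{1/2}_∅(∂Ω)`, normed as the image of `W_∅(Ω)` under the trace map. -/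
def TraceSpace (Ω : Set Plane) (m : ℕ) : Type := traceSubmodule Ω m

namespace TraceSpace

variable {Ω : Set Plane} {m : ℕ}

instance : AddCommGroup (TraceSpace Ω m) := inferInstanceAs (AddCommGroup (traceSubmodule Ω m))

instance : Module ℝ (TraceSpace Ω m) := inferInstanceAs (Module ℝ (traceSubmodule Ω m))

/-- The trace of an element of `W_∅(Ω)` as an element of the trace space. -/
def of {u : W Ω ∅ m} {g : Lp (Vec m) 2 (arcLength Ω)} (h : IsTrace u g) : TraceSpace Ω m :=
  ⟨g, u, h⟩

/-- The quotient norm `inf {‖∇u‖_{L²(Ω)} : u has trace g}`. -/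
def quotNorm (g : TraceSpace Ω m) : ℝ := ⨅ u : {u : W Ω ∅ m // IsTrace u g.1}, ‖u.1‖

lemma bddBelow (g : TraceSpace Ω m) :
    BddBelow (range fun u : {u : W Ω ∅ m // IsTrace u g.1} => ‖u.1‖) :=
  ⟨0, by rintro _ ⟨u, rfl⟩; exact norm_nonneg _⟩

lemma quotNorm_le {g : TraceSpace Ω m} {u : W Ω ∅ m} (h : IsTrace u g.1) : quotNorm g ≤ ‖u‖ :=
  ciInf_le (bddBelow g) (⟨u, h⟩ : {u : W Ω ∅ m // IsTrace u g.1})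

instance (g : TraceSpace Ω m) : Nonempty {u : W Ω ∅ m // IsTrace u g.1} :=
  ⟨⟨g.2.choose, g.2.choose_spec⟩⟩

lemma quotNorm_nonneg (g : TraceSpace Ω m) : 0 ≤ quotNorm g := le_ciInf fun _ => norm_nonneg _

/-- The quotient norm as a seminorm. -/
def quotSeminorm (Ω : Set Plane) (m : ℕ) : Seminorm ℝ (TraceSpace Ω m) :=
  Seminorm.ofSMulLE quotNorm
    (le_antisymm (by simpa using quotNorm_le (g := (0 : TraceSpace Ω m)) IsTrace.zero)
      (quotNorm_nonneg _))
    (by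
      intro g h
      refine le_ciInf_add_ciInf ?_
      rintro ⟨u, hu⟩ ⟨v, hv⟩
      exact (quotNorm_le (g := g + h) (hu.add hv)).trans (norm_add_le u v))
    (by
      intro c g
      unfold quotNorm
      rw [Real.mul_iInf_of_nonneg (norm_nonneg c)]
      refine le_ciInf ?_
      rintro ⟨u, hu⟩
      exact (quotNorm_le (g := c • g) (hu.smul c)).trans (norm_smul c u).le)

instance : SeminormedAddCommGroup (TraceSpace Ω m) :=
  (quotSeminorm Ω m).toAddGroupSeminorm.toSeminormedAddCommGroup

instance : NormedSpace ℝ (TraceSpace Ω m) where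
  norm_smul_le c g := (map_smul_eq_mul (quotSeminorm Ω m) c g).le

lemma norm_def (g : TraceSpace Ω m) : ‖g‖ = ⨅ u : {u : W Ω ∅ m // IsTrace u g.1}, ‖u.1‖ := rfl

end TraceSpace

/-- `W^{-1}_∅(Ω)`, the dual of `W_∅(Ω)`, with the dual norm. -/
abbrev WDual (Ω : Set Plane) (m : ℕ) : Type := StrongDual ℝ (W Ω ∅ m)

/-- `W^{-1/2}_∅(∂Ω)`, the dual of the trace space, with the dual norm. -/
abbrev TraceDual (Ω : Set Plane) (m : ℕ) : Type := StrongDual ℝ (TraceSpace Ω m)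

/-! ### The operator and the weak Neumann problem -/

/-- Coefficients `a i j α β`, the entry `a^{ij}_{αβ}`. -/
abbrev Coeff (m : ℕ) : Type := Fin 2 → Fin 2 → Fin m → Fin m → Plane → ℝ

/-- The coefficients are measurable on `Ω` and bounded there by `M`. -/
def Coeff.IsBounded {m : ℕ} (a : Coeff m) (Ω : Set Plane) (M : ℝ) : Prop :=
  ∀ i j α β, AEMeasurable (a i j α β) (volume.restrict Ω) ∧
    ∀ᵐ x ∂volume.restrict Ω, |a i j α β x| ≤ M

/-- The integrand `a^{ij}_{αβ} ∂_j u^β ∂_i φ^α` at the point `x`, for the values `P` of `∇u(x)` and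
`Q` of `∇φ(x)`. -/
def Coeff.density {m : ℕ} (a : Coeff m) (x : Plane) (P Q : GradVec m) : ℝ :=
  ∑ i, ∑ j, ∑ α, ∑ β, a i j α β x * P (j, β) * Q (i, α)

/-- The form `A(u, φ)`. -/
def Coeff.form {m : ℕ} (a : Coeff m) {Ω D : Set Plane} (u φ : W Ω D m) : ℝ :=
  ∫ x in Ω, a.density x (u.grad x) (φ.grad x)

/-- Local ellipticity with constant `M`, for the choice `loc x ρ` of the local domains `Ω_ρ(x)`. -/
def Coeff.IsLocallyElliptic {m : ℕ} (a : Coeff m) (Ω : Set Plane) (M r₀ : ℝ)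
    (loc : Plane → ℝ → Set Plane) : Prop :=
  ∀ x ∈ closure Ω, ∀ ρ : ℝ, 0 < ρ → ρ < r₀ → ∀ (u : W Ω ∅ m) (c : Vec m),
    M⁻¹ * ∫ y in loc x ρ, ‖u.grad y‖ ^ 2 ≤
      ∫ y in loc x ρ, (a.density y (u.grad y) (u.grad y) + (ρ ^ 2)⁻¹ * ‖u.fn y - c‖ ^ 2)

/-- Coercivity of the form on `W_D(Ω)` with constant `M`. -/
def Coeff.IsCoercive {m : ℕ} (a : Coeff m) (Ω D : Set Plane) (M : ℝ) : Prop :=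
  ∀ u : W Ω D m, M⁻¹ * ∫ x in Ω, ‖u.grad x‖ ^ 2 ≤ a.form u u

/-- The solutions `𝒱` of the homogeneous Neumann problem for `L`. -/
def Coeff.nullSpace {m : ℕ} (a : Coeff m) (Ω : Set Plane) : Set (W Ω ∅ m) :=
  {v | ∀ φ : W Ω ∅ m, a.form v φ = 0}

/-- The solutions `𝒱*` of the homogeneous Neumann problem for the adjoint `L*`. -/
def Coeff.adjointNullSpace {m : ℕ} (a : Coeff m) (Ω : Set Plane) : Set (W Ω ∅ m) :=
  {v | ∀ φ : W Ω ∅ m, a.form φ v = 0}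

/-- The compatibility condition `⟨f_N, v⟩_{∂Ω} - ⟨f, v⟩ = 0` for `v ∈ 𝒱*`. -/
def Coeff.Compatible {m : ℕ} (a : Coeff m) {Ω : Set Plane} (f : WDual Ω m)
    (f_N : TraceDual Ω m) : Prop :=
  ∀ v ∈ a.adjointNullSpace Ω, ∀ (g : Lp (Vec m) 2 (arcLength Ω)) (hg : IsTrace v g),
    f_N (TraceSpace.of hg) - f v = 0

/-- `u` solves the weak Neumann problem with data `f`, `f_N`, normalized by
`∫_{∂Ω} u^α v^α dσ = 0` for `v ∈ 𝒱`. -/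
structure Coeff.IsWeakSolution {m : ℕ} (a : Coeff m) {Ω : Set Plane} (f : WDual Ω m)
    (f_N : TraceDual Ω m) (u : W Ω ∅ m) : Prop where
  weak : ∀ (φ : W Ω ∅ m) (g : Lp (Vec m) 2 (arcLength Ω)) (hg : IsTrace φ g),
    a.form u φ = - f φ + f_N (TraceSpace.of hg)
  normalized : ∀ v ∈ a.nullSpace Ω, ∀ g h : Lp (Vec m) 2 (arcLength Ω),
    IsTrace u g → IsTrace v h → ∫ x, ∑ α, g x α * h x α ∂arcLength Ω = 0

end NeumannProblem

end

open NeumannProblem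

/-!
The weak Neumann problem is solved by the Fredholm alternative in a Hilbert space.

The bilinear form is coercive up to finitely many functionals. First, Gårding's inequality
`M⁻¹ ‖∇u‖² ≤ A(u, u) + Λ ‖u‖²` holds in `L²(Ω)`: each point of `closure Ω` has a local domain that is
a relative neighborhood of it, and the local ellipticity condition is summed over a quadratic
partition of unity (`Coeff.IsLocallyElliptic.exists_garding`). Second, up to a small multiple of
the Sobolev norm, `‖u‖²` is bounded by finitely many squares of mean values of `u`
(`exists_averages`): thin strips along the boundary carry little of the `L²` norm, and on the
remaining compact part of `Ω` one applies Poincaré's inequality on the cells of a fine grid.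
Together these make the form coercive after adding a form of finite rank
(`exists_coercive_add_finiteRank`), so the operator of the form is Fredholm by the Lax-Milgram
theorem (`isFredholm_of_coercive_add_finiteRank`).

A functional therefore lies in the range if and only if it annihilates `𝒱*`, which is the
compatibility condition. The normalization selects one solution and yields the estimate, provided
that the trace is injective on the finite-dimensional space `𝒱`
(`exists_bound_normalized_solution`). This is where coercivity on `W_{∂Ω}(Ω)` enters: a function with
vanishing trace is a limit of smooth functions that vanish near the boundary
(`W.exists_of_isTrace_zero`), so an element of `𝒱` with vanishing trace has vanishing gradient, and
then it is zero (`Coeff.IsCoercive.eq_zero`).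

The Hilbert space is the closure of the pairs `(φ, ∇φ)`, `φ` smooth, in `L²(Ω) × L²(Ω)`. It is
identified with `W_∅(Ω)`, whose definition only involves convergence of the functions in `L¹_loc(Ω)`,
by Poincaré's inequality `exists_sqNorm_le` (`W.toPair`). The inequalities of Poincaré, Rellich and
trace type are proved for smooth functions and extended by density; the trace is a bounded operator
on this space (`exists_trace_operator`).
-/

open MeasureTheory Filter Topology Set
open scoped ENNReal ContDiff InnerProductSpace

noncomputable section

namespace NeumannProblem

/-! ### The Fredholm alternative for coercive forms of finite-rank defect -/

section FredholmAlternative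

open scoped InnerProductSpace LinearMap.FiniteRangeSetoid
open InnerProductSpace

variable {H Y κ : Type*} [NormedAddCommGroup H] [InnerProductSpace ℝ H] [CompleteSpace H]
  [NormedAddCommGroup Y] [InnerProductSpace ℝ Y] [Fintype κ]

/-- A bounded bilinear form that is coercive up to finitely many functionals is represented by a
Fredholm operator: it differs by finite rank from the isomorphism that the Lax-Milgram theorem
attaches to the coercive form `B u φ + ∑ i, ℓ i u * ℓ i φ`. -/
theorem isFredholm_of_coercive_add_finiteRank (B : H →L[ℝ] H →L[ℝ] ℝ) (ℓ : κ → StrongDual ℝ H)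
    {c : ℝ} (hc : 0 < c) (hB : ∀ u, c * ‖u‖ ^ 2 ≤ B u u + ∑ i, (ℓ i u) ^ 2) :
    (continuousLinearMapOfBilin B : H →L[ℝ] H).IsFredholm := by
  set B' : H →L[ℝ] H →L[ℝ] ℝ := B + ∑ i, (ℓ i).smulRight (ℓ i) with hB'
  have hB'_apply : ∀ u φ, B' u φ = B u φ + ∑ i, ℓ i u * ℓ i φ := by
    intro u φ
    simp [hB']
  have hco : IsCoercive B' := by
    refine ⟨c, hc, fun u => ?_⟩
    rw [hB'_apply, mul_assoc, ← pow_two]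
    simpa only [pow_two] using hB u
  let e := hco.continuousLinearEquivOfBilin
  refine ContinuousLinearMap.IsFredholm.of_isQuasiInverse (v := (e.symm : H →L[ℝ] H)) ?_
  have h1 := LinearEquiv.isQuasiInverse e.toLinearEquiv
  refine h1.congr (Setoid.refl _) ?_
  rw [LinearMap.FiniteRangeSetoid.equiv_iff_hasFiniteRange]
  let r : H →ₗ[ℝ] (κ → ℝ) := LinearMap.pi fun i => (ℓ i : H →ₗ[ℝ] ℝ)
  let s : (κ → ℝ) →ₗ[ℝ] H := Fintype.linearCombination ℝ fun i => (toDual ℝ H).symm (ℓ i)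
  have h2 : ((continuousLinearMapOfBilin B : H →L[ℝ] H) : H →ₗ[ℝ] H) -
      (e.toLinearEquiv : H →ₗ[ℝ] H) = - (s ∘ₗ r) := by
    ext u
    refine ext_inner_right ℝ fun φ => ?_
    have h3 : ⟪e u, φ⟫_ℝ = B' u φ := hco.continuousLinearEquivOfBilin_apply u φ
    have h4 : ⟪(continuousLinearMapOfBilin B : H →L[ℝ] H) u, φ⟫_ℝ = B u φ :=
      continuousLinearMapOfBilin_apply B u φ
    have h5 : ⟪s (r u), φ⟫_ℝ = ∑ i, ℓ i u * ℓ i φ := by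
      simp [s, r, Fintype.linearCombination_apply, sum_inner, inner_smul_left]
    change ⟪(continuousLinearMapOfBilin B : H →L[ℝ] H) u - e u, φ⟫_ℝ = ⟪-(s (r u)), φ⟫_ℝ
    rw [inner_sub_left, inner_neg_left, h3, h4, h5, hB'_apply]
    ring
  rw [h2]
  exact (LinearMap.HasFiniteRange.of_finite_dom.comp_right r).neg

/-- The Fredholm alternative for such a form. Uniqueness is restored by the normalization
`τ u ⊥ τ N`, where `N` is the finite-dimensional null space: as `τ` is injective on `N`, every
solution can be corrected by exactly one element of `N`. -/
theorem exists_bound_normalized_solution (B : H →L[ℝ] H →L[ℝ] ℝ) (ℓ : κ → StrongDual ℝ H)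
    {c : ℝ} (hc : 0 < c) (hB : ∀ u, c * ‖u‖ ^ 2 ≤ B u u + ∑ i, (ℓ i u) ^ 2)
    (τ : H →L[ℝ] Y) (hτ : ∀ u, (∀ φ, B u φ = 0) → τ u = 0 → u = 0) :
    ∃ C : ℝ, 0 ≤ C ∧ ∀ F : StrongDual ℝ H, (∀ v, (∀ φ, B φ v = 0) → F v = 0) →
      (∃! u, (∀ φ, B u φ = F φ) ∧ ∀ v, (∀ φ, B v φ = 0) → ⟪τ u, τ v⟫_ℝ = 0) ∧
      ∀ u, (∀ φ, B u φ = F φ) → (∀ v, (∀ φ, B v φ = 0) → ⟪τ u, τ v⟫_ℝ = 0) →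
        ‖u‖ ≤ C * ‖F‖ := by
  have hfred := isFredholm_of_coercive_add_finiteRank B ℓ hc hB
  set A : H →L[ℝ] H := continuousLinearMapOfBilin B with hA
  have hA_apply : ∀ u φ, ⟪A u, φ⟫_ℝ = B u φ := fun u φ => continuousLinearMapOfBilin_apply B u φ
  have hker : ∀ u, u ∈ A.ker ↔ ∀ φ, B u φ = 0 := by
    intro u
    rw [LinearMap.mem_ker]
    constructor
    · intro h φ
      rw [← hA_apply]
      change ⟪(A : H →ₗ[ℝ] H) u, φ⟫_ℝ = 0
      rw [h, inner_zero_left]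
    · intro h
      refine ext_inner_right ℝ fun φ => ?_
      rw [inner_zero_left, ← h φ]
      exact hA_apply u φ
  have hfin : FiniteDimensional ℝ A.ker := hfred.finite_ker
  -- `K` is the finite-dimensional space `τ N`, and `U` is the space of normalized elements.
  let K : Submodule ℝ Y := A.ker.map (τ : H →ₗ[ℝ] Y)
  let U : Submodule ℝ H := Kᗮ.comap (τ : H →ₗ[ℝ] Y)
  have hU : ∀ u, u ∈ U ↔ ∀ v, (∀ φ, B v φ = 0) → ⟪τ u, τ v⟫_ℝ = 0 := by
    intro u
    simp only [U, K, Submodule.mem_comap, Submodule.mem_orthogonal', Submodule.mem_map,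
      forall_exists_index, and_imp, forall_apply_eq_imp_iff₂, hker]
    rfl
  have hUclosed : IsClosed (U : Set H) := by
    have : IsClosed (Kᗮ : Set Y) := Submodule.isClosed_orthogonal K
    exact this.preimage τ.continuous
  have hdisj : ∀ u, u ∈ A.ker → u ∈ U → u = 0 := by
    intro u h1 h2
    refine hτ u ((hker u).1 h1) ?_
    exact inner_self_eq_zero.1 ((hU u).1 h2 u ((hker u).1 h1))
  have hcorr : ∀ u, ∃ v ∈ A.ker, u - v ∈ U := by
    intro u
    -- The correction is a preimage of the orthogonal projection of `τ u` onto `K`.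
    have : FiniteDimensional ℝ K := inferInstance
    obtain ⟨v, hv, hvu⟩ := (Submodule.mem_map).1 (K.starProjection_apply_mem (τ u))
    refine ⟨v, hv, ?_⟩
    change τ (u - v) ∈ Kᗮ
    have hvu' : τ v = K.starProjection (τ u) := hvu
    rw [map_sub, hvu']
    exact K.sub_starProjection_mem_orthogonal (τ u)
  have : CompleteSpace U := hUclosed.completeSpace_coe
  let A' : U →L[ℝ] H := A.comp U.subtypeL
  have hA'inj : Function.Injective A' := by
    rw [injective_iff_map_eq_zero]
    intro u hu
    exact Subtype.ext (hdisj u hu u.2)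
  have hrange : Set.range A' = Set.range A := by
    refine Set.Subset.antisymm (by rintro _ ⟨u, rfl⟩; exact ⟨u, rfl⟩) ?_
    rintro _ ⟨u, rfl⟩
    obtain ⟨v, hv, hvu⟩ := hcorr u
    refine ⟨⟨u - v, hvu⟩, ?_⟩
    change A (u - v) = A u
    have : A v = 0 := hv
    rw [map_sub, this, sub_zero]
  obtain ⟨C, hC⟩ := A'.antilipschitz_of_injective_of_isClosed_range hA'inj
    (by rw [hrange]; exact hfred.isClosed_range)
  have hbound : ∀ u ∈ U, ‖u‖ ≤ C * ‖A u‖ := by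
    intro u hu
    have h := hC.le_mul_dist ⟨u, hu⟩ 0
    rw [map_zero, dist_zero_right, dist_zero_right] at h
    exact h
  have hsol : ∀ (F : StrongDual ℝ H) u, (∀ φ, B u φ = F φ) ↔ A u = (toDual ℝ H).symm F := by
    intro F u
    constructor
    · intro h
      refine ext_inner_right ℝ fun φ => ?_
      rw [hA_apply, h]
      simp
    · intro h φ
      rw [← hA_apply, h]
      simp
  refine ⟨C, C.2, fun F hF => ⟨?_, ?_⟩⟩
  · have hmem : (toDual ℝ H).symm F ∈ A.range := by
      have : CompleteSpace A.range := hfred.isClosed_range.completeSpace_coe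
      rw [← A.range.orthogonal_orthogonal, Submodule.mem_orthogonal']
      intro w hw
      rw [toDual_symm_apply]
      refine hF w fun φ => ?_
      rw [← hA_apply]
      exact hw _ ⟨φ, rfl⟩
    obtain ⟨u, hu⟩ := hmem
    obtain ⟨v, hv, hvu⟩ := hcorr u
    have hv0 : A v = 0 := hv
    have hu0 : A u = _ := hu
    refine ⟨u - v, ⟨(hsol F _).2 ?_, (hU _).1 hvu⟩, ?_⟩
    · rw [map_sub, hv0, sub_zero, hu0]
    · rintro w ⟨hw1, hw2⟩
      have h1 : A (w - (u - v)) = 0 := by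
        rw [map_sub, map_sub, hv0, hu0, (hsol F w).1 hw1, sub_zero, sub_self]
      exact sub_eq_zero.1 (hdisj _ h1 (U.sub_mem ((hU w).2 hw2) hvu))
  · intro u h1 h2
    refine (hbound u ((hU u).2 h2)).trans (le_of_eq ?_)
    rw [(hsol F u).1 h1, LinearIsometryEquiv.norm_map]

end FredholmAlternative

/-- The square of the `L²(μ)` norm, with values in `[0, ∞]`. -/
def sqNorm {X F : Type*} [MeasurableSpace X] [NormedAddCommGroup F] (μ : Measure X) (f : X → F) :
    ℝ≥0∞ :=
  ∫⁻ x, ‖f x‖ₑ ^ 2 ∂μ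

lemma ENNReal_add_sq_le (a b : ℝ≥0∞) : (a + b) ^ 2 ≤ 2 * a ^ 2 + 2 * b ^ 2 := by
  rcases eq_or_ne a ⊤ with rfl | ha
  · simp
  rcases eq_or_ne b ⊤ with rfl | hb
  · simp
  lift a to NNReal using ha
  lift b to NNReal using hb
  norm_cast
  rw [← mul_add]
  exact add_sq_le

/-- The Cauchy-Schwarz inequality against the constant function `1`. -/
lemma lintegral_sq_le {X : Type*} [MeasurableSpace X] (μ : Measure X) {f : X → ℝ≥0∞}
    (hf : AEMeasurable f μ) : (∫⁻ x, f x ∂μ) ^ 2 ≤ μ univ * ∫⁻ x, f x ^ 2 ∂μ := by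
  have h := ENNReal.lintegral_mul_le_Lp_mul_Lq μ Real.HolderConjugate.two_two
    (aemeasurable_const (b := (1 : ℝ≥0∞))) hf
  have h1 : (fun a => ((fun _ => 1 : X → ℝ≥0∞) * f) a) = f := by ext; simp
  rw [h1] at h
  refine (pow_le_pow_left₀ zero_le h 2).trans (le_of_eq ?_)
  rw [mul_pow, ← ENNReal.rpow_natCast, ← ENNReal.rpow_natCast, ← ENNReal.rpow_mul,
    ← ENNReal.rpow_mul]
  norm_num

section Line

variable {F : Type*} [NormedAddCommGroup F] [NormedSpace ℝ F] [CompleteSpace F]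

/-- The fundamental theorem of calculus and the Cauchy-Schwarz inequality on an interval. -/
lemma enorm_sub_sq_le_of_hasDerivAt {f f' : ℝ → F} (hf : ∀ x, HasDerivAt f (f' x) x)
    (hf' : Continuous f') {J : Set ℝ} (hJ : J.OrdConnected) {s t : ℝ} (hs : s ∈ J)
    (ht : t ∈ J) : ‖f s - f t‖ₑ ^ 2 ≤ volume J * ∫⁻ x in J, ‖f' x‖ₑ ^ 2 := by
  have h1 : f s - f t = ∫ x in t..s, f' x :=
    (intervalIntegral.integral_eq_sub_of_hasDerivAt (fun x _ => hf x)
      (hf'.intervalIntegrable _ _)).symm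
  have h2 : ‖f s - f t‖ₑ ≤ ∫⁻ x in J, ‖f' x‖ₑ := by
    have h3 : ‖f s - f t‖ₑ = ‖∫ x in uIoc t s, f' x‖ₑ := by
      rw [h1, ← ofReal_norm, ← ofReal_norm, intervalIntegral.norm_intervalIntegral_eq]
    rw [h3]
    refine (enorm_integral_le_lintegral_enorm _).trans (lintegral_mono_set ?_)
    exact uIoc_subset_uIcc.trans (hJ.uIcc_subset ht hs)
  have h4 := lintegral_sq_le (volume.restrict J) (f := fun x => ‖f' x‖ₑ)
    hf'.enorm.measurable.aemeasurable
  rw [Measure.restrict_apply_univ] at h4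
  exact (pow_le_pow_left₀ zero_le h2 2).trans h4

end Line

/-! ### Cartesian coordinates in the plane -/

/-- The point with the coordinates `s`, `t` in the frame `T`. -/
def pt (T : Plane ≃ₗᵢ[ℝ] Plane) (s t : ℝ) : Plane := T.symm !₂[s, t]

section Coordinates

variable (T : Plane ≃ₗᵢ[ℝ] Plane)

@[simp] lemma frame_pt_zero (s t : ℝ) : T (pt T s t) 0 = s := by simp [pt]

@[simp] lemma frame_pt_one (s t : ℝ) : T (pt T s t) 1 = t := by simp [pt]

lemma pt_frame (y : Plane) : pt T (T y 0) (T y 1) = y := by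
  unfold pt
  rw [LinearIsometryEquiv.symm_apply_eq]
  ext i
  fin_cases i <;> simp

lemma continuous_pt : Continuous fun p : ℝ × ℝ => pt T p.1 p.2 := by
  unfold pt
  refine T.symm.continuous.comp ?_
  refine (PiLp.continuous_toLp 2 _).comp ?_
  fun_prop

lemma measurePreserving_frame :
    MeasurePreserving (fun y : Plane => (T y 0, T y 1)) volume volume :=
  (volume_preserving_finTwoArrow ℝ).comp
    ((EuclideanSpace.volume_preserving_symm_measurableEquiv_toLp (Fin 2)).comp
      T.measurePreserving)

lemma lintegral_eq_lintegral_pt {f : Plane → ℝ≥0∞} (hf : Measurable f) :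
    ∫⁻ y, f y = ∫⁻ s, ∫⁻ t, f (pt T s t) := by
  have hm : Measurable fun p : ℝ × ℝ => f (pt T p.1 p.2) := hf.comp (continuous_pt T).measurable
  have h := (measurePreserving_frame T).lintegral_comp hm
  simp only [pt_frame] at h
  rw [h, Measure.volume_eq_prod, lintegral_prod _ hm.aemeasurable]

/-- Fubini's theorem over a region between two curves, or more generally over a set that is
given by its slices. -/
lemma setLIntegral_eq_lintegral_slices {f : Plane → ℝ≥0∞} (hf : Measurable f) {A : Set Plane}
    (hA : MeasurableSet A) {I : Set ℝ} (hI : MeasurableSet I) {J : ℝ → Set ℝ}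
    (hJ : ∀ s, MeasurableSet (J s)) (h : ∀ y, y ∈ A ↔ T y 0 ∈ I ∧ T y 1 ∈ J (T y 0)) :
    ∫⁻ y in A, f y = ∫⁻ s in I, ∫⁻ t in J s, f (pt T s t) := by
  rw [← lintegral_indicator hA, lintegral_eq_lintegral_pt T (hf.indicator hA),
    ← lintegral_indicator hI]
  refine lintegral_congr fun s => ?_
  by_cases hs : s ∈ I
  · rw [indicator_of_mem hs, ← lintegral_indicator (hJ s)]
    refine lintegral_congr fun t => ?_
    by_cases ht : t ∈ J s
    · rw [indicator_of_mem ht, indicator_of_mem ((h _).2 (by simp [hs, ht]))]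
    · rw [indicator_of_notMem ht, indicator_of_notMem (fun h' => ht (by simpa [hs] using (h _).1 h'))]
  · rw [indicator_of_notMem hs]
    refine (lintegral_congr fun t => ?_).trans lintegral_zero
    rw [indicator_of_notMem (fun h' => hs (by simpa using ((h _).1 h').1))]

end Coordinates

section Gradient

variable {m : ℕ}

lemma norm_fderiv_apply_le (φ : Plane → Vec m) (x v : Plane) :
    ‖fderiv ℝ φ x v‖ ≤ ‖classicalGrad φ x‖ * ‖v‖ := by
  have hv : v = ∑ i, v i • EuclideanSpace.single i (1 : ℝ) := by
    simpa using ((EuclideanSpace.basisFun (Fin 2) ℝ).sum_repr v).symm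
  refine le_of_sq_le_sq ?_ (by positivity)
  have h1 : ∀ α, fderiv ℝ φ x v α = ∑ i, v i * classicalGrad φ x (i, α) := by
    intro α
    conv_lhs => rw [hv]
    simp [classicalGrad]
  rw [EuclideanSpace.norm_sq_eq, mul_pow, EuclideanSpace.norm_sq_eq (classicalGrad φ x),
    EuclideanSpace.norm_sq_eq v, Fintype.sum_prod_type_right, Finset.sum_mul]
  refine Finset.sum_le_sum fun α _ => ?_
  rw [h1]
  simp only [Real.norm_eq_abs, sq_abs]
  rw [mul_comm]
  exact Finset.sum_mul_sq_le_sq_mul_sq _ _ _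

lemma enorm_fderiv_apply_le (φ : Plane → Vec m) (x : Plane) {v : Plane} (hv : ‖v‖ ≤ 1) :
    ‖fderiv ℝ φ x v‖ₑ ≤ ‖classicalGrad φ x‖ₑ := by
  rw [← ofReal_norm, ← ofReal_norm]
  refine ENNReal.ofReal_le_ofReal ((norm_fderiv_apply_le φ x v).trans ?_)
  exact mul_le_of_le_one_right (norm_nonneg _) hv

variable {φ : Plane → Vec m} (hφ : ContDiff ℝ ∞ φ) (T : Plane ≃ₗᵢ[ℝ] Plane)

include hφ

lemma measurable_enorm_classicalGrad_sq : Measurable fun y => ‖classicalGrad φ y‖ₑ ^ 2 :=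
  ((continuous_classicalGrad hφ).enorm.measurable).pow_const 2

lemma measurable_enorm_sq : Measurable fun y => ‖φ y‖ₑ ^ 2 :=
  (hφ.continuous.enorm.measurable).pow_const 2

lemma enorm_sub_sq_le_of_line (c : ℝ → Plane) (v : Plane) (hv : ‖v‖ ≤ 1)
    (hc : ∀ t, HasDerivAt c v t) {J : Set ℝ} (hJ : J.OrdConnected) {t t' : ℝ} (ht : t ∈ J)
    (ht' : t' ∈ J) :
    ‖φ (c t) - φ (c t')‖ₑ ^ 2 ≤ volume J * ∫⁻ τ in J, ‖classicalGrad φ (c τ)‖ₑ ^ 2 := by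
  have hd : ∀ τ, HasDerivAt (fun τ => φ (c τ)) (fderiv ℝ φ (c τ) v) τ := fun τ =>
    ((hφ.differentiable (by simp)) (c τ)).hasFDerivAt.comp_hasDerivAt τ (hc τ)
  have hcc : Continuous c := continuous_iff_continuousAt.2 fun t => (hc t).continuousAt
  have hcont : Continuous fun τ => fderiv ℝ φ (c τ) v :=
    ((hφ.continuous_fderiv (by simp)).comp hcc).clm_apply continuous_const
  refine (enorm_sub_sq_le_of_hasDerivAt hd hcont hJ ht ht').trans ?_
  gcongr
  exact enorm_fderiv_apply_le φ _ hv

lemma enorm_sub_sq_le_vertical (s : ℝ) {J : Set ℝ} (hJ : J.OrdConnected) {t t' : ℝ}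
    (ht : t ∈ J) (ht' : t' ∈ J) :
    ‖φ (pt T s t) - φ (pt T s t')‖ₑ ^ 2 ≤
      volume J * ∫⁻ τ in J, ‖classicalGrad φ (pt T s τ)‖ₑ ^ 2 := by
  refine enorm_sub_sq_le_of_line hφ (fun t => pt T s t)
    (T.symm (EuclideanSpace.single 1 1)) (by simp) (fun t => ?_) hJ ht ht'
  have h : (fun t => pt T s t) = fun t => t • T.symm (EuclideanSpace.single 1 1) + pt T s 0 := by
    ext1 t
    rw [pt, pt, ← map_smul, ← map_add]
    congr 1
    ext i
    fin_cases i <;> simp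
  rw [h]
  simpa using ((hasDerivAt_id t).smul_const (T.symm (EuclideanSpace.single 1 1))).add_const
    (pt T s 0)

lemma enorm_sub_sq_le_horizontal (t : ℝ) {I : Set ℝ} (hI : I.OrdConnected) {s s' : ℝ}
    (hs : s ∈ I) (hs' : s' ∈ I) :
    ‖φ (pt T s t) - φ (pt T s' t)‖ₑ ^ 2 ≤
      volume I * ∫⁻ τ in I, ‖classicalGrad φ (pt T τ t)‖ₑ ^ 2 := by
  refine enorm_sub_sq_le_of_line hφ (fun s => pt T s t)
    (T.symm (EuclideanSpace.single 0 1)) (by simp) (fun s => ?_) hI hs hs'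
  have h : (fun s => pt T s t) = fun s => s • T.symm (EuclideanSpace.single 0 1) + pt T 0 t := by
    ext1 s
    rw [pt, pt, ← map_smul, ← map_add]
    congr 1
    ext i
    fin_cases i <;> simp
  rw [h]
  simpa using ((hasDerivAt_id s).smul_const (T.symm (EuclideanSpace.single 0 1))).add_const
    (pt T 0 t)

end Gradient

/-! ### Poincaré's inequality on squares -/

section Square

variable {m : ℕ} {φ : Plane → Vec m} (hφ : ContDiff ℝ ∞ φ) (T : Plane ≃ₗᵢ[ℝ] Plane)

/-- The product of the intervals `I` and `J` in the coordinates of the frame `T`. -/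
def box (T : Plane ≃ₗᵢ[ℝ] Plane) (I J : Set ℝ) : Set Plane := {y | T y 0 ∈ I ∧ T y 1 ∈ J}

lemma measurable_frame_apply (i : Fin 2) : Measurable fun y : Plane => T y i :=
  (show Continuous fun y : Plane => T y i by fun_prop).measurable

lemma measurableSet_box {I J : Set ℝ} (hI : MeasurableSet I) (hJ : MeasurableSet J) :
    MeasurableSet (box T I J) :=
  (measurable_frame_apply T 0 hI).inter (measurable_frame_apply T 1 hJ)

lemma setLIntegral_box {I J : Set ℝ} (hI : MeasurableSet I) (hJ : MeasurableSet J)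
    {f : Plane → ℝ≥0∞} (hf : Measurable f) :
    ∫⁻ y in box T I J, f y = ∫⁻ s in I, ∫⁻ t in J, f (pt T s t) :=
  setLIntegral_eq_lintegral_slices T hf (measurableSet_box T hI hJ) hI (fun _ => hJ)
    fun _ => Iff.rfl

lemma setLIntegral_box_swap {I J : Set ℝ} (hI : MeasurableSet I) (hJ : MeasurableSet J)
    {f : Plane → ℝ≥0∞} (hf : Measurable f) :
    ∫⁻ y in box T I J, f y = ∫⁻ t in J, ∫⁻ s in I, f (pt T s t) := by
  rw [setLIntegral_box T hI hJ hf]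
  exact lintegral_lintegral_swap (hf.comp (continuous_pt T).measurable).aemeasurable

lemma volume_box {I J : Set ℝ} (hI : MeasurableSet I) (hJ : MeasurableSet J) :
    volume (box T I J) = volume I * volume J := by
  have h := setLIntegral_box T hI hJ (f := fun _ => 1) measurable_const
  simp only [lintegral_one, Measure.restrict_apply_univ, lintegral_const] at h
  rw [h, mul_comm]

include hφ

lemma lintegral_lintegral_enorm_sub_sq_le {I J : Set ℝ} (hI : MeasurableSet I)
    (hJ : MeasurableSet J) (hIc : I.OrdConnected) (hJc : J.OrdConnected) {L : ℝ≥0∞}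
    (hIL : volume I = L) (hJL : volume J = L) :
    ∫⁻ x in box T I J, ∫⁻ y in box T I J, ‖φ x - φ y‖ₑ ^ 2 ≤
      4 * L ^ 4 * sqNorm (volume.restrict (box T I J)) (classicalGrad φ) := by
  set a : ℝ → ℝ≥0∞ := fun t => ∫⁻ σ in I, ‖classicalGrad φ (pt T σ t)‖ₑ ^ 2 with ha
  set b : ℝ → ℝ≥0∞ := fun s => ∫⁻ τ in J, ‖classicalGrad φ (pt T s τ)‖ₑ ^ 2 with hb
  have hG : Measurable fun p : ℝ × ℝ => ‖classicalGrad φ (pt T p.1 p.2)‖ₑ ^ 2 :=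
    (measurable_enorm_classicalGrad_sq hφ).comp (continuous_pt T).measurable
  have ham : Measurable a := by
    rw [ha]
    exact hG.lintegral_prod_left'
  have hbm : Measurable b := by
    rw [hb]
    exact hG.lintegral_prod_right'
  have haD : ∫⁻ t in J, a t = sqNorm (volume.restrict (box T I J)) (classicalGrad φ) :=
    (setLIntegral_box_swap T hI hJ (measurable_enorm_classicalGrad_sq hφ)).symm
  have hbD : ∫⁻ s in I, b s = sqNorm (volume.restrict (box T I J)) (classicalGrad φ) :=
    (setLIntegral_box T hI hJ (measurable_enorm_classicalGrad_sq hφ)).symm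
  have key : ∀ x ∈ box T I J, ∀ y ∈ box T I J,
      ‖φ x - φ y‖ₑ ^ 2 ≤ 2 * L * a (T x 1) + 2 * L * b (T y 0) := by
    intro x hx y hy
    have h1 := enorm_sub_sq_le_horizontal hφ T (T x 1) hIc hx.1 hy.1
    have h2 := enorm_sub_sq_le_vertical hφ T (T y 0) hJc hx.2 hy.2
    rw [pt_frame, hIL] at h1
    rw [pt_frame, hJL] at h2
    have h3 : φ x - φ y = (φ x - φ (pt T (T y 0) (T x 1))) + (φ (pt T (T y 0) (T x 1)) - φ y) := by
      abel
    calc ‖φ x - φ y‖ₑ ^ 2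
        ≤ (‖φ x - φ (pt T (T y 0) (T x 1))‖ₑ + ‖φ (pt T (T y 0) (T x 1)) - φ y‖ₑ) ^ 2 := by
          conv_lhs => rw [h3]
          gcongr
          exact enorm_add_le _ _
      _ ≤ 2 * ‖φ x - φ (pt T (T y 0) (T x 1))‖ₑ ^ 2 +
          2 * ‖φ (pt T (T y 0) (T x 1)) - φ y‖ₑ ^ 2 := ENNReal_add_sq_le _ _
      _ ≤ 2 * (L * a (T x 1)) + 2 * (L * b (T y 0)) := by gcongr
      _ = _ := by ring
  have hQ := measurableSet_box T hI hJ
  have h1 : ∀ x ∈ box T I J, ∫⁻ y in box T I J, ‖φ x - φ y‖ₑ ^ 2 ≤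
      2 * L ^ 3 * a (T x 1) +
        2 * L ^ 2 * sqNorm (volume.restrict (box T I J)) (classicalGrad φ) := by
    intro x hx
    refine (setLIntegral_mono_ae' hQ (ae_of_all _ (key x hx))).trans ?_
    rw [setLIntegral_box T hI hJ (f := fun y => 2 * L * a (T x 1) + 2 * L * b (T y 0))
      (measurable_const.add ((hbm.comp (measurable_frame_apply T 0)).const_mul _))]
    simp only [frame_pt_zero, lintegral_const, Measure.restrict_apply_univ, hJL]
    rw [lintegral_mul_const _ (by fun_prop), lintegral_add_left (by fun_prop), lintegral_const,
      Measure.restrict_apply_univ, hIL,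
      lintegral_const_mul _ hbm, hbD]
    refine le_of_eq ?_
    ring
  refine (setLIntegral_mono_ae' hQ (ae_of_all _ h1)).trans ?_
  rw [setLIntegral_box_swap T hI hJ (f := fun x => 2 * L ^ 3 * a (T x 1) +
    2 * L ^ 2 * sqNorm (volume.restrict (box T I J)) (classicalGrad φ))
    (((ham.comp (measurable_frame_apply T 1)).const_mul _).add measurable_const)]
  simp only [frame_pt_one, lintegral_const, Measure.restrict_apply_univ, hIL]
  rw [lintegral_mul_const _ (by fun_prop), lintegral_add_right _ measurable_const, lintegral_const,
    Measure.restrict_apply_univ, hJL,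
    lintegral_const_mul _ ham, haD]
  refine le_of_eq ?_
  ring

/-- Poincaré's inequality on a square `Q`, with the mean value over a subset `A` of `Q` in the
place of the mean value over `Q`. -/
lemma sqNorm_box_le_of_subset {I J : Set ℝ} (hI : MeasurableSet I)
    (hJ : MeasurableSet J) (hIc : I.OrdConnected) (hJc : J.OrdConnected) {L : ℝ≥0∞}
    (hIL : volume I = L) (hJL : volume J = L) (hbdd : Bornology.IsBounded (box T I J))
    {A : Set Plane} (hAQ : A ⊆ box T I J) :
    volume A ^ 2 * sqNorm (volume.restrict (box T I J)) φ ≤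
      8 * L ^ 4 * volume A * sqNorm (volume.restrict (box T I J)) (classicalGrad φ) +
      2 * L ^ 2 * ‖∫ y in A, φ y‖ₑ ^ 2 := by
  have hQ := measurableSet_box T hI hJ
  have hAvol : volume A ≠ ⊤ := (hbdd.subset hAQ).measure_lt_top.ne
  have hint : IntegrableOn φ A :=
    (hφ.continuous.continuousOn.integrableOn_compact (hbdd.subset hAQ).isCompact_closure).mono_set
      subset_closure
  have h1 : ∀ x ∈ box T I J, volume A ^ 2 * ‖φ x‖ₑ ^ 2 ≤
      2 * volume A * (∫⁻ y in box T I J, ‖φ x - φ y‖ₑ ^ 2) + 2 * ‖∫ y in A, φ y‖ₑ ^ 2 := by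
    intro x _
    have h2 : (volume A).toReal • φ x = (∫ y in A, (φ x - φ y)) + ∫ y in A, φ y := by
      have hc : Integrable (fun _ => φ x) (volume.restrict A) := integrableOn_const hAvol (by simp)
      rw [integral_sub hc hint, sub_add_cancel, setIntegral_const]
      rfl
    have h3 : volume A * ‖φ x‖ₑ ≤ (∫⁻ y in A, ‖φ x - φ y‖ₑ) + ‖∫ y in A, φ y‖ₑ := by
      calc volume A * ‖φ x‖ₑ = ‖(volume A).toReal • φ x‖ₑ := by
            rw [enorm_smul, Real.enorm_eq_ofReal ENNReal.toReal_nonneg, ENNReal.ofReal_toReal hAvol]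
        _ ≤ ‖∫ y in A, (φ x - φ y)‖ₑ + ‖∫ y in A, φ y‖ₑ := by
            rw [h2]
            exact enorm_add_le _ _
        _ ≤ _ := by
            gcongr
            exact enorm_integral_le_lintegral_enorm _
    have hm : Measurable fun y => ‖φ x - φ y‖ₑ :=
      (continuous_const.sub hφ.continuous).enorm.measurable
    have h4 := lintegral_sq_le (volume.restrict A) hm.aemeasurable
    rw [Measure.restrict_apply_univ] at h4
    calc volume A ^ 2 * ‖φ x‖ₑ ^ 2 = (volume A * ‖φ x‖ₑ) ^ 2 := by ring
      _ ≤ ((∫⁻ y in A, ‖φ x - φ y‖ₑ) + ‖∫ y in A, φ y‖ₑ) ^ 2 := by gcongr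
      _ ≤ 2 * (∫⁻ y in A, ‖φ x - φ y‖ₑ) ^ 2 + 2 * ‖∫ y in A, φ y‖ₑ ^ 2 := ENNReal_add_sq_le _ _
      _ ≤ 2 * (volume A * (∫⁻ y in A, ‖φ x - φ y‖ₑ ^ 2)) + 2 * ‖∫ y in A, φ y‖ₑ ^ 2 := by gcongr
      _ ≤ 2 * (volume A * ∫⁻ y in box T I J, ‖φ x - φ y‖ₑ ^ 2) + 2 * ‖∫ y in A, φ y‖ₑ ^ 2 := by
          gcongr
      _ = _ := by ring
  have hm2 : Measurable fun x => ∫⁻ y in box T I J, ‖φ x - φ y‖ₑ ^ 2 := by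
    have : Measurable fun p : Plane × Plane => ‖φ p.1 - φ p.2‖ₑ ^ 2 :=
      (((hφ.continuous.comp continuous_fst).sub
        (hφ.continuous.comp continuous_snd)).enorm.measurable).pow_const 2
    exact this.lintegral_prod_right'
  rw [sqNorm, ← lintegral_const_mul _ (measurable_enorm_sq hφ)]
  refine (setLIntegral_mono_ae' hQ (ae_of_all _ h1)).trans ?_
  rw [lintegral_add_right _ measurable_const, lintegral_const_mul _ hm2, lintegral_const,
    Measure.restrict_apply_univ, volume_box T hI hJ, hIL, hJL]
  calc _ ≤ 2 * volume A * (4 * L ^ 4 * sqNorm (volume.restrict (box T I J)) (classicalGrad φ)) +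
        2 * ‖∫ y in A, φ y‖ₑ ^ 2 * (L * L) := by
        gcongr
        exact lintegral_lintegral_enorm_sub_sq_le hφ T hI hJ hIc hJc hIL hJL
    _ = _ := by ring

end Square

/-! ### Strips above a graph -/

section Strip

/-- The strip of height `δ` above the graph of `g` over `I`, in the coordinates of the frame
`T`. -/
def strip (T : Plane ≃ₗᵢ[ℝ] Plane) (g : ℝ → ℝ) (I : Set ℝ) (δ : ℝ) : Set Plane :=
  {y | T y 0 ∈ I ∧ T y 1 ∈ Ioo (g (T y 0)) (g (T y 0) + δ)}

variable {m : ℕ} {φ : Plane → Vec m} (hφ : ContDiff ℝ ∞ φ) (T : Plane ≃ₗᵢ[ℝ] Plane)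
  {g : ℝ → ℝ} (hg : Continuous g) {I : Set ℝ} (hI : MeasurableSet I)

include hI hg

lemma measurableSet_strip (δ : ℝ) : MeasurableSet (strip T g I δ) := by
  have h0 := measurable_frame_apply T 0
  have h1 := measurable_frame_apply T 1
  have hgm := hg.measurable.comp h0
  exact (h0 hI).inter ((measurableSet_lt hgm h1).inter (measurableSet_lt h1 (hgm.add_const δ)))

lemma setLIntegral_strip {f : Plane → ℝ≥0∞} (hf : Measurable f) (δ : ℝ) :
    ∫⁻ y in strip T g I δ, f y = ∫⁻ s in I, ∫⁻ t in Ioo (g s) (g s + δ), f (pt T s t) :=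
  setLIntegral_eq_lintegral_slices T hf (measurableSet_strip T hg hI δ) hI
    (fun _ => measurableSet_Ioo) fun _ => Iff.rfl

lemma volume_strip (δ : ℝ) : volume (strip T g I δ) = volume I * ENNReal.ofReal δ := by
  have h := setLIntegral_strip T hg hI (f := fun _ => 1) measurable_const δ
  simp only [lintegral_one, Measure.restrict_apply_univ, lintegral_const, Real.volume_Ioo,
    add_sub_cancel_left] at h
  rw [h, mul_comm]

omit hI hg
include hφ

lemma enorm_sub_sq_le_vertical_Ioo (s a δ : ℝ) {t t' : ℝ} (ht : t ∈ Icc a (a + δ))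
    (ht' : t' ∈ Icc a (a + δ)) :
    ‖φ (pt T s t) - φ (pt T s t')‖ₑ ^ 2 ≤
      ENNReal.ofReal δ * ∫⁻ τ in Ioo a (a + δ), ‖classicalGrad φ (pt T s τ)‖ₑ ^ 2 := by
  have h := enorm_sub_sq_le_vertical hφ T s ordConnected_Icc ht ht'
  rwa [Real.volume_Icc, add_sub_cancel_left, ← setLIntegral_congr Ioo_ae_eq_Icc] at h

lemma enorm_sq_le_vertical_Ioo (s a δ : ℝ) {t t' : ℝ} (ht : t ∈ Icc a (a + δ))
    (ht' : t' ∈ Icc a (a + δ)) :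
    ‖φ (pt T s t)‖ₑ ^ 2 ≤ 2 * ‖φ (pt T s t')‖ₑ ^ 2 +
      2 * ENNReal.ofReal δ * ∫⁻ τ in Ioo a (a + δ), ‖classicalGrad φ (pt T s τ)‖ₑ ^ 2 := by
  calc ‖φ (pt T s t)‖ₑ ^ 2 = ‖φ (pt T s t') + (φ (pt T s t) - φ (pt T s t'))‖ₑ ^ 2 := by
        rw [add_sub_cancel]
    _ ≤ (‖φ (pt T s t')‖ₑ + ‖φ (pt T s t) - φ (pt T s t')‖ₑ) ^ 2 := by
        gcongr
        exact enorm_add_le _ _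
    _ ≤ 2 * ‖φ (pt T s t')‖ₑ ^ 2 + 2 * ‖φ (pt T s t) - φ (pt T s t')‖ₑ ^ 2 :=
        ENNReal_add_sq_le _ _
    _ ≤ _ := by
        rw [mul_assoc 2 (ENNReal.ofReal δ)]
        gcongr
        exact enorm_sub_sq_le_vertical_Ioo hφ T s a δ ht ht'

lemma mul_enorm_sq_le_vertical (s a h : ℝ) {t : ℝ} (ht : t ∈ Icc a (a + h)) :
    ENNReal.ofReal h * ‖φ (pt T s t)‖ₑ ^ 2 ≤
      2 * (∫⁻ τ in Ioo a (a + h), ‖φ (pt T s τ)‖ₑ ^ 2) +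
      2 * ENNReal.ofReal h ^ 2 *
        ∫⁻ τ in Ioo a (a + h), ‖classicalGrad φ (pt T s τ)‖ₑ ^ 2 := by
  have h1 : ∫⁻ _ in Ioo a (a + h), ‖φ (pt T s t)‖ₑ ^ 2 ≤ ∫⁻ t' in Ioo a (a + h),
      (2 * ‖φ (pt T s t')‖ₑ ^ 2 +
      2 * ENNReal.ofReal h * ∫⁻ τ in Ioo a (a + h), ‖classicalGrad φ (pt T s τ)‖ₑ ^ 2) :=
    setLIntegral_mono_ae' measurableSet_Ioo (ae_of_all _ fun t' ht' =>
      enorm_sq_le_vertical_Ioo hφ T s a h ht (Ioo_subset_Icc_self ht'))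
  have hm : Measurable fun τ => ‖φ (pt T s τ)‖ₑ ^ 2 :=
    (measurable_enorm_sq hφ).comp ((continuous_pt T).measurable.comp measurable_prodMk_left)
  rw [lintegral_const, Measure.restrict_apply_univ, Real.volume_Ioo, add_sub_cancel_left,
    lintegral_add_right _ measurable_const, lintegral_const_mul _ hm, lintegral_const,
    Measure.restrict_apply_univ, Real.volume_Ioo, add_sub_cancel_left, mul_comm] at h1
  refine h1.trans (le_of_eq ?_)
  ring

include hI hg

lemma lintegral_add_strip (A B : ℝ≥0∞) (h : ℝ) :
    ∫⁻ s in I, (A * (∫⁻ τ in Ioo (g s) (g s + h), ‖φ (pt T s τ)‖ₑ ^ 2) +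
      B * ∫⁻ τ in Ioo (g s) (g s + h), ‖classicalGrad φ (pt T s τ)‖ₑ ^ 2) =
    A * sqNorm (volume.restrict (strip T g I h)) φ +
      B * sqNorm (volume.restrict (strip T g I h)) (classicalGrad φ) := by
  have hslice : ∀ {f : Plane → ℝ≥0∞}, Measurable f →
      Measurable fun s => ∫⁻ τ in Ioo (g s) (g s + h), f (pt T s τ) := by
    intro f hf
    have hS := measurableSet_strip T hg MeasurableSet.univ h
    have h1 : Measurable fun p : ℝ × ℝ =>
        (strip T g univ h).indicator f (pt T p.1 p.2) :=
      (hf.indicator hS).comp (continuous_pt T).measurable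
    have h2 := h1.lintegral_prod_right' (ν := volume)
    convert h2 using 2 with s
    rw [← lintegral_indicator measurableSet_Ioo]
    refine lintegral_congr fun t => ?_
    by_cases ht : t ∈ Ioo (g s) (g s + h)
    · rw [indicator_of_mem ht, indicator_of_mem (by simpa [strip] using ht)]
    · rw [indicator_of_notMem ht, indicator_of_notMem (by simpa [strip] using ht)]
  have h1 := hslice (measurable_enorm_sq hφ)
  have h2 := hslice (measurable_enorm_classicalGrad_sq hφ)
  rw [lintegral_add_left (h1.const_mul _), lintegral_const_mul _ h1, lintegral_const_mul _ h2,
    sqNorm, sqNorm, setLIntegral_strip T hg hI (measurable_enorm_sq hφ),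
    setLIntegral_strip T hg hI (measurable_enorm_classicalGrad_sq hφ)]

/-- The trace inequality over a graph. -/
lemma mul_lintegral_graph_le {h : ℝ} (hh : 0 ≤ h) :
    ENNReal.ofReal h * ∫⁻ s in I, ‖φ (pt T s (g s))‖ₑ ^ 2 ≤
      2 * sqNorm (volume.restrict (strip T g I h)) φ +
      2 * ENNReal.ofReal h ^ 2 * sqNorm (volume.restrict (strip T g I h)) (classicalGrad φ) := by
  rw [← lintegral_const_mul' _ _ ENNReal.ofReal_ne_top, ← lintegral_add_strip hφ T hg hI]
  exact setLIntegral_mono_ae' hI (ae_of_all _ fun s _ =>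
    mul_enorm_sq_le_vertical hφ T s (g s) h ⟨le_rfl, by linarith⟩)

/-- A thin strip carries a small part of the `L²` norm. -/
lemma mul_sqNorm_strip_le {δ h : ℝ} (hδ : δ ≤ h) :
    ENNReal.ofReal h * sqNorm (volume.restrict (strip T g I δ)) φ ≤
      ENNReal.ofReal δ * (2 * sqNorm (volume.restrict (strip T g I h)) φ +
      2 * ENNReal.ofReal h ^ 2 * sqNorm (volume.restrict (strip T g I h)) (classicalGrad φ)) := by
  rw [← lintegral_add_strip hφ T hg hI, sqNorm, setLIntegral_strip T hg hI (measurable_enorm_sq hφ),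
    ← lintegral_const_mul' _ _ ENNReal.ofReal_ne_top,
    ← lintegral_const_mul' _ _ ENNReal.ofReal_ne_top]
  refine setLIntegral_mono_ae' hI (ae_of_all _ fun s _ => ?_)
  rw [← lintegral_const_mul' _ _ ENNReal.ofReal_ne_top]
  refine (setLIntegral_mono_ae' measurableSet_Ioo (ae_of_all _ fun t ht =>
    mul_enorm_sq_le_vertical hφ T s (g s) h ⟨ht.1.le, ht.2.le.trans (by linarith)⟩)).trans ?_
  rw [lintegral_const, Measure.restrict_apply_univ, Real.volume_Ioo, add_sub_cancel_left, mul_comm]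

/-- The `L²` norm on a strip is controlled by the boundary values and the gradient. -/
lemma sqNorm_strip_le_graph {δ : ℝ} (hδ : 0 ≤ δ) :
    sqNorm (volume.restrict (strip T g I δ)) φ ≤
      2 * ENNReal.ofReal δ * (∫⁻ s in I, ‖φ (pt T s (g s))‖ₑ ^ 2) +
      2 * ENNReal.ofReal δ ^ 2 * sqNorm (volume.restrict (strip T g I δ)) (classicalGrad φ) := by
  have hm : Measurable fun s => ‖φ (pt T s (g s))‖ₑ ^ 2 :=
    (measurable_enorm_sq hφ).comp ((continuous_pt T).comp (continuous_id.prodMk hg)).measurable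
  have e := lintegral_add_strip hφ T hg hI 0 (2 * ENNReal.ofReal δ ^ 2) δ
  simp only [zero_mul, zero_add] at e
  rw [← e, ← lintegral_const_mul _ hm, ← lintegral_add_left (hm.const_mul _), sqNorm,
    setLIntegral_strip T hg hI (measurable_enorm_sq hφ)]
  refine setLIntegral_mono_ae' hI (ae_of_all _ fun s _ => ?_)
  refine (setLIntegral_mono_ae' measurableSet_Ioo (ae_of_all _ fun t ht =>
    enorm_sq_le_vertical_Ioo hφ T s (g s) δ (Ioo_subset_Icc_self ht)
      ⟨le_rfl, by linarith⟩)).trans ?_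
  rw [lintegral_const, Measure.restrict_apply_univ, Real.volume_Ioo, add_sub_cancel_left]
  refine le_of_eq ?_
  ring

end Strip

/-! ### Boundary strips and arc length in the coordinate rectangles -/

lemma abs_frame_sub_le (T : Plane ≃ₗᵢ[ℝ] Plane) (y z : Plane) (i : Fin 2) :
    |T y i - T z i| ≤ dist y z := by
  have h := PiLp.norm_apply_le (T y - T z) i
  rwa [← map_sub, T.norm_map, map_sub, PiLp.sub_apply, Real.norm_eq_abs, ← dist_eq_norm] at h

lemma dist_pt_le (T : Plane ≃ₗᵢ[ℝ] Plane) (s t s' t' : ℝ) :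
    dist (pt T s t) (pt T s' t') ≤ |s - s'| + |t - t'| := by
  rw [pt, pt, T.symm.dist_map, dist_eq_norm]
  refine le_of_sq_le_sq ?_ (by positivity)
  rw [EuclideanSpace.norm_sq_eq, Fin.sum_univ_two]
  simp only [Real.norm_eq_abs, sq_abs, PiLp.sub_apply, Matrix.cons_val_zero, Matrix.cons_val_one]
  have h1 := mul_nonneg (abs_nonneg (s - s')) (abs_nonneg (t - t'))
  have h2 := sq_abs (s - s')
  have h3 := sq_abs (t - t')
  nlinarith

lemma IsLipschitzDomain.frontier_nonempty {Ω : Set Plane} {M : ℝ} (hΩ : IsLipschitzDomain Ω M) :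
    (frontier Ω).Nonempty := by
  rw [nonempty_iff_ne_empty]
  intro h
  rcases isClopen_iff.1 (isClopen_iff_frontier_eq_empty.2 h) with h | h
  · exact hΩ.isConnected.nonempty.ne_empty h
  · have := hΩ.isBounded
    rw [h] at this
    exact NormedSpace.unbounded_univ ℝ Plane this

lemma IsLipschitzDomain.isCompact_frontier {Ω : Set Plane} {M : ℝ} (hΩ : IsLipschitzDomain Ω M) :
    IsCompact (frontier Ω) :=
  hΩ.isBounded.isCompact_closure.of_isClosed_subset isClosed_frontier frontier_subset_closure

lemma IsLipschitzDomain.notMem_of_mem_frontier {Ω : Set Plane} {M : ℝ}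
    (hΩ : IsLipschitzDomain Ω M) {y : Plane} (hy : y ∈ frontier Ω) : y ∉ Ω := by
  rw [hΩ.isOpen.frontier_eq] at hy
  exact hy.2

/-- The part of `Ω` at distance at least `ε` from the boundary. -/
def core (Ω : Set Plane) (ε : ℝ) : Set Plane := {y ∈ Ω | ε ≤ Metric.infDist y (frontier Ω)}

lemma core_subset (Ω : Set Plane) (ε : ℝ) : core Ω ε ⊆ Ω := fun _ hy => hy.1

lemma IsLipschitzDomain.isCompact_core {Ω : Set Plane} {M : ℝ} (hΩ : IsLipschitzDomain Ω M)
    {ε : ℝ} (hε : 0 < ε) : IsCompact (core Ω ε) := by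
  have h : core Ω ε = closure Ω ∩ {y | ε ≤ Metric.infDist y (frontier Ω)} := by
    ext y
    refine ⟨fun hy => ⟨subset_closure hy.1, hy.2⟩, fun hy => ⟨?_, hy.2⟩⟩
    by_contra h
    have h1 : y ∈ frontier Ω := by
      rw [hΩ.isOpen.frontier_eq]
      exact ⟨hy.1, h⟩
    have h2 : ε ≤ Metric.infDist y (frontier Ω) := hy.2
    rw [Metric.infDist_zero_of_mem h1] at h2
    linarith
  rw [h]
  exact hΩ.isBounded.isCompact_closure.inter_right
    (isClosed_le continuous_const (Metric.continuous_infDist_pt _))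

namespace CoordCover

variable {Ω : Set Plane} {M : ℝ} (𝒞 : CoordCover Ω M)

lemma radius_ge (i : Fin 𝒞.n) : 𝒞.r₀ ≤ 𝒞.radius i :=
  ciInf_le (Set.finite_range _).bddBelow i

lemma r₀_pos (hΩ : IsLipschitzDomain Ω M) : 0 < 𝒞.r₀ := by
  obtain ⟨z, hz⟩ := hΩ.frontier_nonempty
  obtain ⟨i, -⟩ := mem_iUnion.1 (𝒞.covers hz)
  have : Nonempty (Fin 𝒞.n) := ⟨i⟩
  obtain ⟨j, hj⟩ := exists_eq_ciInf_of_finite (f := 𝒞.radius)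
  rw [r₀, ← hj]
  exact 𝒞.radius_pos j

/-- The interval over which the strips of the `i`-th chart are taken. It has twice the width of the
rectangle of the cover. -/
def base (i : Fin 𝒞.n) : Set ℝ :=
  Ioo (𝒞.frame i (𝒞.center i) 0 - 2 * 𝒞.radius i) (𝒞.frame i (𝒞.center i) 0 + 2 * 𝒞.radius i)

/-- The strip of height `δ` above the boundary in the `i`-th chart. -/
def layer (i : Fin 𝒞.n) (δ : ℝ) : Set Plane := strip (𝒞.frame i) (𝒞.graph i) (𝒞.base i) δ

/-- The parametrization of the boundary in the `i`-th chart. -/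
def curve (i : Fin 𝒞.n) (s : ℝ) : Plane := pt (𝒞.frame i) s (𝒞.graph i s)

lemma measurableSet_base (i : Fin 𝒞.n) : MeasurableSet (𝒞.base i) := measurableSet_Ioo

lemma abs_sub_lt_of_mem_base {i : Fin 𝒞.n} {s : ℝ} (hs : s ∈ 𝒞.base i) :
    |s - 𝒞.frame i (𝒞.center i) 0| < 2 * 𝒞.radius i :=
  abs_lt.2 ⟨by linarith [hs.1], by linarith [hs.2]⟩

lemma volume_base_ne_top (i : Fin 𝒞.n) : volume (𝒞.base i) ≠ ⊤ := by
  simp [base]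

lemma continuous_graph (i : Fin 𝒞.n) : Continuous (𝒞.graph i) := by
  have h : LipschitzWith M.toNNReal (𝒞.graph i) := LipschitzWith.of_dist_le_mul fun s t => by
    rw [Real.dist_eq, Real.dist_eq]
    refine ((𝒞.isCoordRect i).lipschitz s t).trans ?_
    gcongr
    exact Real.le_coe_toNNReal M
  exact h.continuous

lemma measurableSet_layer (i : Fin 𝒞.n) (δ : ℝ) : MeasurableSet (𝒞.layer i δ) :=
  measurableSet_strip _ (𝒞.continuous_graph i) (𝒞.measurableSet_base i) δ

lemma center_one (hM : 0 < M) (i : Fin 𝒞.n) :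
    𝒞.frame i (𝒞.center i) 1 = 𝒞.graph i (𝒞.frame i (𝒞.center i) 0) := by
  have hr := 𝒞.radius_pos i
  have h : 𝒞.center i ∈ frontier Ω ∩ rect M (𝒞.frame i) (𝒞.center i) (100 * 𝒞.radius i) := by
    refine ⟨𝒞.center_mem i, ?_, ?_⟩ <;> simp only [sub_self, abs_zero] <;> positivity
  rw [(𝒞.isCoordRect i).boundary] at h
  exact h.1

lemma mem_rect_of_near (hM : 0 < M) {i : Fin 𝒞.n} {y : Plane} (h0 : 𝒞.frame i y 0 ∈ 𝒞.base i)
    (h1 : |𝒞.frame i y 1 - 𝒞.graph i (𝒞.frame i y 0)| ≤ 𝒞.radius i) :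
    y ∈ rect M (𝒞.frame i) (𝒞.center i) (100 * 𝒞.radius i) := by
  have hr := 𝒞.radius_pos i
  have h2 := 𝒞.abs_sub_lt_of_mem_base h0
  have h3 := (𝒞.isCoordRect i).lipschitz (𝒞.frame i y 0) (𝒞.frame i (𝒞.center i) 0)
  rw [← 𝒞.center_one hM i] at h3
  refine ⟨by linarith, ?_⟩
  have h4 := abs_sub_le (𝒞.frame i y 1) (𝒞.graph i (𝒞.frame i y 0)) (𝒞.frame i (𝒞.center i) 1)
  have h5 := mul_lt_mul_of_pos_left h2 hM
  have h6 := mul_pos hM hr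
  nlinarith

lemma layer_subset (hM : 0 < M) (i : Fin 𝒞.n) {δ : ℝ} (hδ : δ ≤ 𝒞.r₀) : 𝒞.layer i δ ⊆ Ω := by
  rintro y ⟨h0, h1, h2⟩
  have hr := 𝒞.radius_ge i
  have h3 : y ∈ {y | 𝒞.graph i (𝒞.frame i y 0) < 𝒞.frame i y 1} ∩
      rect M (𝒞.frame i) (𝒞.center i) (100 * 𝒞.radius i) :=
    ⟨h1, 𝒞.mem_rect_of_near hM h0 (abs_le.2 ⟨by linarith, by linarith⟩)⟩
  rw [← (𝒞.isCoordRect i).domain] at h3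
  exact h3.1

lemma curve_mem_frontier (hM : 0 < M) {i : Fin 𝒞.n} {s : ℝ} (hs : s ∈ 𝒞.base i) :
    𝒞.curve i s ∈ frontier Ω := by
  have h : 𝒞.curve i s ∈ {y | 𝒞.frame i y 1 = 𝒞.graph i (𝒞.frame i y 0)} ∩
      rect M (𝒞.frame i) (𝒞.center i) (100 * 𝒞.radius i) := by
    refine ⟨by simp [curve], 𝒞.mem_rect_of_near hM (by simpa [curve] using hs) ?_⟩
    simpa [curve] using (𝒞.radius_pos i).le
  rw [← (𝒞.isCoordRect i).boundary] at h
  exact h.1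

lemma mem_rect_enlarge (hM : 0 < M) {i : Fin 𝒞.n} {y z : Plane}
    (hz : z ∈ rect M (𝒞.frame i) (𝒞.center i) (𝒞.radius i)) (hyz : dist y z ≤ 𝒞.radius i) :
    𝒞.frame i y 0 ∈ 𝒞.base i ∧ y ∈ rect M (𝒞.frame i) (𝒞.center i) (100 * 𝒞.radius i) := by
  have hr := 𝒞.radius_pos i
  have h0 := (abs_frame_sub_le (𝒞.frame i) y z 0).trans hyz
  have h1 := (abs_frame_sub_le (𝒞.frame i) y z 1).trans hyz
  have h2 := abs_sub_le (𝒞.frame i y 0) (𝒞.frame i z 0) (𝒞.frame i (𝒞.center i) 0)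
  have h3 := abs_sub_le (𝒞.frame i y 1) (𝒞.frame i z 1) (𝒞.frame i (𝒞.center i) 1)
  obtain ⟨h4, h5⟩ := hz
  have h6 := mul_pos hM hr
  have h7 : |𝒞.frame i y 0 - 𝒞.frame i (𝒞.center i) 0| < 2 * 𝒞.radius i := by linarith
  refine ⟨⟨by linarith [(abs_lt.1 h7).1], by linarith [(abs_lt.1 h7).2]⟩, by linarith, by nlinarith⟩

lemma exists_mem_base (hM : 0 < M) {z : Plane} (hz : z ∈ frontier Ω) :
    ∃ i, z ∈ rect M (𝒞.frame i) (𝒞.center i) (𝒞.radius i) ∧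
      𝒞.frame i z 1 = 𝒞.graph i (𝒞.frame i z 0) := by
  obtain ⟨i, hi⟩ := mem_iUnion.1 (𝒞.covers hz)
  have h := (𝒞.mem_rect_enlarge hM hi (y := z) (by simpa using (𝒞.radius_pos i).le)).2
  have h1 : z ∈ frontier Ω ∩ rect M (𝒞.frame i) (𝒞.center i) (100 * 𝒞.radius i) := ⟨hz, h⟩
  rw [(𝒞.isCoordRect i).boundary] at h1
  exact ⟨i, hi, h1.1⟩

/-- The points of `Ω` close to the boundary lie in the strips. -/
lemma exists_mem_layer (hΩ : IsLipschitzDomain Ω M) (hM : 0 < M) {δ : ℝ} (hδ : δ ≤ 𝒞.r₀)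
    {y : Plane} (hy : y ∈ Ω) (hd : Metric.infDist y (frontier Ω) < δ / (1 + M)) :
    ∃ i, y ∈ 𝒞.layer i δ := by
  obtain ⟨z, hz, hyz⟩ := (Metric.infDist_lt_iff hΩ.frontier_nonempty).1 hd
  obtain ⟨i, hi, hzg⟩ := 𝒞.exists_mem_base hM hz
  rw [lt_div_iff₀ (by positivity)] at hyz
  have hδ' : dist y z ≤ δ := by nlinarith [dist_nonneg (x := y) (y := z)]
  obtain ⟨h0, h1⟩ := 𝒞.mem_rect_enlarge hM hi (hδ'.trans (hδ.trans (𝒞.radius_ge i)))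
  refine ⟨i, h0, ?_, ?_⟩
  · have h2 : y ∈ Ω ∩ rect M (𝒞.frame i) (𝒞.center i) (100 * 𝒞.radius i) := ⟨hy, h1⟩
    rw [(𝒞.isCoordRect i).domain] at h2
    exact h2.1
  · have h2 := abs_frame_sub_le (𝒞.frame i) y z 0
    have h3 := abs_frame_sub_le (𝒞.frame i) y z 1
    have h4 := (𝒞.isCoordRect i).lipschitz (𝒞.frame i z 0) (𝒞.frame i y 0)
    rw [abs_sub_comm (𝒞.frame i z 0)] at h4
    have h5 := mul_le_mul_of_nonneg_left h2 hM.le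
    have h6 := (abs_le.1 h3).2
    have h7 := (abs_le.1 h4).2
    rw [hzg] at h6
    nlinarith

lemma subset_core_union_layers (hΩ : IsLipschitzDomain Ω M) (hM : 0 < M) {δ : ℝ}
    (hδ : δ ≤ 𝒞.r₀) : Ω ⊆ core Ω (δ / (1 + M)) ∪ ⋃ i, 𝒞.layer i δ := by
  intro y hy
  rcases le_or_gt (δ / (1 + M)) (Metric.infDist y (frontier Ω)) with h | h
  · exact Or.inl ⟨hy, h⟩
  · exact Or.inr (mem_iUnion.2 (𝒞.exists_mem_layer hΩ hM hδ hy h))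

lemma frontier_subset_curves (hM : 0 < M) : frontier Ω ⊆ ⋃ i, 𝒞.curve i '' 𝒞.base i := by
  intro z hz
  obtain ⟨i, hi, hzg⟩ := 𝒞.exists_mem_base hM hz
  refine mem_iUnion.2 ⟨i, 𝒞.frame i z 0, ?_, ?_⟩
  · exact (𝒞.mem_rect_enlarge hM hi (y := z) (by simpa using (𝒞.radius_pos i).le)).1
  · rw [curve, ← hzg, pt_frame]

lemma lipschitzWith_curve (hM : 0 < M) (i : Fin 𝒞.n) :
    LipschitzWith (1 + M).toNNReal (𝒞.curve i) := by
  refine LipschitzWith.of_dist_le_mul fun s t => ?_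
  rw [Real.coe_toNNReal _ (by positivity), Real.dist_eq]
  refine (dist_pt_le _ _ _ _ _).trans ?_
  have := (𝒞.isCoordRect i).lipschitz s t
  linarith

lemma restrict_curve_le (hM : 0 < M) (i : Fin 𝒞.n) :
    (Measure.hausdorffMeasure 1).restrict (𝒞.curve i '' 𝒞.base i) ≤
      ENNReal.ofReal (1 + M) • (volume.restrict (𝒞.base i)).map (𝒞.curve i) := by
  have hL := 𝒞.lipschitzWith_curve hM i
  refine Measure.le_iff.2 fun A hA => ?_
  rw [Measure.restrict_apply hA, Measure.smul_apply, Measure.map_apply hL.continuous.measurable hA,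
    Measure.restrict_apply (hL.continuous.measurable hA)]
  have h1 : A ∩ 𝒞.curve i '' 𝒞.base i ⊆ 𝒞.curve i '' (𝒞.curve i ⁻¹' A ∩ 𝒞.base i) := by
    rintro _ ⟨hA, s, hs, rfl⟩
    exact ⟨s, ⟨hA, hs⟩, rfl⟩
  refine (measure_mono h1).trans ((hL.hausdorffMeasure_image_le zero_le_one _).trans ?_)
  rw [hausdorffMeasure_real, ENNReal.rpow_one]
  rfl

lemma map_curve_le (hM : 0 < M) (i : Fin 𝒞.n) :
    (volume.restrict (𝒞.base i)).map (𝒞.curve i) ≤ arcLength Ω := by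
  have hL := 𝒞.lipschitzWith_curve hM i
  refine Measure.le_iff.2 fun A hA => ?_
  rw [arcLength, Measure.restrict_apply hA, Measure.map_apply hL.continuous.measurable hA,
    Measure.restrict_apply (hL.continuous.measurable hA)]
  have hp : LipschitzWith 1 fun y : Plane => 𝒞.frame i y 0 :=
    LipschitzWith.of_dist_le_mul fun y z => by
      rw [NNReal.coe_one, one_mul, Real.dist_eq]
      exact abs_frame_sub_le _ _ _ _
  have h1 : 𝒞.curve i ⁻¹' A ∩ 𝒞.base i ⊆ (fun y : Plane => 𝒞.frame i y 0) '' (A ∩ frontier Ω) := by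
    rintro s ⟨hA, hs⟩
    exact ⟨𝒞.curve i s, ⟨hA, 𝒞.curve_mem_frontier hM hs⟩, by simp [curve]⟩
  refine (measure_mono h1).trans ?_
  have h2 := hp.hausdorffMeasure_image_le zero_le_one (A ∩ frontier Ω)
  rw [hausdorffMeasure_real] at h2
  simpa using h2

lemma lintegral_curve_le (hM : 0 < M) (i : Fin 𝒞.n) {f : Plane → ℝ≥0∞} (hf : Measurable f) :
    ∫⁻ s in 𝒞.base i, f (𝒞.curve i s) ≤ ∫⁻ x, f x ∂arcLength Ω := by
  rw [← lintegral_map hf (𝒞.lipschitzWith_curve hM i).continuous.measurable]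
  exact lintegral_mono' (𝒞.map_curve_le hM i) le_rfl

lemma lintegral_arcLength_le (hM : 0 < M) {f : Plane → ℝ≥0∞} (hf : Measurable f) :
    ∫⁻ x, f x ∂arcLength Ω ≤
      ENNReal.ofReal (1 + M) * ∑ i, ∫⁻ s in 𝒞.base i, f (𝒞.curve i s) := by
  have h1 : arcLength Ω ≤ Measure.sum fun i =>
      (Measure.hausdorffMeasure 1).restrict (𝒞.curve i '' 𝒞.base i) :=
    (Measure.restrict_mono (𝒞.frontier_subset_curves hM) le_rfl).trans Measure.restrict_iUnion_le
  refine (lintegral_mono' h1 le_rfl).trans ?_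
  rw [lintegral_sum_measure, tsum_fintype, Finset.mul_sum]
  refine Finset.sum_le_sum fun i _ => ?_
  refine (lintegral_mono' (𝒞.restrict_curve_le hM i) le_rfl).trans ?_
  rw [lintegral_smul_measure, lintegral_map hf (𝒞.lipschitzWith_curve hM i).continuous.measurable]
  rfl

include 𝒞 in
lemma isFiniteMeasure_arcLength (hM : 0 < M) : IsFiniteMeasure (arcLength Ω) := by
  refine ⟨?_⟩
  have h := 𝒞.lintegral_arcLength_le hM (f := fun _ => 1) measurable_const
  simp only [lintegral_one, Measure.restrict_apply_univ] at h
  refine h.trans_lt (ENNReal.mul_lt_top ENNReal.ofReal_lt_top ?_)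
  exact ENNReal.sum_lt_top.2 fun i _ => (𝒞.volume_base_ne_top i).lt_top

end CoordCover

/-! ### Inequalities of Poincaré, Rellich and trace type for smooth functions -/

section Energy

variable {X F : Type*} [MeasurableSpace X] [NormedAddCommGroup F]

lemma sqNorm_mono_measure {μ ν : Measure X} (h : μ ≤ ν) (f : X → F) : sqNorm μ f ≤ sqNorm ν f :=
  lintegral_mono' h le_rfl

lemma sqNorm_mono_set {μ : Measure X} {A B : Set X} (h : A ⊆ B) (f : X → F) :
    sqNorm (μ.restrict A) f ≤ sqNorm (μ.restrict B) f :=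
  sqNorm_mono_measure (Measure.restrict_mono h le_rfl) f

lemma sqNorm_union_le {μ : Measure X} (A B : Set X) (f : X → F) :
    sqNorm (μ.restrict (A ∪ B)) f ≤ sqNorm (μ.restrict A) f + sqNorm (μ.restrict B) f :=
  lintegral_union_le _ _ _

lemma sqNorm_iUnion_le {μ : Measure X} {ι : Type*} [Fintype ι] (A : ι → Set X) (f : X → F) :
    sqNorm (μ.restrict (⋃ i, A i)) f ≤ ∑ i, sqNorm (μ.restrict (A i)) f := by
  have h := lintegral_iUnion_le (μ := μ) A fun x => ‖f x‖ₑ ^ 2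
  rwa [tsum_fintype] at h

lemma sqNorm_lt_top_of_continuous {Ω : Set Plane} (hΩ : Bornology.IsBounded Ω) {f : Plane → F}
    (hf : Continuous f) : sqNorm (volume.restrict Ω) f < ⊤ := by
  refine (sqNorm_mono_set (subset_closure (s := Ω)) f).trans_lt ?_
  obtain ⟨C, hC⟩ := hΩ.isCompact_closure.exists_bound_of_continuousOn hf.continuousOn
  refine (setLIntegral_mono_ae' (g := fun _ => ENNReal.ofReal C ^ 2)
    isClosed_closure.measurableSet (ae_of_all _ fun x hx => ?_)).trans_lt ?_
  · gcongr
    rw [← ofReal_norm]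
    exact ENNReal.ofReal_le_ofReal (hC x hx)
  · rw [lintegral_const, Measure.restrict_apply_univ]
    exact ENNReal.mul_lt_top (ENNReal.pow_lt_top ENNReal.ofReal_lt_top)
      hΩ.isCompact_closure.measure_lt_top

lemma ENNReal_absorb {a b d : ℝ≥0∞} (ha : a ≠ ⊤) (h : a ≤ b + 2⁻¹ * (a + d)) : a ≤ 2 * b + d := by
  have h1 : 2 * a ≤ 2 * b + (a + d) := by
    calc 2 * a ≤ 2 * (b + 2⁻¹ * (a + d)) := by gcongr
      _ = 2 * b + (a + d) := by
        rw [mul_add, ← mul_assoc, ENNReal.mul_inv_cancel (by simp) (by simp), one_mul]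
  rw [two_mul, ← add_assoc, add_comm (2 * b) a, add_assoc] at h1
  exact (ENNReal.add_le_add_iff_left ha).1 h1

end Energy

/-- The open square with center `x` and side length `2 * ℓ`. -/
def square (x : Plane) (ℓ : ℝ) : Set Plane :=
  box (LinearIsometryEquiv.refl ℝ Plane) (Ioo (x 0 - ℓ) (x 0 + ℓ)) (Ioo (x 1 - ℓ) (x 1 + ℓ))

lemma isOpen_square (x : Plane) (ℓ : ℝ) : IsOpen (square x ℓ) := by
  have h0 : Continuous fun y : Plane => y 0 := by fun_prop
  have h1 : Continuous fun y : Plane => y 1 := by fun_prop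
  exact (isOpen_Ioo.preimage h0).inter (isOpen_Ioo.preimage h1)

lemma mem_square_self (x : Plane) {ℓ : ℝ} (hℓ : 0 < ℓ) : x ∈ square x ℓ := by
  simp [square, box, hℓ]

lemma dist_le_abs_add_abs (x y : Plane) : dist x y ≤ |x 0 - y 0| + |x 1 - y 1| := by
  have h := dist_pt_le (LinearIsometryEquiv.refl ℝ Plane) (x 0) (x 1) (y 0) (y 1)
  have hx := pt_frame (LinearIsometryEquiv.refl ℝ Plane) x
  have hy := pt_frame (LinearIsometryEquiv.refl ℝ Plane) y
  simp only [LinearIsometryEquiv.coe_refl, id_eq] at hx hy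
  rwa [hx, hy] at h

lemma square_subset_ball (x : Plane) (ℓ : ℝ) : square x ℓ ⊆ Metric.ball x (2 * ℓ) := by
  rintro y ⟨h0, h1⟩
  simp only [LinearIsometryEquiv.coe_refl, id_eq, mem_Ioo] at h0 h1
  rw [Metric.mem_ball]
  refine (dist_le_abs_add_abs y x).trans_lt ?_
  have h2 : |y 0 - x 0| < ℓ := abs_lt.2 ⟨by linarith, by linarith⟩
  have h3 : |y 1 - x 1| < ℓ := abs_lt.2 ⟨by linarith, by linarith⟩
  linarith

lemma exists_square_subset {U : Set Plane} (hU : IsOpen U) {x : Plane} (hx : x ∈ U) :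
    ∃ ℓ > 0, square x ℓ ⊆ U := by
  obtain ⟨r, hr, h⟩ := Metric.isOpen_iff.1 hU x hx
  refine ⟨r / 2, by positivity, (square_subset_ball x _).trans ?_⟩
  rwa [mul_div_cancel₀ r two_ne_zero]

lemma sqNorm_square_le {m : ℕ} {φ : Plane → Vec m} (hφ : ContDiff ℝ ∞ φ) (x : Plane) (ℓ : ℝ)
    {A : Set Plane} (hA : A ⊆ square x ℓ) :
    volume A ^ 2 * sqNorm (volume.restrict (square x ℓ)) φ ≤
      8 * ENNReal.ofReal (2 * ℓ) ^ 4 * volume A *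
        sqNorm (volume.restrict (square x ℓ)) (classicalGrad φ) +
      2 * ENNReal.ofReal (2 * ℓ) ^ 2 * ‖∫ y in A, φ y‖ₑ ^ 2 := by
  refine sqNorm_box_le_of_subset hφ _ measurableSet_Ioo measurableSet_Ioo ordConnected_Ioo
    ordConnected_Ioo ?_ ?_ (Metric.isBounded_ball.subset (square_subset_ball x ℓ)) hA
  all_goals rw [Real.volume_Ioo]; congr 1; ring

/-- The cell with index `k` of the grid of mesh size `δ`. -/
def gridCell (δ : ℝ) (k : ℤ × ℤ) : Set Plane :=
  box (LinearIsometryEquiv.refl ℝ Plane) (Ico (k.1 * δ) ((k.1 + 1) * δ))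
    (Ico (k.2 * δ) ((k.2 + 1) * δ))

lemma mem_gridCell_iff {δ : ℝ} (hδ : 0 < δ) {k : ℤ × ℤ} {y : Plane} :
    y ∈ gridCell δ k ↔ (⌊y 0 / δ⌋, ⌊y 1 / δ⌋) = k := by
  rw [Prod.ext_iff]
  simp only [Int.floor_eq_iff, le_div_iff₀ hδ, div_lt_iff₀ hδ]
  rfl

lemma dist_lt_of_mem_gridCell {δ : ℝ} {k : ℤ × ℤ} {y z : Plane}
    (hy : y ∈ gridCell δ k) (hz : z ∈ gridCell δ k) : dist y z < 2 * δ := by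
  obtain ⟨⟨a1, a2⟩, a3, a4⟩ := hy
  obtain ⟨⟨b1, b2⟩, b3, b4⟩ := hz
  simp only [LinearIsometryEquiv.coe_refl, id_eq] at a1 a2 a3 a4 b1 b2 b3 b4
  refine (dist_le_abs_add_abs y z).trans_lt ?_
  have h0 : |y 0 - z 0| < δ := abs_lt.2 ⟨by linarith, by linarith⟩
  have h1 : |y 1 - z 1| < δ := abs_lt.2 ⟨by linarith, by linarith⟩
  linarith

lemma measurableSet_gridCell (δ : ℝ) (k : ℤ × ℤ) : MeasurableSet (gridCell δ k) :=
  measurableSet_box _ measurableSet_Ico measurableSet_Ico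

lemma sqNorm_gridCell_le {m : ℕ} {φ : Plane → Vec m} (hφ : ContDiff ℝ ∞ φ) {δ : ℝ} (hδ : 0 < δ)
    (k : ℤ × ℤ) :
    sqNorm (volume.restrict (gridCell δ k)) φ ≤
      8 * ENNReal.ofReal δ ^ 2 * sqNorm (volume.restrict (gridCell δ k)) (classicalGrad φ) +
      2 * (ENNReal.ofReal δ ^ 2)⁻¹ * ‖∫ y in gridCell δ k, φ y‖ₑ ^ 2 := by
  have hbdd : Bornology.IsBounded (gridCell δ k) := by
    rw [Metric.isBounded_iff]
    exact ⟨2 * δ, fun y hy z hz => (dist_lt_of_mem_gridCell hy hz).le⟩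
  have hvol : ∀ n : ℤ, volume (Ico (n * δ) ((n + 1) * δ)) = ENNReal.ofReal δ := by
    intro n
    rw [Real.volume_Ico]
    congr 1
    ring
  have h := sqNorm_box_le_of_subset hφ (LinearIsometryEquiv.refl ℝ Plane) measurableSet_Ico
    measurableSet_Ico ordConnected_Ico ordConnected_Ico (hvol k.1) (hvol k.2) hbdd
    (A := gridCell δ k) Subset.rfl
  have hv : volume (gridCell δ k) = ENNReal.ofReal δ ^ 2 := by
    rw [gridCell, volume_box _ measurableSet_Ico measurableSet_Ico, hvol, hvol, pow_two]
  rw [hv] at h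
  set L := ENNReal.ofReal δ with hL
  have hL0 : L ^ 2 ≠ 0 := pow_ne_zero 2 (by simpa [hL] using hδ)
  have hLt : L ^ 2 ≠ ⊤ := ENNReal.pow_ne_top ENNReal.ofReal_ne_top
  have hi : (L ^ 2)⁻¹ * L ^ 2 = 1 := ENNReal.inv_mul_cancel hL0 hLt
  change (L ^ 2) ^ 2 * sqNorm (volume.restrict (gridCell δ k)) φ ≤ 8 * L ^ 4 * L ^ 2 *
    sqNorm (volume.restrict (gridCell δ k)) (classicalGrad φ) + _ at h
  calc sqNorm (volume.restrict (gridCell δ k)) φ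
      = ((L ^ 2)⁻¹ * L ^ 2) ^ 2 * sqNorm (volume.restrict (gridCell δ k)) φ := by
        rw [hi, one_pow, one_mul]
    _ = ((L ^ 2)⁻¹) ^ 2 * ((L ^ 2) ^ 2 * sqNorm (volume.restrict (gridCell δ k)) φ) := by ring
    _ ≤ ((L ^ 2)⁻¹) ^ 2 * (8 * L ^ 4 * L ^ 2 *
        sqNorm (volume.restrict (gridCell δ k)) (classicalGrad φ) +
        2 * L ^ 2 * ‖∫ y in gridCell δ k, φ y‖ₑ ^ 2) := by gcongr
    _ = ((L ^ 2)⁻¹ * L ^ 2) ^ 2 * (8 * L ^ 2 *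
        sqNorm (volume.restrict (gridCell δ k)) (classicalGrad φ)) +
        ((L ^ 2)⁻¹ * L ^ 2) * (2 * (L ^ 2)⁻¹ * ‖∫ y in gridCell δ k, φ y‖ₑ ^ 2) := by ring
    _ = _ := by rw [hi, one_pow, one_mul, one_mul]

/-- On a compact subset of an open set, the `L²` norm is controlled by a small multiple of the
gradient and finitely many mean values. -/
lemma exists_averages_compact {Ω K : Set Plane} (hΩ : IsOpen Ω) (hK : IsCompact K) (hKΩ : K ⊆ Ω)
    {ε : ℝ≥0∞} (hε : ε ≠ 0) :
    ∃ (κ : Type) (_ : Fintype κ) (Q : κ → Set Plane) (C : ℝ≥0∞), C ≠ ⊤ ∧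
      (∀ k, MeasurableSet (Q k) ∧ Q k ⊆ Ω) ∧
      ∀ {m : ℕ} {φ : Plane → Vec m}, ContDiff ℝ ∞ φ →
        sqNorm (volume.restrict K) φ ≤ ε * sqNorm (volume.restrict Ω) (classicalGrad φ) +
          C * ∑ k, ‖∫ y in Q k, φ y‖ₑ ^ 2 := by
  obtain ⟨r, hr, hrΩ⟩ := hK.exists_thickening_subset_open hΩ hKΩ
  obtain ⟨δ, hδ, hδr, hδε⟩ : ∃ δ : ℝ, 0 < δ ∧ 2 * δ < r ∧ 8 * ENNReal.ofReal δ ^ 2 ≤ ε := by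
    have h1 : Tendsto (fun δ : ℝ => 8 * ENNReal.ofReal δ ^ 2) (𝓝[>] 0) (𝓝 0) := by
      have h2 : Tendsto (fun δ : ℝ => 8 * ENNReal.ofReal δ ^ 2) (𝓝 0)
          (𝓝 (8 * ENNReal.ofReal 0 ^ 2)) :=
        ENNReal.Tendsto.const_mul (ENNReal.Tendsto.pow (ENNReal.tendsto_ofReal tendsto_id))
          (Or.inr (by simp))
      simp only [ENNReal.ofReal_zero, ne_eq, OfNat.ofNat_ne_zero, not_false_eq_true, zero_pow,
        mul_zero] at h2
      exact h2.mono_left nhdsWithin_le_nhds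
    have h3 := h1.eventually_le_const (pos_iff_ne_zero.2 hε)
    have h4 : ∀ᶠ δ : ℝ in 𝓝[>] 0, δ < r / 2 :=
      mem_nhdsWithin_of_mem_nhds (Iio_mem_nhds (by positivity))
    obtain ⟨δ, ⟨h5, h6⟩, h7⟩ := ((h3.and h4).and self_mem_nhdsWithin).exists
    exact ⟨δ, h7, by linarith, h5⟩
  -- The index of the grid cell that contains `y`; only finitely many cells meet `K`.
  let index : Plane → ℤ × ℤ := fun y => (⌊y 0 / δ⌋, ⌊y 1 / δ⌋)
  have hfin : (index '' K).Finite := by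
    obtain ⟨R, hR⟩ := hK.isBounded.exists_norm_le
    refine ((Set.finite_Icc ⌊-R / δ⌋ ⌊R / δ⌋).prod (Set.finite_Icc ⌊-R / δ⌋ ⌊R / δ⌋)).subset ?_
    rintro _ ⟨y, hy, rfl⟩
    have h : ∀ i, |y i| ≤ R := fun i => (PiLp.norm_apply_le y i).trans (hR y hy)
    have h' : ∀ i, ⌊y i / δ⌋ ∈ Icc ⌊-R / δ⌋ ⌊R / δ⌋ := fun i =>
      ⟨Int.floor_le_floor (by gcongr; exact (abs_le.1 (h i)).1),
        Int.floor_le_floor (by gcongr; exact (abs_le.1 (h i)).2)⟩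
    exact ⟨h' 0, h' 1⟩
  have hfint : Fintype (index '' K) := hfin.fintype
  have hsub : ∀ k : index '' K, gridCell δ k ⊆ Ω := by
    rintro ⟨_, z, hz, rfl⟩ y hy
    refine hrΩ (Metric.mem_thickening_iff.2 ⟨z, hz, ?_⟩)
    exact (dist_lt_of_mem_gridCell hy ((mem_gridCell_iff hδ).2 rfl)).trans hδr
  have hdisj : Pairwise (Function.onFun Disjoint fun k : index '' K => gridCell δ k) := by
    intro k l hkl
    refine Set.disjoint_left.2 fun y hy hy' => hkl (Subtype.ext ?_)
    rw [← (mem_gridCell_iff hδ).1 hy, ← (mem_gridCell_iff hδ).1 hy']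
  refine ⟨index '' K, hfint, fun k => gridCell δ k, 2 * (ENNReal.ofReal δ ^ 2)⁻¹, ?_,
    fun k => ⟨measurableSet_gridCell δ k, hsub k⟩, fun {m φ} hφ => ?_⟩
  · refine ENNReal.mul_ne_top (by simp) (ENNReal.inv_ne_top.2 (pow_ne_zero 2 ?_))
    simpa using hδ
  · have h1 : K ⊆ ⋃ k : index '' K, gridCell δ k := fun y hy =>
      mem_iUnion.2 ⟨⟨index y, y, hy, rfl⟩, (mem_gridCell_iff hδ).2 rfl⟩
    calc sqNorm (volume.restrict K) φ
        ≤ ∑ k : index '' K, sqNorm (volume.restrict (gridCell δ k)) φ :=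
          (sqNorm_mono_set h1 φ).trans (sqNorm_iUnion_le _ φ)
      _ ≤ ∑ k : index '' K, (8 * ENNReal.ofReal δ ^ 2 *
            sqNorm (volume.restrict (gridCell δ k)) (classicalGrad φ) +
            2 * (ENNReal.ofReal δ ^ 2)⁻¹ * ‖∫ y in gridCell δ k, φ y‖ₑ ^ 2) :=
          Finset.sum_le_sum fun k _ => sqNorm_gridCell_le hφ hδ k
      _ = 8 * ENNReal.ofReal δ ^ 2 *
            sqNorm (volume.restrict (⋃ k : index '' K, gridCell δ k)) (classicalGrad φ) +
            2 * (ENNReal.ofReal δ ^ 2)⁻¹ * ∑ k : index '' K, ‖∫ y in gridCell δ k, φ y‖ₑ ^ 2 := by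
          rw [Finset.sum_add_distrib, ← Finset.mul_sum, ← Finset.mul_sum]
          congr 2
          have h2 := lintegral_iUnion (μ := volume)
            (fun k : index '' K => measurableSet_gridCell δ k) hdisj
            fun y => ‖classicalGrad φ y‖ₑ ^ 2
          rw [tsum_fintype] at h2
          exact h2.symm
      _ ≤ _ := by
          gcongr
          exact sqNorm_mono_set (iUnion_subset hsub) _

section Domain

variable {Ω : Set Plane} {M : ℝ} (hΩ : IsLipschitzDomain Ω M) (hM : 0 < M) (𝒞 : CoordCover Ω M)

include hΩ hM 𝒞

/-- All of the `L²` norm but a small part lives on a compact subset of `Ω`: the rest of `Ω` is covered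
by thin strips along the boundary. -/
lemma exists_compact_sqNorm_le {ε : ℝ≥0∞} (hε : ε ≠ 0) :
    ∃ K ⊆ Ω, IsCompact K ∧ ∀ {m : ℕ} {φ : Plane → Vec m}, ContDiff ℝ ∞ φ →
      sqNorm (volume.restrict Ω) φ ≤ sqNorm (volume.restrict K) φ +
        ε * (sqNorm (volume.restrict Ω) φ + sqNorm (volume.restrict Ω) (classicalGrad φ)) := by
  have hr := 𝒞.r₀_pos hΩ
  set h := ENNReal.ofReal 𝒞.r₀ with hh
  have hh0 : h ≠ 0 := by simpa [hh] using hr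
  have hht : h ≠ ⊤ := ENNReal.ofReal_ne_top
  set C : ℝ≥0∞ := 𝒞.n * (h⁻¹ * (2 + 2 * h ^ 2)) with hC
  have hCt : C ≠ ⊤ := by
    refine ENNReal.mul_ne_top (by simp) (ENNReal.mul_ne_top (ENNReal.inv_ne_top.2 hh0) ?_)
    exact ENNReal.add_ne_top.2 ⟨by simp, ENNReal.mul_ne_top (by simp) (ENNReal.pow_ne_top hht)⟩
  obtain ⟨δ, hδ, hδr, hδε⟩ : ∃ δ : ℝ, 0 < δ ∧ δ ≤ 𝒞.r₀ ∧ C * ENNReal.ofReal δ ≤ ε := by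
    have h1 : Tendsto (fun δ : ℝ => C * ENNReal.ofReal δ) (𝓝[>] 0) (𝓝 0) := by
      have h2 : Tendsto (fun δ : ℝ => C * ENNReal.ofReal δ) (𝓝 0) (𝓝 (C * ENNReal.ofReal 0)) :=
        ENNReal.Tendsto.const_mul (ENNReal.tendsto_ofReal tendsto_id) (Or.inr hCt)
      rw [ENNReal.ofReal_zero, mul_zero] at h2
      exact h2.mono_left nhdsWithin_le_nhds
    have h3 := h1.eventually_le_const (pos_iff_ne_zero.2 hε)
    have h4 : ∀ᶠ δ : ℝ in 𝓝[>] 0, δ < 𝒞.r₀ := mem_nhdsWithin_of_mem_nhds (Iio_mem_nhds hr)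
    obtain ⟨δ, ⟨h5, h6⟩, h7⟩ := ((h3.and h4).and self_mem_nhdsWithin).exists
    exact ⟨δ, h7, h6.le, h5⟩
  refine ⟨core Ω (δ / (1 + M)), core_subset _ _, hΩ.isCompact_core (by positivity),
    fun {m φ} hφ => ?_⟩
  have hlayer : ∀ i, sqNorm (volume.restrict (𝒞.layer i δ)) φ ≤ ENNReal.ofReal δ *
      (h⁻¹ * (2 + 2 * h ^ 2)) *
      (sqNorm (volume.restrict Ω) φ + sqNorm (volume.restrict Ω) (classicalGrad φ)) := by
    intro i
    have h1 := mul_sqNorm_strip_le hφ (𝒞.frame i) (𝒞.continuous_graph i) (𝒞.measurableSet_base i)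
      hδr
    have h2 : strip (𝒞.frame i) (𝒞.graph i) (𝒞.base i) 𝒞.r₀ ⊆ Ω := 𝒞.layer_subset hM i le_rfl
    have h3 := sqNorm_mono_set (μ := volume) h2 φ
    have h4 := sqNorm_mono_set (μ := volume) h2 (classicalGrad φ)
    calc sqNorm (volume.restrict (𝒞.layer i δ)) φ
        = h⁻¹ * (h * sqNorm (volume.restrict (𝒞.layer i δ)) φ) := by
          rw [← mul_assoc, ENNReal.inv_mul_cancel hh0 hht, one_mul]
      _ ≤ h⁻¹ * (ENNReal.ofReal δ * (2 * sqNorm (volume.restrict Ω) φ +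
          2 * h ^ 2 * sqNorm (volume.restrict Ω) (classicalGrad φ))) := by
          refine mul_le_mul_right (h1.trans ?_) _
          gcongr
      _ ≤ h⁻¹ * (ENNReal.ofReal δ * ((2 + 2 * h ^ 2) * sqNorm (volume.restrict Ω) φ +
          (2 + 2 * h ^ 2) * sqNorm (volume.restrict Ω) (classicalGrad φ))) := by
          gcongr
          · exact le_self_add
          · exact le_add_self
      _ = _ := by ring
  calc sqNorm (volume.restrict Ω) φ
      ≤ sqNorm (volume.restrict (core Ω (δ / (1 + M)) ∪ ⋃ i, 𝒞.layer i δ)) φ :=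
        sqNorm_mono_set (𝒞.subset_core_union_layers hΩ hM hδr) φ
    _ ≤ sqNorm (volume.restrict (core Ω (δ / (1 + M)))) φ +
        ∑ i, sqNorm (volume.restrict (𝒞.layer i δ)) φ :=
        (sqNorm_union_le _ _ φ).trans (by gcongr; exact sqNorm_iUnion_le _ φ)
    _ ≤ sqNorm (volume.restrict (core Ω (δ / (1 + M)))) φ + ∑ _ : Fin 𝒞.n, ENNReal.ofReal δ *
      (h⁻¹ * (2 + 2 * h ^ 2)) *
      (sqNorm (volume.restrict Ω) φ + sqNorm (volume.restrict Ω) (classicalGrad φ)) := by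
        gcongr with i
        exact hlayer i
    _ = sqNorm (volume.restrict (core Ω (δ / (1 + M)))) φ + C * ENNReal.ofReal δ *
      (sqNorm (volume.restrict Ω) φ + sqNorm (volume.restrict Ω) (classicalGrad φ)) := by
        rw [Finset.sum_const, Finset.card_univ, Fintype.card_fin, nsmul_eq_mul, hC]
        ring
    _ ≤ _ := by gcongr

/-- A quantitative form of Rellich's theorem: up to a small multiple of the Sobolev norm, the
`L²` norm is controlled by finitely many mean values. -/
lemma exists_averages {ε : ℝ≥0∞} (hε : ε ≠ 0) :
    ∃ (κ : Type) (_ : Fintype κ) (Q : κ → Set Plane) (C : ℝ≥0∞), C ≠ ⊤ ∧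
      (∀ k, MeasurableSet (Q k) ∧ Q k ⊆ Ω) ∧
      ∀ {m : ℕ} {φ : Plane → Vec m}, ContDiff ℝ ∞ φ →
        sqNorm (volume.restrict Ω) φ ≤
          ε * (sqNorm (volume.restrict Ω) φ + sqNorm (volume.restrict Ω) (classicalGrad φ)) +
          C * ∑ k, ‖∫ y in Q k, φ y‖ₑ ^ 2 := by
  have hε2 : ε / 2 ≠ 0 := (ENNReal.half_pos hε).ne'
  obtain ⟨K, hK, hKc, h1⟩ := exists_compact_sqNorm_le hΩ hM 𝒞 hε2
  obtain ⟨κ, hκ, Q, C, hC, hQ, h2⟩ := exists_averages_compact hΩ.isOpen hKc hK hε2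
  refine ⟨κ, hκ, Q, C, hC, hQ, fun {m φ} hφ => (h1 hφ).trans ?_⟩
  calc _ ≤ (ε / 2 * sqNorm (volume.restrict Ω) (classicalGrad φ) +
        C * ∑ k, ‖∫ y in Q k, φ y‖ₑ ^ 2) + ε / 2 * (sqNorm (volume.restrict Ω) φ +
        sqNorm (volume.restrict Ω) (classicalGrad φ)) := by
        gcongr
        exact h2 hφ
    _ ≤ (ε / 2 * (sqNorm (volume.restrict Ω) φ +
        sqNorm (volume.restrict Ω) (classicalGrad φ)) +
        C * ∑ k, ‖∫ y in Q k, φ y‖ₑ ^ 2) + ε / 2 * (sqNorm (volume.restrict Ω) φ +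
        sqNorm (volume.restrict Ω) (classicalGrad φ)) := by
        gcongr
        exact le_add_self
    _ = (ε / 2 + ε / 2) * (sqNorm (volume.restrict Ω) φ +
        sqNorm (volume.restrict Ω) (classicalGrad φ)) +
        C * ∑ k, ‖∫ y in Q k, φ y‖ₑ ^ 2 := by ring
    _ = _ := by rw [ENNReal.add_halves]

/-- The trace inequality on `Ω`: the trace inequalities over the graphs, added up. -/
lemma exists_sqNorm_arcLength_le :
    ∃ C : ℝ≥0∞, C ≠ ⊤ ∧ ∀ {m : ℕ} {φ : Plane → Vec m}, ContDiff ℝ ∞ φ →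
      sqNorm (arcLength Ω) φ ≤
        C * (sqNorm (volume.restrict Ω) φ + sqNorm (volume.restrict Ω) (classicalGrad φ)) := by
  have hr := 𝒞.r₀_pos hΩ
  set h := ENNReal.ofReal 𝒞.r₀ with hh
  have hh0 : h ≠ 0 := by simpa [hh] using hr
  have hht : h ≠ ⊤ := ENNReal.ofReal_ne_top
  refine ⟨ENNReal.ofReal (1 + M) * (𝒞.n * (h⁻¹ * (2 + 2 * h ^ 2))), ?_, fun {m φ} hφ => ?_⟩
  · refine ENNReal.mul_ne_top ENNReal.ofReal_ne_top (ENNReal.mul_ne_top (by simp)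
      (ENNReal.mul_ne_top (ENNReal.inv_ne_top.2 hh0) ?_))
    exact ENNReal.add_ne_top.2 ⟨by simp, ENNReal.mul_ne_top (by simp) (ENNReal.pow_ne_top hht)⟩
  have hcurve : ∀ i, ∫⁻ s in 𝒞.base i, ‖φ (𝒞.curve i s)‖ₑ ^ 2 ≤
      (h⁻¹ * (2 + 2 * h ^ 2)) *
      (sqNorm (volume.restrict Ω) φ + sqNorm (volume.restrict Ω) (classicalGrad φ)) := by
    intro i
    have h1 := mul_lintegral_graph_le hφ (𝒞.frame i) (𝒞.continuous_graph i)
      (𝒞.measurableSet_base i) hr.le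
    have h2 : strip (𝒞.frame i) (𝒞.graph i) (𝒞.base i) 𝒞.r₀ ⊆ Ω := 𝒞.layer_subset hM i le_rfl
    have h3 := sqNorm_mono_set (μ := volume) h2 φ
    have h4 := sqNorm_mono_set (μ := volume) h2 (classicalGrad φ)
    calc ∫⁻ s in 𝒞.base i, ‖φ (𝒞.curve i s)‖ₑ ^ 2
        = h⁻¹ * (h * ∫⁻ s in 𝒞.base i, ‖φ (𝒞.curve i s)‖ₑ ^ 2) := by
          rw [← mul_assoc, ENNReal.inv_mul_cancel hh0 hht, one_mul]
      _ ≤ h⁻¹ * (2 * sqNorm (volume.restrict Ω) φ +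
          2 * h ^ 2 * sqNorm (volume.restrict Ω) (classicalGrad φ)) := by
          refine mul_le_mul_right (h1.trans ?_) _
          gcongr
      _ ≤ h⁻¹ * ((2 + 2 * h ^ 2) * sqNorm (volume.restrict Ω) φ +
          (2 + 2 * h ^ 2) * sqNorm (volume.restrict Ω) (classicalGrad φ)) := by
          gcongr
          · exact le_self_add
          · exact le_add_self
      _ = _ := by ring
  refine (𝒞.lintegral_arcLength_le hM (measurable_enorm_sq hφ)).trans ?_
  rw [mul_assoc]
  refine mul_le_mul_right ?_ _
  refine (Finset.sum_le_sum fun i _ => hcurve i).trans (le_of_eq ?_)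
  rw [Finset.sum_const, Finset.card_univ, Fintype.card_fin, nsmul_eq_mul]
  ring

omit hM 𝒞 in
/-- Local control of the `L²` norm by the gradient and the `L¹` norm on `V` propagates from square
to overlapping square through the connected set `Ω`. -/
lemma exists_sqNorm_compact_le {V : Set Plane} (hV : IsOpen V) (hVne : V.Nonempty) (hVΩ : V ⊆ Ω)
    {K : Set Plane} (hK : IsCompact K) (hKΩ : K ⊆ Ω) (m : ℕ) :
    ∃ C : ℝ≥0∞, C ≠ ⊤ ∧ ∀ {φ : Plane → Vec m}, ContDiff ℝ ∞ φ →
      sqNorm (volume.restrict K) φ ≤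
        C * (sqNorm (volume.restrict Ω) (classicalGrad φ) + (∫⁻ x in V, ‖φ x‖ₑ) ^ 2) := by
  set R : (Plane → Vec m) → ℝ≥0∞ := fun φ =>
    sqNorm (volume.restrict Ω) (classicalGrad φ) + (∫⁻ x in V, ‖φ x‖ₑ) ^ 2 with hR
  let good : Set Plane → Prop := fun A => ∃ C : ℝ≥0∞, C ≠ ⊤ ∧
    ∀ {φ : Plane → Vec m}, ContDiff ℝ ∞ φ → sqNorm (volume.restrict A) φ ≤ C * R φ
  -- A square inside `Ω` is good if the means over an open part of it are under control.
  have hsq : ∀ x ℓ, square x ℓ ⊆ Ω → ∀ A ⊆ square x ℓ, IsOpen A → A.Nonempty →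
      (∃ C : ℝ≥0∞, C ≠ ⊤ ∧ ∀ {φ : Plane → Vec m}, ContDiff ℝ ∞ φ →
        ‖∫ y in A, φ y‖ₑ ^ 2 ≤ C * R φ) → good (square x ℓ) := by
    rintro x ℓ hxΩ A hA hAo hAne ⟨C, hC, h⟩
    have hA0 : volume A ^ 2 ≠ 0 := pow_ne_zero 2 (hAo.measure_pos volume hAne).ne'
    have hAt' : volume A ≠ ⊤ := ((hΩ.isBounded.subset hxΩ).subset hA).measure_lt_top.ne
    have hAt : volume A ^ 2 ≠ ⊤ := ENNReal.pow_ne_top hAt'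
    refine ⟨(volume A ^ 2)⁻¹ * (8 * ENNReal.ofReal (2 * ℓ) ^ 4 * volume A +
      2 * ENNReal.ofReal (2 * ℓ) ^ 2 * C), ?_, fun {φ} hφ => ?_⟩
    · refine ENNReal.mul_ne_top (ENNReal.inv_ne_top.2 hA0) (ENNReal.add_ne_top.2 ⟨?_, ?_⟩)
      · exact ENNReal.mul_ne_top (ENNReal.mul_ne_top (by simp)
          (ENNReal.pow_ne_top ENNReal.ofReal_ne_top)) hAt'
      · exact ENNReal.mul_ne_top (ENNReal.mul_ne_top (by simp)
          (ENNReal.pow_ne_top ENNReal.ofReal_ne_top)) hC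
    · calc sqNorm (volume.restrict (square x ℓ)) φ
          = (volume A ^ 2)⁻¹ * (volume A ^ 2 * sqNorm (volume.restrict (square x ℓ)) φ) := by
            rw [← mul_assoc, ENNReal.inv_mul_cancel hA0 hAt, one_mul]
        _ ≤ (volume A ^ 2)⁻¹ * (8 * ENNReal.ofReal (2 * ℓ) ^ 4 * volume A * R φ +
            2 * ENNReal.ofReal (2 * ℓ) ^ 2 * (C * R φ)) := by
            refine mul_le_mul_right ((sqNorm_square_le hφ x ℓ hA).trans ?_) _
            gcongr
            · exact (sqNorm_mono_set hxΩ _).trans le_self_add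
            · exact h hφ
        _ = _ := by ring
  have hmono : ∀ {A B}, A ⊆ B → good B → good A := by
    rintro A B hAB ⟨C, hC, h⟩
    exact ⟨C, hC, fun hφ => (sqNorm_mono_set hAB _).trans (h hφ)⟩
  -- The union of the good open sets is nonempty and relatively closed in `Ω`, hence contains `Ω`.
  let U : Set Plane := ⋃₀ {A | IsOpen A ∧ good A}
  have hUo : IsOpen U := isOpen_sUnion fun A hA => hA.1
  have hΩU : Ω ⊆ U := by
    refine hΩ.isConnected.isPreconnected.subset_of_closure_inter_subset hUo ?_ ?_
    · obtain ⟨x, hx⟩ := hVne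
      obtain ⟨ℓ, hℓ, hsub⟩ := exists_square_subset hV hx
      refine ⟨x, hVΩ hx, square x ℓ, ⟨isOpen_square x ℓ, ?_⟩, mem_square_self x hℓ⟩
      refine hsq x ℓ (hsub.trans hVΩ) _ Subset.rfl (isOpen_square x ℓ) ⟨x, mem_square_self x hℓ⟩
        ⟨1, by simp, fun {φ} _ => ?_⟩
      rw [one_mul]
      refine le_trans ?_ (le_add_self (a := (∫⁻ x in V, ‖φ x‖ₑ) ^ 2))
      gcongr
      exact (enorm_integral_le_lintegral_enorm _).trans (lintegral_mono_set hsub)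
    · rintro x ⟨hxU, hxΩ⟩
      obtain ⟨ℓ, hℓ, hsub⟩ := exists_square_subset hΩ.isOpen hxΩ
      obtain ⟨y, hy, A, ⟨hAo, C, hC, hA⟩, hyA⟩ := mem_closure_iff.1 hxU _ (isOpen_square x ℓ)
        (mem_square_self x hℓ)
      refine ⟨square x ℓ, ⟨isOpen_square x ℓ, ?_⟩, mem_square_self x hℓ⟩
      have hBt : volume (square x ℓ ∩ A) ≠ ⊤ :=
        ((hΩ.isBounded.subset hsub).subset inter_subset_left).measure_lt_top.ne
      refine hsq x ℓ hsub (square x ℓ ∩ A) inter_subset_left ((isOpen_square x ℓ).inter hAo)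
        ⟨y, hy, hyA⟩ ⟨volume (square x ℓ ∩ A) * C, ENNReal.mul_ne_top hBt hC, fun {φ} hφ => ?_⟩
      have h1 := lintegral_sq_le (volume.restrict (square x ℓ ∩ A)) (f := fun x => ‖φ x‖ₑ)
        hφ.continuous.enorm.measurable.aemeasurable
      rw [Measure.restrict_apply_univ] at h1
      calc ‖∫ y in square x ℓ ∩ A, φ y‖ₑ ^ 2
          ≤ (∫⁻ y in square x ℓ ∩ A, ‖φ y‖ₑ) ^ 2 := by
            gcongr
            exact enorm_integral_le_lintegral_enorm _
        _ ≤ volume (square x ℓ ∩ A) * sqNorm (volume.restrict (square x ℓ ∩ A)) φ := h1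
        _ ≤ volume (square x ℓ ∩ A) * (C * R φ) := by
            gcongr
            exact (sqNorm_mono_set inter_subset_right _).trans (hA hφ)
        _ = _ := by ring
  refine hK.induction_on (p := good) ⟨0, by simp, fun _ => by simp [sqNorm]⟩
    (fun s t hst ht => hmono hst ht) ?_ ?_
  · rintro s t ⟨C, hC, hs⟩ ⟨C', hC', ht⟩
    refine ⟨C + C', ENNReal.add_ne_top.2 ⟨hC, hC'⟩, fun hφ => (sqNorm_union_le s t _).trans ?_⟩
    rw [add_mul]
    exact add_le_add (hs hφ) (ht hφ)
  · intro x hx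
    obtain ⟨A, ⟨hAo, hA⟩, hxA⟩ := hΩU (hKΩ hx)
    exact ⟨A, mem_nhdsWithin_of_mem_nhds (hAo.mem_nhds hxA), hA⟩

/-- Poincaré's inequality on `Ω`: the additive constant is controlled by the `L¹` norm on an open
part `V`. -/
lemma exists_sqNorm_le {V : Set Plane} (hV : IsOpen V) (hVne : V.Nonempty) (hVΩ : V ⊆ Ω) (m : ℕ) :
    ∃ C : ℝ≥0∞, C ≠ ⊤ ∧ ∀ {φ : Plane → Vec m}, ContDiff ℝ ∞ φ →
      sqNorm (volume.restrict Ω) φ ≤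
        C * (sqNorm (volume.restrict Ω) (classicalGrad φ) + (∫⁻ x in V, ‖φ x‖ₑ) ^ 2) := by
  obtain ⟨K, hK, hKc, h1⟩ := exists_compact_sqNorm_le hΩ hM 𝒞 (ε := 2⁻¹) (by simp)
  obtain ⟨C, hC, h2⟩ := exists_sqNorm_compact_le hΩ hV hVne hVΩ hKc hK m
  refine ⟨2 * C + 1, ENNReal.add_ne_top.2 ⟨ENNReal.mul_ne_top (by simp) hC, by simp⟩,
    fun {φ} hφ => ?_⟩
  -- The finiteness of the left-hand side allows the term with the factor `1 / 2` to be absorbed.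
  have h3 := ENNReal_absorb (sqNorm_lt_top_of_continuous hΩ.isBounded hφ.continuous).ne (h1 hφ)
  refine h3.trans ?_
  rw [add_mul, one_mul, mul_assoc]
  gcongr
  · exact h2 hφ
  · exact le_self_add

end Domain

/-! ### Convergence in `L²` -/

section Convergence

variable {F : Type*} [NormedAddCommGroup F] {μ ν : Measure Plane} {φ : ℕ → Plane → F}
  {f g : Plane → F}

lemma eLpNorm_two_sq {X : Type*} [MeasurableSpace X] (μ : Measure X) (f : X → F) :
    eLpNorm f 2 μ ^ 2 = sqNorm μ f := by
  rw [eLpNorm_eq_lintegral_rpow_enorm_toReal (by simp) (by simp), ← ENNReal.rpow_natCast,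
    ← ENNReal.rpow_mul, sqNorm]
  norm_num

lemma sqNorm_congr {X : Type*} [MeasurableSpace X] {μ : Measure X} {f g : X → F}
    (h : f =ᵐ[μ] g) : sqNorm μ f = sqNorm μ g :=
  lintegral_congr_ae (h.mono fun x hx => by simp only [hx])

lemma sqNorm_lt_top_iff_memLp {X : Type*} [MeasurableSpace X] {μ : Measure X} {f : X → F}
    (hf : AEStronglyMeasurable f μ) : sqNorm μ f < ⊤ ↔ MemLp f 2 μ := by
  rw [← eLpNorm_two_sq, ENNReal.pow_lt_top_iff]
  simp [MemLp, hf]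

lemma memLp_of_continuous {Ω : Set Plane} (hΩ : Bornology.IsBounded Ω) (hf : Continuous f) :
    MemLp f 2 (volume.restrict Ω) := by
  rw [← sqNorm_lt_top_iff_memLp]
  · exact sqNorm_lt_top_of_continuous hΩ hf
  · exact ((hf.continuousOn.aestronglyMeasurable_of_isCompact hΩ.isCompact_closure
      isClosed_closure.measurableSet).mono_measure (Measure.restrict_mono subset_closure le_rfl))

lemma sqNorm_sub_le {X : Type*} [MeasurableSpace X] (μ : Measure X) {f g h : X → F}
    (hf : AEStronglyMeasurable f μ) (hh : AEStronglyMeasurable h μ) :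
    sqNorm μ (f - g) ≤ 2 * sqNorm μ (f - h) + 2 * sqNorm μ (g - h) := by
  have hm : AEMeasurable (fun x => 2 * ‖(f - h) x‖ₑ ^ 2) μ :=
    (((hf.sub hh).enorm).pow_const 2).const_mul 2
  rw [sqNorm, sqNorm, sqNorm, ← lintegral_const_mul'' _ (((hf.sub hh).enorm).pow_const 2),
    ← lintegral_const_mul' _ _ (by simp), ← lintegral_add_left' hm]
  refine lintegral_mono fun x => ?_
  refine le_trans ?_ (ENNReal_add_sq_le _ _)
  gcongr
  rw [show (f - g) x = (f - h) x - (g - h) x by simp]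
  exact enorm_sub_le

lemma eLpNorm_one_sub_sq_le {X : Type*} [MeasurableSpace X] (μ : Measure X) {f g h : X → F}
    (hf : AEStronglyMeasurable f μ) (hg : AEStronglyMeasurable g μ)
    (hh : AEStronglyMeasurable h μ) :
    eLpNorm (f - g) 1 μ ^ 2 ≤ 2 * eLpNorm (f - h) 1 μ ^ 2 + 2 * eLpNorm (g - h) 1 μ ^ 2 := by
  refine le_trans ?_ (ENNReal_add_sq_le _ _)
  gcongr
  rw [show f - g = (f - h) - (g - h) by abel]
  exact eLpNorm_sub_le (hf.sub hh) (hg.sub hh) le_rfl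

lemma convLp_iff_sqNorm : ConvLp 2 μ φ f ↔ Tendsto (fun k => sqNorm μ (φ k - f)) atTop (𝓝 0) := by
  simp only [← eLpNorm_two_sq]
  constructor
  · intro h
    have h1 := ENNReal.Tendsto.pow (n := 2) h
    rw [zero_pow two_ne_zero] at h1
    exact h1
  · intro h
    have h1 := (ENNReal.continuous_rpow_const (y := (1 / 2 : ℝ))).tendsto 0 |>.comp h
    rw [ENNReal.zero_rpow_of_pos (by norm_num)] at h1
    refine h1.congr fun k => ?_
    simp only [Function.comp_apply]
    rw [← ENNReal.rpow_natCast, ← ENNReal.rpow_mul]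
    norm_num
    rfl

lemma ConvLp.mono_measure {p : ℝ≥0∞} (h : ConvLp p ν φ f) (hμ : μ ≤ ν) : ConvLp p μ φ f :=
  tendsto_of_tendsto_of_tendsto_of_le_of_le tendsto_const_nhds h (fun _ => zero_le)
    fun _ => eLpNorm_mono_measure _ hμ

lemma ConvLp.to_one [IsFiniteMeasure μ] (h : ConvLp 2 μ φ f)
    (hφ : ∀ k, AEStronglyMeasurable (φ k) μ) (hf : AEStronglyMeasurable f μ) :
    ConvLp 1 μ φ f := by
  have h1 := ENNReal.Tendsto.mul_const (b := μ univ ^ (1 / (1 : ℝ≥0∞).toReal - 1 / (2 : ℝ≥0∞).toReal))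
    h (Or.inr (by
      refine ENNReal.rpow_ne_top_of_nonneg (by norm_num) (measure_ne_top μ _)))
  rw [zero_mul] at h1
  exact tendsto_of_tendsto_of_tendsto_of_le_of_le tendsto_const_nhds h1 (fun _ => zero_le)
    fun k => eLpNorm_le_eLpNorm_mul_rpow_measure_univ (by norm_num) ((hφ k).sub hf)

lemma ConvLp.ae_eq {p : ℝ≥0∞} (hp : 1 ≤ p) (hφ : ∀ k, AEStronglyMeasurable (φ k) μ)
    (hf : AEStronglyMeasurable f μ) (hg : AEStronglyMeasurable g μ)
    (h1 : ConvLp p μ φ f) (h2 : ConvLp p μ φ g) : f =ᵐ[μ] g := by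
  have h3 := Tendsto.add h1 h2
  rw [add_zero] at h3
  have h4 : eLpNorm (f - g) p μ ≤ 0 := by
    refine ge_of_tendsto' h3 fun k => ?_
    rw [show f - g = (φ k - g) - (φ k - f) by abel, add_comm]
    exact eLpNorm_sub_le ((hφ k).sub hg) ((hφ k).sub hf) hp
  have h5 := (eLpNorm_eq_zero_iff (hf.sub hg) (by positivity)).1 (le_antisymm h4 zero_le)
  filter_upwards [h5] with x hx
  simpa [sub_eq_zero] using hx

lemma ConvLp.congr {p : ℝ≥0∞} (h : ConvLp p μ φ f) (hfg : f =ᵐ[μ] g) : ConvLp p μ φ g := by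
  refine Tendsto.congr (fun k => eLpNorm_congr_ae ?_) h
  filter_upwards [hfg] with x hx
  rw [hx]

lemma ConvLp.congr_left {p : ℝ≥0∞} {χ : ℕ → Plane → F} (h : ConvLp p μ φ f)
    (hφχ : ∀ k, φ k =ᵐ[μ] χ k) : ConvLp p μ χ f := by
  refine Tendsto.congr (fun k => eLpNorm_congr_ae ?_) h
  filter_upwards [hφχ k] with x hx
  rw [hx]

lemma convLp_iff_tendsto_toLp (hφ : ∀ k, MemLp (φ k) 2 μ) (hf : MemLp f 2 μ) :
    ConvLp 2 μ φ f ↔ Tendsto (fun k => (hφ k).toLp (φ k)) atTop (𝓝 (hf.toLp f)) :=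
  (Lp.tendsto_Lp_iff_tendsto_eLpNorm'' φ hφ f hf).symm

lemma enorm_toLp_sq (hf : MemLp f 2 μ) : ‖hf.toLp f‖ₑ ^ 2 = sqNorm μ f := by
  rw [Lp.enorm_def, eLpNorm_congr_ae hf.coeFn_toLp, eLpNorm_two_sq]

lemma enorm_sq_eq_sqNorm (f : Lp F 2 μ) : ‖f‖ₑ ^ 2 = sqNorm μ f := by
  rw [Lp.enorm_def, eLpNorm_two_sq]

lemma norm_sq_eq_toReal_sqNorm (f : Lp F 2 μ) : ‖f‖ ^ 2 = (sqNorm μ f).toReal := by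
  rw [← enorm_sq_eq_sqNorm, ENNReal.toReal_pow, toReal_enorm]

lemma ConvLp.tendsto_sqNorm (hφ : ∀ k, MemLp (φ k) 2 μ) (hf : MemLp f 2 μ)
    (h : ConvLp 2 μ φ f) : Tendsto (fun k => sqNorm μ (φ k)) atTop (𝓝 (sqNorm μ f)) := by
  have h1 := (ENNReal.Tendsto.pow (n := 2)
    ((continuous_enorm.tendsto _).comp ((convLp_iff_tendsto_toLp hφ hf).1 h)))
  simpa only [Function.comp_apply, enorm_toLp_sq] using h1

lemma exists_convLp_of_cauchy [CompleteSpace F] (hφ : ∀ k, MemLp (φ k) 2 μ) {C : ℝ≥0∞} (hC : C ≠ ⊤)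
    {b : ℕ → ℝ≥0∞} (hb : Tendsto b atTop (𝓝 0))
    (h : ∀ k l, sqNorm μ (φ k - φ l) ≤ C * (b k + b l)) :
    ∃ f : Lp F 2 μ, ConvLp 2 μ φ f := by
  have hcau : CauchySeq fun k => (hφ k).toLp (φ k) := by
    rw [EMetric.cauchySeq_iff]
    intro ε hε
    have h1 : Tendsto (fun k => C * b k) atTop (𝓝 0) := by
      simpa using ENNReal.Tendsto.const_mul (a := C) hb (Or.inr hC)
    have hε2 : 0 < ε ^ 2 / 2 := ENNReal.half_pos (pow_ne_zero 2 hε.ne')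
    obtain ⟨N, hN⟩ := eventually_atTop.1 (h1.eventually_lt_const hε2)
    refine ⟨N, fun k hk l hl => ?_⟩
    rw [Lp.edist_toLp_toLp]
    have h2 : eLpNorm (φ k - φ l) 2 μ ^ 2 < ε ^ 2 := by
      calc eLpNorm (φ k - φ l) 2 μ ^ 2 ≤ C * b k + C * b l := by
            rw [eLpNorm_two_sq, ← mul_add]
            exact h k l
        _ < ε ^ 2 / 2 + ε ^ 2 / 2 := ENNReal.add_lt_add (hN k hk) (hN l hl)
        _ = ε ^ 2 := ENNReal.add_halves _
    exact lt_of_not_ge fun h3 => h2.not_ge (pow_le_pow_left₀ zero_le h3 2)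
  obtain ⟨f, hf⟩ := cauchySeq_tendsto_of_complete hcau
  refine ⟨f, (convLp_iff_tendsto_toLp hφ (Lp.memLp f)).2 ?_⟩
  rwa [Lp.toLp_coeFn]

end Convergence

/-! ### The Sobolev space as a Hilbert space of pairs -/

section Approximation

variable {Ω : Set Plane} {M : ℝ} {m : ℕ}

lemma classicalGrad_sub {φ χ : Plane → Vec m} (hφ : Differentiable ℝ φ)
    (hχ : Differentiable ℝ χ) : classicalGrad (φ - χ) = classicalGrad φ - classicalGrad χ := by
  funext x
  ext p
  simp [classicalGrad, fderiv_sub (hφ x) (hχ x)]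

/-- Approximation of `u` with gradient `G` in the full Sobolev norm. -/
structure StrongConv (Ω : Set Plane) (φ : ℕ → Plane → Vec m) (u : Plane → Vec m)
    (G : Plane → GradVec m) : Prop where
  fn : ConvLp 2 (volume.restrict Ω) φ u
  grad : ConvLp 2 (volume.restrict Ω) (fun k => classicalGrad (φ k)) G

lemma IsLipschitzDomain.isFiniteMeasure (hΩ : IsLipschitzDomain Ω M) :
    IsFiniteMeasure (volume.restrict Ω) :=
  ⟨by rw [Measure.restrict_apply_univ]; exact hΩ.isBounded.measure_lt_top⟩

lemma memLp_smooth (hΩ : IsLipschitzDomain Ω M) {φ : Plane → Vec m} (hφ : ContDiff ℝ ∞ φ) :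
    MemLp φ 2 (volume.restrict Ω) :=
  memLp_of_continuous hΩ.isBounded hφ.continuous

lemma memLp_classicalGrad (hΩ : IsLipschitzDomain Ω M) {φ : Plane → Vec m}
    (hφ : ContDiff ℝ ∞ φ) : MemLp (classicalGrad φ) 2 (volume.restrict Ω) :=
  memLp_of_continuous hΩ.isBounded (continuous_classicalGrad hφ)

lemma ae_eq_of_forall_compact (hΩ : IsLipschitzDomain Ω M) {u v : Plane → Vec m}
    (h : ∀ K ⊆ Ω, IsCompact K → u =ᵐ[volume.restrict K] v) : u =ᵐ[volume.restrict Ω] v := by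
  have h1 : Ω ⊆ ⋃ n : ℕ, core Ω (1 / (n + 1)) := by
    intro y hy
    have hd : 0 < Metric.infDist y (frontier Ω) :=
      (isClosed_frontier.notMem_iff_infDist_pos hΩ.frontier_nonempty).1
        fun h => hΩ.notMem_of_mem_frontier h hy
    obtain ⟨n, hn⟩ := exists_nat_one_div_lt hd
    exact mem_iUnion.2 ⟨n, hy, hn.le⟩
  refine ae_restrict_of_ae_restrict_of_subset h1 ?_
  rw [ae_restrict_iUnion_iff]
  exact fun n => h _ (core_subset _ _) (hΩ.isCompact_core (by positivity))

/-- On a Lipschitz domain, convergence of the gradients in `L²(Ω)` and of the functions in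
`L¹_loc(Ω)` implies convergence of the functions in `L²(Ω)`. -/
lemma SobolevConv.memLp_and_strongConv (hΩ : IsLipschitzDomain Ω M) (hM : 0 < M)
    (𝒞 : CoordCover Ω M) {φ : ℕ → Plane → Vec m} (hφ : ∀ k, ContDiff ℝ ∞ (φ k))
    {u : Plane → Vec m} {G : Plane → GradVec m} (hu : AEStronglyMeasurable u (volume.restrict Ω))
    (hG : AEStronglyMeasurable G (volume.restrict Ω)) (h : SobolevConv Ω φ u G) :
    MemLp u 2 (volume.restrict Ω) ∧ StrongConv Ω φ u G := by
  obtain ⟨x, hx⟩ := hΩ.isConnected.nonempty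
  obtain ⟨r, hr, hrΩ⟩ := Metric.nhds_basis_closedBall.mem_iff.1 (hΩ.isOpen.mem_nhds hx)
  have hcpt : IsCompact (Metric.closedBall x r) := isCompact_closedBall x r
  obtain ⟨C, hC, hP⟩ := exists_sqNorm_le hΩ hM 𝒞 (V := Metric.ball x r) Metric.isOpen_ball
    ⟨x, Metric.mem_ball_self hr⟩ (Metric.ball_subset_closedBall.trans hrΩ) m
  set ν := (volume : Measure Plane).restrict (Metric.closedBall x r) with hν
  have huν : AEStronglyMeasurable u ν := hu.mono_measure (Measure.restrict_mono hrΩ le_rfl)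
  have hφm : ∀ k (μ : Measure Plane), AEStronglyMeasurable (φ k) μ := fun k μ =>
    (hφ k).continuous.aestronglyMeasurable
  have hgm : ∀ k (μ : Measure Plane), AEStronglyMeasurable (classicalGrad (φ k)) μ := fun k μ =>
    (continuous_classicalGrad (hφ k)).aestronglyMeasurable
  set b : ℕ → ℝ≥0∞ := fun k => 2 * sqNorm (volume.restrict Ω) (classicalGrad (φ k) - G) +
    2 * eLpNorm (φ k - u) 1 ν ^ 2 with hb
  have hb0 : Tendsto b atTop (𝓝 0) := by
    have h1 := ENNReal.Tendsto.const_mul (a := 2) (convLp_iff_sqNorm.1 h.grad) (Or.inr (by simp))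
    have h2 := ENNReal.Tendsto.const_mul (a := 2)
      (ENNReal.Tendsto.pow (n := 2) (h.loc _ hrΩ hcpt)) (Or.inr (by simp))
    have h3 := h1.add h2
    simp only [mul_zero, ne_eq, OfNat.ofNat_ne_zero, not_false_eq_true, zero_pow, add_zero] at h3
    exact h3
  obtain ⟨v, hv⟩ := exists_convLp_of_cauchy (fun k => memLp_smooth hΩ (hφ k)) hC hb0 (by
    intro k l
    have hsub : ContDiff ℝ ∞ (φ k - φ l) := (hφ k).sub (hφ l)
    refine (hP hsub).trans (mul_le_mul_right ?_ _)
    rw [classicalGrad_sub ((hφ k).differentiable (by simp)) ((hφ l).differentiable (by simp))]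
    have h1 := sqNorm_sub_le (volume.restrict Ω) (g := classicalGrad (φ l)) (hgm k _) hG
    have h2 := eLpNorm_one_sub_sq_le ν (hφm k _) (hφm l _) huν
    have h3 : (∫⁻ x in Metric.ball x r, ‖(φ k - φ l) x‖ₑ) ^ 2 ≤ eLpNorm (φ k - φ l) 1 ν ^ 2 := by
      rw [eLpNorm_one_eq_lintegral_enorm]
      exact pow_le_pow_left₀ zero_le (lintegral_mono_set Metric.ball_subset_closedBall) 2
    refine (add_le_add h1 (h3.trans h2)).trans (le_of_eq ?_)
    simp only [hb]
    ring)
  have huv : u =ᵐ[volume.restrict Ω] v := by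
    refine ae_eq_of_forall_compact hΩ fun K hK hKc => ?_
    have hle : (volume : Measure Plane).restrict K ≤ volume.restrict Ω :=
      Measure.restrict_mono hK le_rfl
    have : IsFiniteMeasure ((volume : Measure Plane).restrict K) :=
      ⟨by rw [Measure.restrict_apply_univ]; exact hKc.measure_lt_top⟩
    have hvK : AEStronglyMeasurable v ((volume : Measure Plane).restrict K) :=
      (Lp.aestronglyMeasurable v).mono_measure hle
    exact ConvLp.ae_eq le_rfl (fun k => hφm k _) (hu.mono_measure hle) hvK (h.loc K hK hKc)
      ((hv.mono_measure hle).to_one (fun k => hφm k _) hvK)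
  exact ⟨(memLp_congr_ae huv).2 (Lp.memLp v), hv.congr huv.symm, h.grad⟩

lemma StrongConv.sobolevConv {φ : ℕ → Plane → Vec m}
    (hφ : ∀ k, ContDiff ℝ ∞ (φ k)) {u : Plane → Vec m} {G : Plane → GradVec m}
    (hu : AEStronglyMeasurable u (volume.restrict Ω)) (h : StrongConv Ω φ u G) :
    SobolevConv Ω φ u G := by
  refine ⟨h.grad, fun K hK hKc => ?_⟩
  have hle : (volume : Measure Plane).restrict K ≤ volume.restrict Ω :=
    Measure.restrict_mono hK le_rfl
  have : IsFiniteMeasure ((volume : Measure Plane).restrict K) :=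
    ⟨by rw [Measure.restrict_apply_univ]; exact hKc.measure_lt_top⟩
  exact (h.fn.mono_measure hle).to_one (fun k => (hφ k).continuous.aestronglyMeasurable)
    (hu.mono_measure hle)

end Approximation

section PairSpace

variable (Ω D : Set Plane) (m : ℕ)

/-- Pairs of a function and a field of gradients, both in `L²(Ω)`. -/
abbrev PairSpace : Type :=
  WithLp 2 (Lp (Vec m) 2 (volume.restrict Ω) × Lp (GradVec m) 2 (volume.restrict Ω))

/-- The pairs `(φ, ∇φ)` for smooth functions `φ` that vanish in a neighborhood of `D`. -/
def smoothPairs : Submodule ℝ (PairSpace Ω m) where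
  carrier := {p | ∃ φ : Plane → Vec m, ContDiff ℝ ∞ φ ∧ φ =ᶠ[𝓝ˢ D] 0 ∧
    p.fst =ᵐ[volume.restrict Ω] φ ∧ p.snd =ᵐ[volume.restrict Ω] classicalGrad φ}
  zero_mem' := by
    refine ⟨0, contDiff_const, EventuallyEq.rfl, Lp.coeFn_zero _ _ _, ?_⟩
    rw [classicalGrad_zero]
    exact Lp.coeFn_zero _ _ _
  add_mem' := by
    rintro p q ⟨φ, hφ, hφD, hp1, hp2⟩ ⟨χ, hχ, hχD, hq1, hq2⟩
    refine ⟨φ + χ, hφ.add hχ, ?_, ?_, ?_⟩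
    · filter_upwards [hφD, hχD] with x hx hx'
      simp [hx, hx']
    · exact (Lp.coeFn_add p.fst q.fst).trans (hp1.add hq1)
    · rw [classicalGrad_add (hφ.differentiable (by simp)) (hχ.differentiable (by simp))]
      exact (Lp.coeFn_add p.snd q.snd).trans (hp2.add hq2)
  smul_mem' := by
    rintro c p ⟨φ, hφ, hφD, hp1, hp2⟩
    refine ⟨c • φ, contDiff_const.smul hφ, ?_, ?_, ?_⟩
    · filter_upwards [hφD] with x hx
      simp [hx]
    · exact (Lp.coeFn_smul c p.fst).trans (hp1.const_smul c)
    · rw [classicalGrad_smul c (hφ.differentiable (by simp))]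
      exact (Lp.coeFn_smul c p.snd).trans (hp2.const_smul c)

/-- The Sobolev space as a closed subspace of the Hilbert space of pairs. -/
def sobolevPairs : Submodule ℝ (PairSpace Ω m) := (smoothPairs Ω D m).topologicalClosure

instance : CompleteSpace (sobolevPairs Ω D m) :=
  (smoothPairs Ω D m).isClosed_topologicalClosure.completeSpace_coe

variable {Ω D m} {M : ℝ}

lemma convLp_coeFn_iff {F : Type*} [NormedAddCommGroup F] {μ : Measure Plane} {f : ℕ → Lp F 2 μ}
    {g : Lp F 2 μ} : Tendsto f atTop (𝓝 g) ↔ ConvLp 2 μ (fun k => f k) g :=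
  Lp.tendsto_Lp_iff_tendsto_eLpNorm' f g

lemma tendsto_pair_iff {p : ℕ → PairSpace Ω m} {q : PairSpace Ω m} :
    Tendsto p atTop (𝓝 q) ↔
      Tendsto (fun k => (p k).fst) atTop (𝓝 q.fst) ∧
      Tendsto (fun k => (p k).snd) atTop (𝓝 q.snd) := by
  constructor
  · intro h
    exact ⟨((WithLp.continuous_fst 2 _ _).tendsto q).comp h,
      ((WithLp.continuous_snd 2 _ _).tendsto q).comp h⟩
  · rintro ⟨h1, h2⟩
    have h3 := h1.prodMk_nhds h2
    exact ((WithLp.prod_continuous_toLp 2 _ _).tendsto _).comp h3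

/-- Membership in the Sobolev space in terms of approximating sequences. -/
lemma mem_sobolevPairs_iff (hΩ : IsLipschitzDomain Ω M) {p : PairSpace Ω m} :
    p ∈ sobolevPairs Ω D m ↔ ∃ φ : ℕ → Plane → Vec m, (∀ k, ContDiff ℝ ∞ (φ k)) ∧
      (∀ k, φ k =ᶠ[𝓝ˢ D] 0) ∧ StrongConv Ω φ p.fst p.snd := by
  rw [sobolevPairs, ← SetLike.mem_coe, Submodule.topologicalClosure_coe, mem_closure_iff_seq_limit]
  constructor
  · rintro ⟨q, hq, hqp⟩
    choose φ hφ hφD hq1 hq2 using hq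
    obtain ⟨h1, h2⟩ := tendsto_pair_iff.1 hqp
    exact ⟨φ, hφ, hφD, (convLp_coeFn_iff.1 h1).congr_left hq1,
      (convLp_coeFn_iff.1 h2).congr_left hq2⟩
  · rintro ⟨φ, hφ, hφD, h1, h2⟩
    refine ⟨fun k => WithLp.toLp 2 ((memLp_smooth hΩ (hφ k)).toLp,
      (memLp_classicalGrad hΩ (hφ k)).toLp), fun k => ⟨φ k, hφ k, hφD k, ?_, ?_⟩, ?_⟩
    · exact (memLp_smooth hΩ (hφ k)).coeFn_toLp
    · exact (memLp_classicalGrad hΩ (hφ k)).coeFn_toLp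
    · rw [tendsto_pair_iff]
      exact ⟨convLp_coeFn_iff.2 (h1.congr_left fun k => (memLp_smooth hΩ (hφ k)).coeFn_toLp.symm),
        convLp_coeFn_iff.2 (h2.congr_left fun k =>
          (memLp_classicalGrad hΩ (hφ k)).coeFn_toLp.symm)⟩

/-- A closed condition on pairs that holds for smooth functions holds on the Sobolev space. -/
lemma sobolevPairs_induction (hΩ : IsLipschitzDomain Ω M) {P : PairSpace Ω m → Prop}
    (hP : IsClosed {p | P p})
    (h : ∀ φ : Plane → Vec m, ∀ hφ : ContDiff ℝ ∞ φ,
      P (WithLp.toLp 2 ((memLp_smooth hΩ hφ).toLp, (memLp_classicalGrad hΩ hφ).toLp)))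
    {p : PairSpace Ω m} (hp : p ∈ sobolevPairs Ω D m) : P p := by
  refine closure_minimal (s := (smoothPairs Ω D m : Set (PairSpace Ω m))) ?_ hP hp
  rintro q ⟨φ, hφ, -, h1, h2⟩
  have e : q = WithLp.toLp 2 ((memLp_smooth hΩ hφ).toLp, (memLp_classicalGrad hΩ hφ).toLp) := by
    refine WithLp.ofLp_injective 2 (Prod.ext ?_ ?_)
    · exact Lp.ext (h1.trans (memLp_smooth hΩ hφ).coeFn_toLp.symm)
    · exact Lp.ext (h2.trans (memLp_classicalGrad hΩ hφ).coeFn_toLp.symm)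
  change P q
  rw [e]
  exact h φ hφ

lemma isWeakGrad_classicalGrad {φ : Plane → Vec m} (hφ : ContDiff ℝ ∞ φ) :
    IsWeakGrad Ω φ (classicalGrad φ) := by
  intro ψ hψ hc hs i α
  have hsupp : ∀ x, x ∉ tsupport ψ → partialDeriv i ψ x = 0 := by
    intro x hx
    have : fderiv ℝ ψ x = 0 := by
      by_contra h
      exact hx (tsupport_fderiv_subset ℝ (subset_tsupport _ h))
    simp [partialDeriv, this]
  have hcomp : ContDiff ℝ ∞ fun x => φ x α :=
    (EuclideanSpace.proj (𝕜 := ℝ) α).contDiff.comp hφ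
  have hgrad : ∀ x, fderiv ℝ (fun x => φ x α) x (EuclideanSpace.single i 1) =
      classicalGrad φ x (i, α) := by
    intro x
    have h1 := (EuclideanSpace.proj (𝕜 := ℝ) α).hasFDerivAt.comp x
      ((hφ.differentiable (by simp)) x).hasFDerivAt
    have h2 : fderiv ℝ (fun x => φ x α) x = _ := h1.fderiv
    rw [h2]
    rfl
  have hcontψ : Continuous (partialDeriv i ψ) := by
    have h := hψ.continuous_fderiv (by simp)
    unfold partialDeriv
    fun_prop
  have hcontG : Continuous fun x => classicalGrad φ x (i, α) :=
    (EuclideanSpace.proj (𝕜 := ℝ) (i, α)).continuous.comp (continuous_classicalGrad hφ)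
  have hi1 : Integrable (fun x => classicalGrad φ x (i, α) * ψ x) :=
    (hcontG.mul hψ.continuous).integrable_of_hasCompactSupport hc.mul_left
  have hi2 : Integrable (fun x => φ x α * partialDeriv i ψ x) :=
    (hcomp.continuous.mul hcontψ).integrable_of_hasCompactSupport
      (HasCompactSupport.intro hc hsupp).mul_left
  have hi3 : Integrable (fun x => φ x α * ψ x) :=
    (hcomp.continuous.mul hψ.continuous).integrable_of_hasCompactSupport hc.mul_left
  have hd1 : Differentiable ℝ fun x => φ x α := hcomp.differentiable (by simp)
  have hd2 : Differentiable ℝ ψ := hψ.differentiable (by simp)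
  simp only [← hgrad] at hi1 ⊢
  rw [setIntegral_eq_integral_of_forall_compl_eq_zero,
    setIntegral_eq_integral_of_forall_compl_eq_zero]
  · exact integral_mul_fderiv_eq_neg_fderiv_mul_of_integrable hi1 hi2 hi3 (fun x _ => hd1 x)
      (fun x _ => hd2 x)
  · intro x hx
    rw [image_eq_zero_of_notMem_tsupport fun h => hx (hs h), mul_zero]
  · intro x hx
    rw [hsupp x fun h => hx (hs h), mul_zero]

/-- Integration of one component against an `L²` function, as a continuous functional on `L²`. -/
lemma exists_dual_eq_integral {ι : Type*} [Fintype ι] [DecidableEq ι] {μ : Measure Plane}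
    {w : Plane → ℝ} (hw : MemLp w 2 μ) (i : ι) : ∃ ℓ : StrongDual ℝ (Lp (EuclideanSpace ℝ ι) 2 μ),
      ∀ f, ℓ f = ∫ x, f x i * w x ∂μ := by
  have hw' : MemLp (fun x => w x • EuclideanSpace.single i (1 : ℝ)) 2 μ :=
    (ContinuousLinearMap.toSpanSingleton ℝ (EuclideanSpace.single i (1 : ℝ))).comp_memLp' hw
  refine ⟨innerSL ℝ hw'.toLp, fun f => ?_⟩
  rw [innerSL_apply_apply, L2.inner_def]
  refine integral_congr_ae ?_
  filter_upwards [hw'.coeFn_toLp] with x hx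
  rw [hx, inner_smul_left, EuclideanSpace.inner_single_left]
  simp [mul_comm]

lemma isWeakGrad_of_mem_sobolevPairs (hΩ : IsLipschitzDomain Ω M) {p : PairSpace Ω m}
    (hp : p ∈ sobolevPairs Ω D m) : IsWeakGrad Ω p.fst p.snd := by
  intro ψ hψ hc hs i α
  have hcontψ : Continuous (partialDeriv i ψ) := by
    have h := hψ.continuous_fderiv (by simp)
    unfold partialDeriv
    fun_prop
  obtain ⟨ℓ, hℓ⟩ := exists_dual_eq_integral (memLp_of_continuous hΩ.isBounded hcontψ) α
  obtain ⟨ℓ', hℓ'⟩ := exists_dual_eq_integral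
    (memLp_of_continuous hΩ.isBounded hψ.continuous) (i, α)
  refine sobolevPairs_induction hΩ (P := fun p => ∫ x in Ω, p.fst x α * partialDeriv i ψ x =
    - ∫ x in Ω, p.snd x (i, α) * ψ x) ?_ ?_ hp
  · simp only [← hℓ, ← hℓ']
    exact isClosed_eq (ℓ.continuous.comp (WithLp.continuous_fst 2 _ _))
      (ℓ'.continuous.comp (WithLp.continuous_snd 2 _ _)).neg
  · intro φ hφ
    refine Eq.trans (integral_congr_ae ?_) ((isWeakGrad_classicalGrad hφ ψ hψ hc hs i α).trans
      (congrArg Neg.neg (integral_congr_ae ?_)))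
    · filter_upwards [(memLp_smooth hΩ hφ).coeFn_toLp] with x hx
      simp only [WithLp.toLp_fst, hx]
    · filter_upwards [(memLp_classicalGrad hΩ hφ).coeFn_toLp] with x hx
      simp only [WithLp.toLp_snd, hx]

/-- A pair in the closure of the smooth pairs is an element of the Sobolev space. -/
lemma exists_W_of_mem_sobolevPairs (hΩ : IsLipschitzDomain Ω M) {p : PairSpace Ω m}
    (hp : p ∈ sobolevPairs Ω D m) :
    ∃ u : W Ω D m, u.fn =ᵐ[volume.restrict Ω] p.fst ∧ W.gradL u = p.snd := by
  have hfin := hΩ.isFiniteMeasure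
  refine ⟨⟨(p.fst.1, p.snd), ?_, isWeakGrad_of_mem_sobolevPairs hΩ hp, ?_⟩,
    EventuallyEq.rfl, rfl⟩
  · intro K hK _
    have h1 : Integrable p.fst (volume.restrict Ω) := (Lp.memLp p.fst).integrable (by norm_num)
    exact h1.mono_measure (Measure.restrict_mono hK le_rfl)
  · obtain ⟨φ, hφ, hφD, h⟩ := (mem_sobolevPairs_iff hΩ).1 hp
    exact ⟨φ, hφ, hφD, h.sobolevConv hφ (Lp.aestronglyMeasurable _)⟩

end PairSpace

namespace W

variable {Ω D : Set Plane} {m : ℕ} {M : ℝ}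

lemma aestronglyMeasurable_fn (u : W Ω D m) : AEStronglyMeasurable u.fn (volume.restrict Ω) :=
  u.1.1.aestronglyMeasurable

lemma memLp_grad (u : W Ω D m) : MemLp u.grad 2 (volume.restrict Ω) := Lp.memLp (gradL u)

lemma exists_strongConv (hΩ : IsLipschitzDomain Ω M) (hM : 0 < M) (𝒞 : CoordCover Ω M)
    (u : W Ω D m) : ∃ φ : ℕ → Plane → Vec m, (∀ k, ContDiff ℝ ∞ (φ k)) ∧
      (∀ k, φ k =ᶠ[𝓝ˢ D] 0) ∧ StrongConv Ω φ u.fn u.grad := by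
  obtain ⟨φ, hφ, hφD, h⟩ := u.2.approx
  exact ⟨φ, hφ, hφD, (h.memLp_and_strongConv hΩ hM 𝒞 hφ u.aestronglyMeasurable_fn
    u.memLp_grad.1).2⟩

lemma memLp_fn (hΩ : IsLipschitzDomain Ω M) (hM : 0 < M) (𝒞 : CoordCover Ω M)
    (u : W Ω D m) : MemLp u.fn 2 (volume.restrict Ω) := by
  obtain ⟨φ, hφ, -, h⟩ := u.2.approx
  exact (h.memLp_and_strongConv hΩ hM 𝒞 hφ u.aestronglyMeasurable_fn u.memLp_grad.1).1

lemma ext_ae {u v : W Ω D m} (h1 : u.fn =ᵐ[volume.restrict Ω] v.fn) (h2 : gradL u = gradL v) :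
    u = v :=
  Subtype.ext (Prod.ext (AEEqFun.ext h1) h2)

lemma fn_add (u v : W Ω D m) : (u + v).fn =ᵐ[volume.restrict Ω] u.fn + v.fn :=
  AEEqFun.coeFn_add u.1.1 v.1.1

lemma fn_smul (c : ℝ) (u : W Ω D m) : (c • u).fn =ᵐ[volume.restrict Ω] c • u.fn :=
  AEEqFun.coeFn_smul c u.1.1

lemma mk_mem_sobolevPairs (hΩ : IsLipschitzDomain Ω M) (hM : 0 < M) (𝒞 : CoordCover Ω M)
    (u : W Ω D m) :
    (WithLp.toLp 2 ((u.memLp_fn hΩ hM 𝒞).toLp, gradL u) : PairSpace Ω m) ∈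
      sobolevPairs Ω D m := by
  rw [mem_sobolevPairs_iff hΩ]
  obtain ⟨φ, hφ, hφD, h⟩ := u.exists_strongConv hΩ hM 𝒞
  exact ⟨φ, hφ, hφD, h.fn.congr (u.memLp_fn hΩ hM 𝒞).coeFn_toLp.symm, h.grad⟩

/-- The elements of the Sobolev space, as pairs of functions in `L²(Ω)`. -/
def toPairL (hΩ : IsLipschitzDomain Ω M) (hM : 0 < M) (𝒞 : CoordCover Ω M) :
    W Ω D m →ₗ[ℝ] sobolevPairs Ω D m where
  toFun u := ⟨WithLp.toLp 2 ((u.memLp_fn hΩ hM 𝒞).toLp, gradL u), u.mk_mem_sobolevPairs hΩ hM 𝒞⟩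
  map_add' u v := by
    refine Subtype.ext (WithLp.ofLp_injective 2 (Prod.ext ?_ (map_add gradL u v)))
    refine Lp.ext (((u + v).memLp_fn hΩ hM 𝒞).coeFn_toLp.trans ((fn_add u v).trans ?_))
    exact (((u.memLp_fn hΩ hM 𝒞).coeFn_toLp.add (v.memLp_fn hΩ hM 𝒞).coeFn_toLp).symm.trans
      (Lp.coeFn_add _ _).symm)
  map_smul' c u := by
    refine Subtype.ext (WithLp.ofLp_injective 2 (Prod.ext ?_ (map_smul gradL c u)))
    refine Lp.ext (((c • u).memLp_fn hΩ hM 𝒞).coeFn_toLp.trans ((fn_smul c u).trans ?_))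
    exact (((u.memLp_fn hΩ hM 𝒞).coeFn_toLp.const_smul c).symm.trans
      (Lp.coeFn_smul _ _).symm)

lemma bijective_toPairL (hΩ : IsLipschitzDomain Ω M) (hM : 0 < M) (𝒞 : CoordCover Ω M) :
    Function.Bijective (toPairL (D := D) (m := m) hΩ hM 𝒞) := by
  constructor
  · intro u v h
    have h1 : (u.memLp_fn hΩ hM 𝒞).toLp = (v.memLp_fn hΩ hM 𝒞).toLp :=
      congrArg (fun p : sobolevPairs Ω D m => p.1.fst) h
    have h2 : gradL u = gradL v := congrArg (fun p : sobolevPairs Ω D m => p.1.snd) h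
    exact ext_ae ((MemLp.toLp_eq_toLp_iff _ _).1 h1) h2
  · intro p
    obtain ⟨u, h1, h2⟩ := exists_W_of_mem_sobolevPairs hΩ p.2
    refine ⟨u, Subtype.ext (WithLp.ofLp_injective 2 (Prod.ext ?_ h2))⟩
    exact Lp.ext ((u.memLp_fn hΩ hM 𝒞).coeFn_toLp.trans h1)

/-- The Sobolev space is linearly isomorphic to the space of pairs. -/
def toPair (hΩ : IsLipschitzDomain Ω M) (hM : 0 < M) (𝒞 : CoordCover Ω M) :
    W Ω D m ≃ₗ[ℝ] sobolevPairs Ω D m :=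
  LinearEquiv.ofBijective (toPairL hΩ hM 𝒞) (bijective_toPairL hΩ hM 𝒞)

lemma toPair_fst (hΩ : IsLipschitzDomain Ω M) (hM : 0 < M) (𝒞 : CoordCover Ω M) (u : W Ω D m) :
    (toPair hΩ hM 𝒞 u).1.fst =ᵐ[volume.restrict Ω] u.fn :=
  (u.memLp_fn hΩ hM 𝒞).coeFn_toLp

lemma toPair_snd (hΩ : IsLipschitzDomain Ω M) (hM : 0 < M) (𝒞 : CoordCover Ω M) (u : W Ω D m) :
    (toPair hΩ hM 𝒞 u).1.snd = gradL u := rfl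

lemma norm_toPair_sq (hΩ : IsLipschitzDomain Ω M) (hM : 0 < M) (𝒞 : CoordCover Ω M)
    (u : W Ω D m) :
    ‖toPair hΩ hM 𝒞 u‖ ^ 2 = (eLpNorm u.fn 2 (volume.restrict Ω)).toReal ^ 2 + ‖u‖ ^ 2 := by
  rw [Submodule.coe_norm, WithLp.prod_norm_sq_eq_of_L2, toPair_snd, ← norm_def, Lp.norm_def,
    eLpNorm_congr_ae (toPair_fst hΩ hM 𝒞 u)]

end W

/-! ### The trace operator -/

section Trace

variable {Ω D : Set Plane} {m : ℕ} {M : ℝ} (hΩ : IsLipschitzDomain Ω M) (hM : 0 < M)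
  (𝒞 : CoordCover Ω M)

lemma W.enorm_toPair_sq (u : W Ω D m) :
    ‖toPair hΩ hM 𝒞 u‖ₑ ^ 2 =
      sqNorm (volume.restrict Ω) u.fn + sqNorm (volume.restrict Ω) u.grad := by
  have h1 := W.norm_toPair_sq hΩ hM 𝒞 u
  have h2 : ‖u‖ ^ 2 = (sqNorm (volume.restrict Ω) u.grad).toReal := by
    rw [W.norm_def, norm_sq_eq_toReal_sqNorm]
    rfl
  rw [h2, ← ENNReal.toReal_pow, eLpNorm_two_sq, ← ENNReal.toReal_add] at h1
  · rw [← ofReal_norm, ← ENNReal.ofReal_pow (norm_nonneg _), h1, ENNReal.ofReal_toReal]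
    exact ENNReal.add_ne_top.2 ⟨((sqNorm_lt_top_iff_memLp u.aestronglyMeasurable_fn).2
      (u.memLp_fn hΩ hM 𝒞)).ne, ((sqNorm_lt_top_iff_memLp u.memLp_grad.1).2 u.memLp_grad).ne⟩
  · exact ((sqNorm_lt_top_iff_memLp u.aestronglyMeasurable_fn).2 (u.memLp_fn hΩ hM 𝒞)).ne
  · exact ((sqNorm_lt_top_iff_memLp u.memLp_grad.1).2 u.memLp_grad).ne

include hΩ hM 𝒞

lemma memLp_arcLength {φ : Plane → Vec m} (hφ : ContDiff ℝ ∞ φ) :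
    MemLp φ 2 (arcLength Ω) := by
  have hfin := 𝒞.isFiniteMeasure_arcLength hM
  obtain ⟨C, hC⟩ := hΩ.isCompact_frontier.exists_bound_of_continuousOn hφ.continuous.continuousOn
  refine MemLp.of_bound hφ.continuous.aestronglyMeasurable C ?_
  exact (ae_restrict_iff' isClosed_frontier.measurableSet).2 (ae_of_all _ hC)

lemma exists_isTrace (u : W Ω ∅ m) : ∃ g, IsTrace u g := by
  obtain ⟨φ, hφ, -, h⟩ := u.exists_strongConv hΩ hM 𝒞
  obtain ⟨C, hC, hT⟩ := exists_sqNorm_arcLength_le hΩ hM 𝒞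
  have hb := (ENNReal.Tendsto.const_mul (a := 2) (convLp_iff_sqNorm.1 h.fn)
    (Or.inr (by simp))).add (ENNReal.Tendsto.const_mul (a := 2) (convLp_iff_sqNorm.1 h.grad)
    (Or.inr (by simp)))
  rw [mul_zero, add_zero] at hb
  obtain ⟨g, hg⟩ := exists_convLp_of_cauchy (fun k => memLp_arcLength hΩ hM 𝒞 (hφ k)) hC hb (by
    intro k l
    have hsub : ContDiff ℝ ∞ (φ k - φ l) := (hφ k).sub (hφ l)
    refine (hT hsub).trans (mul_le_mul_right ?_ _)
    rw [classicalGrad_sub ((hφ k).differentiable (by simp)) ((hφ l).differentiable (by simp))]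
    have h1 := sqNorm_sub_le (volume.restrict Ω) (g := φ l)
      (hφ k).continuous.aestronglyMeasurable u.aestronglyMeasurable_fn
    have h2 := sqNorm_sub_le (volume.restrict Ω) (g := classicalGrad (φ l))
      (continuous_classicalGrad (hφ k)).aestronglyMeasurable u.memLp_grad.1
    refine (add_le_add h1 h2).trans (le_of_eq ?_)
    ring)
  exact ⟨g, φ, hφ, h.sobolevConv hφ u.aestronglyMeasurable_fn, hg⟩

lemma exists_sqNorm_trace_le : ∃ C : ℝ≥0∞, C ≠ ⊤ ∧ ∀ {m : ℕ} (u : W Ω ∅ m) g, IsTrace u g →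
    sqNorm (arcLength Ω) g ≤ C * ‖W.toPair hΩ hM 𝒞 u‖ₑ ^ 2 := by
  obtain ⟨C, hC, hT⟩ := exists_sqNorm_arcLength_le hΩ hM 𝒞
  refine ⟨C, hC, fun {m} u g => ?_⟩
  rintro ⟨φ, hφ, hs, hg⟩
  have h := (hs.memLp_and_strongConv hΩ hM 𝒞 hφ u.aestronglyMeasurable_fn u.memLp_grad.1).2
  rw [W.enorm_toPair_sq]
  have h1 := hg.tendsto_sqNorm (fun k => memLp_arcLength hΩ hM 𝒞 (hφ k)) (Lp.memLp g)
  have h2 := h.fn.tendsto_sqNorm (fun k => memLp_smooth hΩ (hφ k)) (u.memLp_fn hΩ hM 𝒞)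
  have h3 := h.grad.tendsto_sqNorm (fun k => memLp_classicalGrad hΩ (hφ k)) u.memLp_grad
  exact le_of_tendsto_of_tendsto' h1 (ENNReal.Tendsto.const_mul (h2.add h3) (Or.inr hC))
    fun k => hT (hφ k)

/-- Every element of the Sobolev space has exactly one trace, and the trace is a bounded linear
operator for the full Sobolev norm. -/
lemma exists_trace_operator (m : ℕ) :
    ∃ τ : sobolevPairs Ω ∅ m →L[ℝ] Lp (Vec m) 2 (arcLength Ω),
      ∀ (u : W Ω ∅ m) g, IsTrace u g ↔ τ (W.toPair hΩ hM 𝒞 u) = g := by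
  obtain ⟨C, hC, hT⟩ := exists_sqNorm_trace_le hΩ hM 𝒞
  choose t ht using fun u : W Ω ∅ m => exists_isTrace hΩ hM 𝒞 u
  have huniq : ∀ u g, IsTrace u g → t u = g := by
    intro u g hg
    have h1 : IsTrace (0 : W Ω ∅ m) (t u - g) := by
      have h2 := (ht u).add (hg.smul (-1))
      rwa [neg_one_smul, neg_one_smul, ← sub_eq_add_neg, ← sub_eq_add_neg, sub_self] at h2
    have h2 := hT _ _ h1
    have h0 : ‖(0 : sobolevPairs Ω ∅ m)‖ₑ = 0 := by
      rw [← ofReal_norm, norm_zero, ENNReal.ofReal_zero]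
    rw [map_zero, h0, zero_pow two_ne_zero, mul_zero, ← enorm_sq_eq_sqNorm] at h2
    have h3 : ‖t u - g‖ₑ = 0 := by simpa using h2
    exact sub_eq_zero.1 (enorm_eq_zero.1 h3)
  let T : W Ω ∅ m →ₗ[ℝ] Lp (Vec m) 2 (arcLength Ω) :=
    { toFun := t
      map_add' := fun u v => huniq _ _ ((ht u).add (ht v))
      map_smul' := fun c u => huniq _ _ ((ht u).smul c) }
  let T' := T.comp (W.toPair hΩ hM 𝒞).symm.toLinearMap
  have hT' : ∀ u, T' (W.toPair hΩ hM 𝒞 u) = t u := fun u => by simp [T', T]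
  have hbound : ∀ p, ‖T' p‖ ≤ Real.sqrt C.toReal * ‖p‖ := by
    intro p
    obtain ⟨u, rfl⟩ := (W.toPair hΩ hM 𝒞).surjective p
    rw [hT']
    refine le_of_sq_le_sq ?_ (by positivity)
    rw [mul_pow, Real.sq_sqrt ENNReal.toReal_nonneg, norm_sq_eq_toReal_sqNorm]
    have h2 := ENNReal.toReal_mono (ENNReal.mul_ne_top hC (by simp)) (hT u _ (ht u))
    rwa [ENNReal.toReal_mul, ENNReal.toReal_pow, toReal_enorm] at h2
  refine ⟨T'.mkContinuous _ hbound, fun u g => ?_⟩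
  rw [LinearMap.mkContinuous_apply, hT']
  exact ⟨huniq u g, fun h => h ▸ ht u⟩

end Trace

/-! ### Multiplication by smooth functions -/

section Multiplication

variable {Ω D : Set Plane} {m : ℕ} {M : ℝ}

/-- The gradient of the product of the scalar function `χ` and a function with value `v` and
gradient `G`, by the product rule. -/
def prodGrad (χ : Plane → ℝ) (v : Plane → Vec m) (G : Plane → GradVec m) (x : Plane) :
    GradVec m :=
  WithLp.toLp 2 fun p => χ x * G x p + partialDeriv p.1 χ x * v x p.2

lemma prodGrad_apply (χ : Plane → ℝ) (v : Plane → Vec m) (G : Plane → GradVec m) (x : Plane)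
    (p : Fin 2 × Fin m) :
    prodGrad χ v G x p = χ x * G x p + partialDeriv p.1 χ x * v x p.2 := rfl

lemma classicalGrad_mul {χ : Plane → ℝ} {φ : Plane → Vec m} (hχ : Differentiable ℝ χ)
    (hφ : Differentiable ℝ φ) :
    classicalGrad (fun x => χ x • φ x) = prodGrad χ φ (classicalGrad φ) := by
  funext x
  ext p
  have h := fderiv_fun_smul (hχ x) (hφ x)
  simp [classicalGrad, prodGrad, h, partialDeriv]

lemma prodGrad_sub (χ : Plane → ℝ) (v w : Plane → Vec m) (G H : Plane → GradVec m) :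
    prodGrad χ v G - prodGrad χ w H = prodGrad χ (v - w) (G - H) := by
  funext x
  ext p
  simp [prodGrad_apply]
  ring

lemma norm_prodGrad_sq_le (χ : Plane → ℝ) (v : Plane → Vec m) (G : Plane → GradVec m) (x : Plane) :
    ‖prodGrad χ v G x‖ ^ 2 ≤
      2 * (χ x) ^ 2 * ‖G x‖ ^ 2 + 2 * (∑ i, (partialDeriv i χ x) ^ 2) * ‖v x‖ ^ 2 := by
  have h1 : ∑ p : Fin 2 × Fin m, (partialDeriv p.1 χ x * v x p.2) ^ 2 =
      (∑ i, (partialDeriv i χ x) ^ 2) * ‖v x‖ ^ 2 := by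
    rw [EuclideanSpace.norm_sq_eq, Finset.sum_mul_sum, Fintype.sum_prod_type]
    simp only [mul_pow, Real.norm_eq_abs, sq_abs]
  rw [EuclideanSpace.norm_sq_eq, mul_assoc 2 (∑ i, (partialDeriv i χ x) ^ 2), ← h1,
    EuclideanSpace.norm_sq_eq (G x), Finset.mul_sum, Finset.mul_sum, ← Finset.sum_add_distrib]
  refine Finset.sum_le_sum fun p _ => ?_
  simp only [Real.norm_eq_abs, sq_abs, prodGrad_apply]
  nlinarith [sq_nonneg (χ x * G x p - partialDeriv p.1 χ x * v x p.2)]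

/-- A bound for the product rule with constants on a set. -/
lemma sqNorm_prodGrad_le {χ : Plane → ℝ} {A B : ℝ} {S : Set Plane} (hS : MeasurableSet S)
    (hA : ∀ x ∈ S, |χ x| ≤ A) (hB : ∀ i, ∀ x ∈ S, |partialDeriv i χ x| ≤ B)
    (v : Plane → Vec m) {G : Plane → GradVec m} (hG : AEStronglyMeasurable G (volume.restrict S)) :
    sqNorm (volume.restrict S) (prodGrad χ v G) ≤
      ENNReal.ofReal (2 * A ^ 2) * sqNorm (volume.restrict S) G +
      ENNReal.ofReal (4 * B ^ 2) * sqNorm (volume.restrict S) v := by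
  rw [sqNorm, sqNorm, sqNorm, ← lintegral_const_mul' _ _ ENNReal.ofReal_ne_top,
    ← lintegral_const_mul' _ _ ENNReal.ofReal_ne_top,
    ← lintegral_add_left' ((hG.enorm.pow_const 2).const_mul _)]
  refine setLIntegral_mono_ae' hS (ae_of_all _ fun x hx => ?_)
  rw [← ofReal_norm, ← ofReal_norm, ← ofReal_norm, ← ENNReal.ofReal_pow (norm_nonneg _),
    ← ENNReal.ofReal_pow (norm_nonneg _), ← ENNReal.ofReal_pow (norm_nonneg _),
    ← ENNReal.ofReal_mul (by positivity), ← ENNReal.ofReal_mul (by positivity),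
    ← ENNReal.ofReal_add (by positivity) (by positivity)]
  refine ENNReal.ofReal_le_ofReal ((norm_prodGrad_sq_le χ v G x).trans ?_)
  have h1 : (χ x) ^ 2 ≤ A ^ 2 := sq_le_sq' (abs_le.1 (hA x hx)).1 (abs_le.1 (hA x hx)).2
  have h2 : ∑ i, (partialDeriv i χ x) ^ 2 ≤ 2 * B ^ 2 := by
    rw [Fin.sum_univ_two]
    have h3 := sq_le_sq' (abs_le.1 (hB 0 x hx)).1 (abs_le.1 (hB 0 x hx)).2
    have h4 := sq_le_sq' (abs_le.1 (hB 1 x hx)).1 (abs_le.1 (hB 1 x hx)).2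
    linarith
  have h5 := mul_le_mul_of_nonneg_right h1 (sq_nonneg ‖G x‖)
  have h6 := mul_le_mul_of_nonneg_right h2 (sq_nonneg ‖v x‖)
  linarith

lemma continuous_partialDeriv {χ : Plane → ℝ} (hχ : ContDiff ℝ ∞ χ) (i : Fin 2) :
    Continuous (partialDeriv i χ) := by
  have h := hχ.continuous_fderiv (by simp)
  unfold partialDeriv
  fun_prop

lemma exists_bound_on_bounded {χ : Plane → ℝ} (hχ : ContDiff ℝ ∞ χ)
    (hΩ : Bornology.IsBounded Ω) :
    ∃ A : ℝ, (∀ x ∈ Ω, |χ x| ≤ A) ∧ ∀ i, ∀ x ∈ Ω, |partialDeriv i χ x| ≤ A := by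
  have hK := hΩ.isCompact_closure
  obtain ⟨A, hA⟩ := hK.exists_bound_of_continuousOn hχ.continuous.continuousOn
  obtain ⟨B, hB⟩ := hK.exists_bound_of_continuousOn (continuous_partialDeriv hχ 0).continuousOn
  obtain ⟨C, hC⟩ := hK.exists_bound_of_continuousOn (continuous_partialDeriv hχ 1).continuousOn
  refine ⟨max A (max B C), fun x hx => ?_, fun i x hx => ?_⟩
  · exact (hA x (subset_closure hx)).trans (le_max_left _ _)
  · fin_cases i
    · exact (hB x (subset_closure hx)).trans ((le_max_left _ _).trans (le_max_right _ _))
    · exact (hC x (subset_closure hx)).trans ((le_max_right _ _).trans (le_max_right _ _))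

lemma aestronglyMeasurable_prodGrad {χ : Plane → ℝ} (hχ : ContDiff ℝ ∞ χ) {v : Plane → Vec m}
    {G : Plane → GradVec m} {μ : Measure Plane} (hv : AEStronglyMeasurable v μ)
    (hG : AEStronglyMeasurable G μ) : AEStronglyMeasurable (prodGrad χ v G) μ := by
  have h : ∀ p : Fin 2 × Fin m, AEStronglyMeasurable (fun x => prodGrad χ v G x p) μ := by
    intro p
    simp only [prodGrad_apply]
    have h1 : AEStronglyMeasurable (fun x => G x p) μ :=
      (EuclideanSpace.proj (𝕜 := ℝ) p).continuous.comp_aestronglyMeasurable hG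
    have h2 : AEStronglyMeasurable (fun x => v x p.2) μ :=
      (EuclideanSpace.proj (𝕜 := ℝ) p.2).continuous.comp_aestronglyMeasurable hv
    exact (hχ.continuous.aestronglyMeasurable.mul h1).add
      ((continuous_partialDeriv hχ p.1).aestronglyMeasurable.mul h2)
  have h1 : AEMeasurable (fun x => WithLp.ofLp (prodGrad χ v G x)) μ :=
    aemeasurable_pi_iff.2 fun p => (h p).aemeasurable
  have h2 := (PiLp.continuous_toLp 2 (fun _ : Fin 2 × Fin m => ℝ)).measurable.comp_aemeasurable h1
  exact h2.aestronglyMeasurable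

/-- Products with a smooth function stay in the Sobolev space. -/
lemma W.exists_mul (hΩ : IsLipschitzDomain Ω M) (hM : 0 < M) (𝒞 : CoordCover Ω M) {D' : Set Plane}
    {χ : Plane → ℝ} (hχ : ContDiff ℝ ∞ χ)
    (hD : ∀ φ : Plane → Vec m, φ =ᶠ[𝓝ˢ D] 0 → (fun x => χ x • φ x) =ᶠ[𝓝ˢ D'] 0) (u : W Ω D m) :
    ∃ v : W Ω D' m, v.fn =ᵐ[volume.restrict Ω] (fun x => χ x • u.fn x) ∧
      v.grad =ᵐ[volume.restrict Ω] prodGrad χ u.fn u.grad := by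
  obtain ⟨A, hA, hB⟩ := exists_bound_on_bounded hχ hΩ.isBounded
  obtain ⟨φ, hφ, hφD, h⟩ := u.exists_strongConv hΩ hM 𝒞
  have hmeas := hΩ.isOpen.measurableSet
  have hχm : AEStronglyMeasurable χ (volume.restrict Ω) := hχ.continuous.aestronglyMeasurable
  have hfnbd : ∀ w : Plane → Vec m, sqNorm (volume.restrict Ω) (fun x => χ x • w x) ≤
      ENNReal.ofReal A ^ 2 * sqNorm (volume.restrict Ω) w := by
    intro w
    rw [sqNorm, sqNorm, ← lintegral_const_mul' _ _ (ENNReal.pow_ne_top ENNReal.ofReal_ne_top)]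
    refine setLIntegral_mono_ae' hmeas (ae_of_all _ fun x hx => ?_)
    rw [enorm_smul, mul_pow]
    gcongr
    rw [← ofReal_norm]
    exact ENNReal.ofReal_le_ofReal (hA x hx)
  have hu2 : sqNorm (volume.restrict Ω) u.fn ≠ ⊤ :=
    ((sqNorm_lt_top_iff_memLp u.aestronglyMeasurable_fn).2 (u.memLp_fn hΩ hM 𝒞)).ne
  have hg2 : sqNorm (volume.restrict Ω) u.grad ≠ ⊤ :=
    ((sqNorm_lt_top_iff_memLp u.memLp_grad.1).2 u.memLp_grad).ne
  have hv : MemLp (fun x => χ x • u.fn x) 2 (volume.restrict Ω) := by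
    have hm : AEStronglyMeasurable (fun x => χ x • u.fn x) (volume.restrict Ω) :=
      hχm.smul u.aestronglyMeasurable_fn
    refine (sqNorm_lt_top_iff_memLp hm).1 ?_
    exact (hfnbd u.fn).trans_lt (ENNReal.mul_lt_top
      (ENNReal.pow_lt_top ENNReal.ofReal_lt_top) hu2.lt_top)
  have hG : MemLp (prodGrad χ u.fn u.grad) 2 (volume.restrict Ω) := by
    rw [← sqNorm_lt_top_iff_memLp
      (aestronglyMeasurable_prodGrad hχ u.aestronglyMeasurable_fn u.memLp_grad.1)]
    refine (sqNorm_prodGrad_le hmeas hA hB u.fn u.memLp_grad.1).trans_lt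
      (ENNReal.add_lt_top.2 ⟨?_, ?_⟩)
    · exact ENNReal.mul_lt_top ENNReal.ofReal_lt_top hg2.lt_top
    · exact ENNReal.mul_lt_top ENNReal.ofReal_lt_top hu2.lt_top
  have hmem : (WithLp.toLp 2 (hv.toLp, hG.toLp) : PairSpace Ω m) ∈ sobolevPairs Ω D' m := by
    rw [mem_sobolevPairs_iff hΩ]
    refine ⟨fun k x => χ x • φ k x, fun k => hχ.smul (hφ k), fun k => hD _ (hφD k), ?_, ?_⟩
    · refine ConvLp.congr ?_ hv.coeFn_toLp.symm
      rw [convLp_iff_sqNorm]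
      have h1 := ENNReal.Tendsto.const_mul (a := ENNReal.ofReal A ^ 2) (convLp_iff_sqNorm.1 h.fn)
        (Or.inr (ENNReal.pow_ne_top ENNReal.ofReal_ne_top))
      rw [mul_zero] at h1
      refine tendsto_of_tendsto_of_tendsto_of_le_of_le tendsto_const_nhds h1 (fun _ => zero_le)
        fun k => ?_
      refine le_trans (le_of_eq ?_) (hfnbd (φ k - u.fn))
      congr 1
      funext x
      simp [smul_sub]
    · refine ConvLp.congr ?_ hG.coeFn_toLp.symm
      rw [convLp_iff_sqNorm]
      have h1 := (ENNReal.Tendsto.const_mul (a := ENNReal.ofReal (2 * A ^ 2))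
        (convLp_iff_sqNorm.1 h.grad) (Or.inr ENNReal.ofReal_ne_top)).add
        (ENNReal.Tendsto.const_mul (a := ENNReal.ofReal (4 * A ^ 2))
        (convLp_iff_sqNorm.1 h.fn) (Or.inr ENNReal.ofReal_ne_top))
      rw [mul_zero, mul_zero, add_zero] at h1
      refine tendsto_of_tendsto_of_tendsto_of_le_of_le tendsto_const_nhds h1 (fun _ => zero_le)
        fun k => ?_
      simp only
      rw [classicalGrad_mul (hχ.differentiable (by simp)) ((hφ k).differentiable (by simp)),
        prodGrad_sub]
      exact sqNorm_prodGrad_le hmeas hA hB _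
        ((continuous_classicalGrad (hφ k)).aestronglyMeasurable.sub u.memLp_grad.1)
  obtain ⟨w, hw1, hw2⟩ := exists_W_of_mem_sobolevPairs hΩ hmem
  refine ⟨w, hw1.trans hv.coeFn_toLp, ?_⟩
  have h1 : w.grad = hG.toLp := congrArg (fun f : Lp (GradVec m) 2 (volume.restrict Ω) =>
    (f : Plane → GradVec m)) hw2
  rw [h1]
  exact hG.coeFn_toLp

end Multiplication

/-! ### Functions with vanishing trace -/

section Cutoff

/-- Mollification at scale `r` preserves the Lipschitz constant, and the values at points near which
the function is constant at that scale. -/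
lemma exists_smooth_lipschitz_approx {f : Plane → ℝ} {K : NNReal} (hf : LipschitzWith K f) {r : ℝ}
    (hr : 0 < r) : ∃ χ : Plane → ℝ, ContDiff ℝ ∞ χ ∧ LipschitzWith K χ ∧
      (∀ y, dist (χ y) (f y) ≤ K * r) ∧ ∀ y c, (∀ z ∈ Metric.ball y r, f z = c) → χ y = c := by
  let b : ContDiffBump (0 : Plane) := ⟨r / 2, r, half_pos hr, half_lt_self hr⟩
  have hint : ∀ x, Integrable fun t => b.normed volume t * f (x - t) := fun x =>
    Continuous.integrable_of_hasCompactSupport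
      (b.continuous_normed.mul (hf.continuous.comp (continuous_const.sub continuous_id)))
      b.hasCompactSupport_normed.mul_right
  have hdef : ∀ x, (convolution (b.normed volume) f (ContinuousLinearMap.lsmul ℝ ℝ) volume) x =
      ∫ t, b.normed volume t * f (x - t) := fun x => rfl
  refine ⟨convolution (b.normed volume) f (ContinuousLinearMap.lsmul ℝ ℝ) volume, ?_, ?_, ?_, ?_⟩
  · exact b.hasCompactSupport_normed.contDiff_convolution_left _ b.contDiff_normed
      hf.continuous.locallyIntegrable
  · refine LipschitzWith.of_dist_le_mul fun x y => ?_
    rw [hdef, hdef, dist_eq_norm, ← integral_sub (hint x) (hint y)]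
    have h1 : ∀ t, ‖b.normed volume t * f (x - t) - b.normed volume t * f (y - t)‖ ≤
        b.normed volume t * (K * dist x y) := by
      intro t
      rw [← mul_sub, norm_mul, Real.norm_of_nonneg (b.nonneg_normed t), ← dist_eq_norm]
      refine mul_le_mul_of_nonneg_left ((hf.dist_le_mul _ _).trans (le_of_eq ?_)) (b.nonneg_normed t)
      rw [dist_sub_right]
    refine (norm_integral_le_of_norm_le (b.integrable_normed.mul_const _) (ae_of_all _ h1)).trans ?_
    rw [integral_mul_const, b.integral_normed, one_mul]
  · intro y
    refine b.dist_normed_convolution_le hf.continuous.aestronglyMeasurable fun z hz => ?_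
    exact (hf.dist_le_mul z y).trans (mul_le_mul_of_nonneg_left (le_of_lt hz) K.2)
  · intro y c h
    rw [b.normed_convolution_eq_right (x₀ := y), h y (Metric.mem_ball_self hr)]
    intro z hz
    rw [h z hz, h y (Metric.mem_ball_self hr)]

/-- A smooth function that is `1` near `S` and `0` at distance `ε` from `S`, with derivatives of
order `1 / ε`. -/
lemma exists_cutoff (S : Set Plane) {ε : ℝ} (hε : 0 < ε) :
    ∃ χ : Plane → ℝ, ContDiff ℝ ∞ χ ∧ (∀ y ∈ S, χ =ᶠ[𝓝 y] 1) ∧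
      (∀ y, ε ≤ Metric.infDist y S → χ =ᶠ[𝓝 y] 0) ∧ (∀ y, |χ y| ≤ 2) ∧
      ∀ i y, |partialDeriv i χ y| ≤ 3 / ε := by
  set d : Plane → ℝ := fun y => Metric.infDist y S with hd
  have hdL : ∀ y z, d y ≤ d z + dist y z := fun y z => Metric.infDist_le_infDist_add_dist
  -- This profile is `1` up to the distance `ε / 3` and `0` from `2 * ε / 3` on, which leaves room for
  -- mollification at the scale `ε / 6`.
  set f : Plane → ℝ := fun y => max 0 (min 1 (2 - 3 / ε * d y)) with hf
  have hfL : LipschitzWith (3 / ε).toNNReal f := by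
    refine LipschitzWith.const_max (LipschitzWith.const_min ?_ 1) 0
    refine LipschitzWith.of_le_add_mul' _ fun y z => ?_
    have h1 := mul_le_mul_of_nonneg_left (hdL z y) (show 0 ≤ 3 / ε by positivity)
    rw [dist_comm y z]
    linarith
  obtain ⟨χ, hχ, hχL, hχf, hχc⟩ := exists_smooth_lipschitz_approx hfL (r := ε / 6) (by positivity)
  rw [Real.coe_toNNReal _ (by positivity)] at hχf
  have hone : ∀ y, d y < ε / 6 → χ y = 1 := by
    intro y hy
    refine hχc y 1 fun z hz => ?_
    have h1 : d z ≤ ε / 3 := by linarith [hdL z y, Metric.mem_ball.1 hz]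
    have h2 : 3 / ε * d z ≤ 1 := by rw [div_mul_eq_mul_div, div_le_one hε]; linarith
    rw [hf]
    simp only
    rw [min_eq_left (by linarith), max_eq_right zero_le_one]
  have hzero : ∀ y, 5 * ε / 6 < d y → χ y = 0 := by
    intro y hy
    refine hχc y 0 fun z hz => ?_
    have h1 : 2 * ε / 3 ≤ d z := by
      linarith [hdL y z, Metric.mem_ball.1 hz, dist_comm y z]
    have h2 : 2 ≤ 3 / ε * d z := by rw [div_mul_eq_mul_div, le_div_iff₀ hε]; linarith
    rw [hf]
    simp only
    rw [min_eq_right (by linarith), max_eq_left (by linarith)]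
  have hdc : Continuous d := Metric.continuous_infDist_pt S
  refine ⟨χ, hχ, fun y hy => ?_, fun y hy => ?_, fun y => ?_, fun i y => ?_⟩
  · have h1 : d y < ε / 6 := by
      rw [hd]
      simp only
      rw [Metric.infDist_zero_of_mem hy]
      positivity
    exact (hdc.continuousAt.eventually (gt_mem_nhds h1)).mono hone
  · have h1 : 5 * ε / 6 < d y := lt_of_lt_of_le (by linarith) hy
    exact (hdc.continuousAt.eventually (lt_mem_nhds h1)).mono hzero
  · have h1 := hχf y
    have h2 : 3 / ε * (ε / 6) = 1 / 2 := by field_simp; norm_num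
    rw [h2, Real.dist_eq, abs_le] at h1
    have h3 : 0 ≤ f y := le_max_left _ _
    have h4 : f y ≤ 1 := max_le zero_le_one (min_le_left _ _)
    exact abs_le.2 ⟨by linarith [h1.1], by linarith [h1.2]⟩
  · have h1 := norm_fderiv_le_of_lipschitz ℝ hχL (x₀ := y)
    rw [Real.coe_toNNReal _ (by positivity)] at h1
    have h2 := (fderiv ℝ χ y).le_opNorm (EuclideanSpace.single i 1)
    rw [PiLp.norm_single, norm_one, mul_one] at h2
    exact h2.trans h1

end Cutoff

section VanishingTrace

variable {Ω D : Set Plane} {m : ℕ} {M : ℝ}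

lemma prodGrad_one_sub (χ : Plane → ℝ) (v : Plane → Vec m)
    (G : Plane → GradVec m) :
    prodGrad (fun x => 1 - χ x) v G = G - prodGrad χ v G := by
  funext x
  ext p
  have h : fderiv ℝ (fun x => 1 - χ x) x = - fderiv ℝ χ x := by
    rw [fderiv_const_sub]
  simp only [prodGrad_apply, Pi.sub_apply, PiLp.sub_apply, partialDeriv, h,
    neg_apply]
  ring

lemma prodGrad_eq_zero {χ : Plane → ℝ} {x : Plane} (h : χ =ᶠ[𝓝 x] 0) (v : Plane → Vec m)
    (G : Plane → GradVec m) : prodGrad χ v G x = 0 := by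
  have h1 : fderiv ℝ χ x = 0 := by
    rw [h.fderiv_eq, fderiv_zero]
    rfl
  have h2 : χ x = 0 := h.self_of_nhds
  ext p
  simp [prodGrad_apply, partialDeriv, h1, h2]

lemma CoordCover.isOpen_layer (𝒞 : CoordCover Ω M) (i : Fin 𝒞.n) (δ : ℝ) :
    IsOpen (𝒞.layer i δ) := by
  have h0 : Continuous fun y : Plane => 𝒞.frame i y 0 := by fun_prop
  have h1 : Continuous fun y : Plane => 𝒞.frame i y 1 := by fun_prop
  have hg := (𝒞.continuous_graph i).comp h0
  exact (isOpen_Ioo.preimage h0).inter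
    ((isOpen_lt hg h1).inter (isOpen_lt h1 (hg.add continuous_const)))

lemma CoordCover.layer_nonempty (𝒞 : CoordCover Ω M) (i : Fin 𝒞.n) {δ : ℝ} (hδ : 0 < δ) :
    (𝒞.layer i δ).Nonempty := by
  have hr := 𝒞.radius_pos i
  refine ⟨pt (𝒞.frame i) (𝒞.frame i (𝒞.center i) 0)
    (𝒞.graph i (𝒞.frame i (𝒞.center i) 0) + δ / 2), ?_, ?_, ?_⟩
  · rw [frame_pt_zero]
    exact ⟨by linarith, by linarith⟩
  · rw [frame_pt_zero, frame_pt_one]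
    linarith
  · rw [frame_pt_zero, frame_pt_one]
    linarith

variable (hΩ : IsLipschitzDomain Ω M) (hM : 0 < M) (𝒞 : CoordCover Ω M)

include hΩ hM

/-- Near the boundary, a function with vanishing trace is controlled by its gradient. -/
lemma sqNorm_layer_le_of_isTrace_zero {u : W Ω ∅ m} (hu : IsTrace u 0) (i : Fin 𝒞.n) {δ : ℝ}
    (hδ : 0 ≤ δ) (hδr : δ ≤ 𝒞.r₀) :
    sqNorm (volume.restrict (𝒞.layer i δ)) u.fn ≤
      2 * ENNReal.ofReal δ ^ 2 * sqNorm (volume.restrict (𝒞.layer i δ)) u.grad := by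
  obtain ⟨φ, hφ, hs, hb⟩ := hu
  have h := (hs.memLp_and_strongConv hΩ hM 𝒞 hφ u.aestronglyMeasurable_fn u.memLp_grad.1).2
  have hle : (volume : Measure Plane).restrict (𝒞.layer i δ) ≤ volume.restrict Ω :=
    Measure.restrict_mono (𝒞.layer_subset hM i hδr) le_rfl
  have h1 := (h.fn.mono_measure hle).tendsto_sqNorm
    (fun k => (memLp_smooth hΩ (hφ k)).mono_measure hle) ((u.memLp_fn hΩ hM 𝒞).mono_measure hle)
  have h2 := (h.grad.mono_measure hle).tendsto_sqNorm
    (fun k => (memLp_classicalGrad hΩ (hφ k)).mono_measure hle) (u.memLp_grad.mono_measure hle)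
  have h3 := hb.tendsto_sqNorm (fun k => memLp_arcLength hΩ hM 𝒞 (hφ k)) (Lp.memLp _)
  have h0 : sqNorm (arcLength Ω) ((0 : Lp (Vec m) 2 (arcLength Ω)) : Plane → Vec m) = 0 := by
    rw [← enorm_sq_eq_sqNorm, ← ofReal_norm, norm_zero, ENNReal.ofReal_zero, zero_pow two_ne_zero]
  rw [h0] at h3
  have h4 := (ENNReal.Tendsto.const_mul (a := 2 * ENNReal.ofReal δ) h3
    (Or.inr (by finiteness))).add
    (ENNReal.Tendsto.const_mul (a := 2 * ENNReal.ofReal δ ^ 2) h2 (Or.inr (by finiteness)))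
  rw [mul_zero, zero_add] at h4
  refine le_of_tendsto_of_tendsto' h1 h4 fun k => ?_
  refine (sqNorm_strip_le_graph (hφ k) (𝒞.frame i) (𝒞.continuous_graph i)
    (𝒞.measurableSet_base i) hδ).trans ?_
  gcongr
  · exact 𝒞.lintegral_curve_le hM i (measurable_enorm_sq (hφ k))
  · exact le_rfl

include 𝒞 in
/-- A function with vanishing trace and vanishing gradient vanishes. -/
lemma W.eq_zero_of_isTrace_zero {u : W Ω ∅ m} (hu : IsTrace u 0) (hg : ‖u‖ = 0) : u = 0 := by
  have hg0 : W.gradL u = 0 := norm_eq_zero.1 hg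
  have hgs : sqNorm (volume.restrict Ω) u.grad = 0 := by
    have h := enorm_sq_eq_sqNorm (W.gradL u)
    rw [hg0, enorm_zero, zero_pow two_ne_zero] at h
    rw [W.grad, hg0]
    exact h.symm
  obtain ⟨z, hz⟩ := hΩ.frontier_nonempty
  obtain ⟨i, -⟩ := mem_iUnion.1 (𝒞.covers hz)
  have hr := 𝒞.r₀_pos hΩ
  set V := 𝒞.layer i 𝒞.r₀ with hV
  have hVΩ : V ⊆ Ω := 𝒞.layer_subset hM i le_rfl
  have hle : (volume : Measure Plane).restrict V ≤ volume.restrict Ω :=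
    Measure.restrict_mono hVΩ le_rfl
  have hVu : sqNorm (volume.restrict V) u.fn = 0 := by
    have h1 := sqNorm_layer_le_of_isTrace_zero hΩ hM 𝒞 hu i hr.le le_rfl
    have h2 := sqNorm_mono_set (μ := volume) hVΩ u.grad
    rw [hgs] at h2
    rw [nonpos_iff_eq_zero.1 h2, mul_zero] at h1
    exact nonpos_iff_eq_zero.1 h1
  obtain ⟨C, hC, hP⟩ := exists_sqNorm_le hΩ hM 𝒞 (𝒞.isOpen_layer i 𝒞.r₀) (𝒞.layer_nonempty i hr)
    hVΩ m
  obtain ⟨φ, hφ, -, h⟩ := u.exists_strongConv hΩ hM 𝒞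
  have hVfin : volume V ≠ ⊤ := ((measure_mono hVΩ).trans_lt hΩ.isBounded.measure_lt_top).ne
  have h1 := h.fn.tendsto_sqNorm (fun k => memLp_smooth hΩ (hφ k)) (u.memLp_fn hΩ hM 𝒞)
  have h2 := h.grad.tendsto_sqNorm (fun k => memLp_classicalGrad hΩ (hφ k)) u.memLp_grad
  have h3 := (h.fn.mono_measure hle).tendsto_sqNorm
    (fun k => (memLp_smooth hΩ (hφ k)).mono_measure hle) ((u.memLp_fn hΩ hM 𝒞).mono_measure hle)
  have h4 := ENNReal.Tendsto.const_mul (h2.add (ENNReal.Tendsto.const_mul h3 (Or.inr hVfin)))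
    (Or.inr hC)
  rw [hgs, hVu, mul_zero, add_zero, mul_zero] at h4
  have h5 : sqNorm (volume.restrict Ω) u.fn ≤ 0 := by
    refine le_of_tendsto_of_tendsto' h1 h4 fun k => (hP (hφ k)).trans ?_
    gcongr
    refine (lintegral_sq_le _ (hφ k).continuous.enorm.measurable.aemeasurable).trans ?_
    rw [Measure.restrict_apply_univ]
    rfl
  have h6 : u.fn =ᵐ[volume.restrict Ω] 0 := by
    have h7 := (lintegral_eq_zero_iff' (u.aestronglyMeasurable_fn.enorm.pow_const 2)).1
      (nonpos_iff_eq_zero.1 h5)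
    filter_upwards [h7] with x hx
    simpa using hx
  exact W.ext_ae (h6.trans AEEqFun.coeFn_zero.symm) (by rw [hg0, map_zero])

include 𝒞 in
/-- Functions with vanishing trace are limits of smooth functions that vanish near the boundary: the
cutoffs at distance `δ` from the boundary converge, since the function is of order `δ` there. -/
lemma W.exists_of_isTrace_zero {u : W Ω ∅ m} (hu : IsTrace u 0) :
    ∃ v : W Ω (frontier Ω) m, v.fn =ᵐ[volume.restrict Ω] u.fn ∧ W.gradL v = W.gradL u := by
  have hr := 𝒞.r₀_pos hΩ
  set δ : ℕ → ℝ := fun k => 𝒞.r₀ / (k + 1) with hδ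
  have hδpos : ∀ k, 0 < δ k := fun k => by positivity
  have hδr : ∀ k, δ k ≤ 𝒞.r₀ := fun k =>
    div_le_self hr.le (by linarith [(Nat.cast_nonneg k : (0 : ℝ) ≤ k)])
  have hδ0 : Tendsto δ atTop (𝓝 0) := by
    have h := (tendsto_one_div_add_atTop_nhds_zero_nat (𝕜 := ℝ)).const_mul 𝒞.r₀
    simpa only [mul_one_div, mul_zero] using h
  choose χ hχ hχ1 hχ0 hχb hχd using fun k => exists_cutoff (frontier Ω) (ε := δ k / (1 + M))
    (div_pos (hδpos k) (by positivity))
  have hex : ∀ k, ∃ v : W Ω (frontier Ω) m,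
      v.fn =ᵐ[volume.restrict Ω] (fun x => (1 - χ k x) • u.fn x) ∧
      v.grad =ᵐ[volume.restrict Ω] prodGrad (fun x => 1 - χ k x) u.fn u.grad := fun k =>
    W.exists_mul hΩ hM 𝒞 (contDiff_const.sub (hχ k)) (fun φ _ => by
      refine (eventually_nhdsSet_iff_forall.2 fun y hy => ?_)
      filter_upwards [hχ1 k y hy] with x hx
      simp [hx]) u
  choose v hv1 hv2 using hex
  set b : ℕ → ℝ≥0∞ := fun k => ∑ i, sqNorm (volume.restrict (𝒞.layer i (δ k))) u.grad with hb
  have hb0 : Tendsto b atTop (𝓝 0) := by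
    rw [← Finset.sum_const_zero (s := (Finset.univ : Finset (Fin 𝒞.n)))]
    refine tendsto_finsetSum _ fun i _ => ?_
    have h1 : Tendsto (fun k => volume (𝒞.layer i (δ k))) atTop (𝓝 0) := by
      have h2 := ENNReal.Tendsto.const_mul (a := volume (𝒞.base i))
        ((ENNReal.continuous_ofReal.tendsto 0).comp hδ0) (Or.inr (𝒞.volume_base_ne_top i))
      rw [ENNReal.ofReal_zero, mul_zero] at h2
      refine h2.congr fun k => ?_
      exact (volume_strip _ (𝒞.continuous_graph i) (𝒞.measurableSet_base i) _).symm
    have h2 : Tendsto ((volume.restrict Ω : Measure Plane) ∘ fun k => 𝒞.layer i (δ k)) atTop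
        (𝓝 0) :=
      tendsto_of_tendsto_of_tendsto_of_le_of_le tendsto_const_nhds h1 (fun _ => zero_le)
        fun k => Measure.restrict_apply_le _ _
    have h3 := tendsto_setLIntegral_zero (μ := volume.restrict Ω)
      (f := fun x => ‖u.grad x‖ₑ ^ 2)
      ((sqNorm_lt_top_iff_memLp u.memLp_grad.1).2 u.memLp_grad).ne h2
    refine h3.congr fun k => ?_
    rw [Measure.restrict_restrict_of_subset (𝒞.layer_subset hM i (hδr k))]
    rfl
  -- Functions that vanish away from the boundary only have to be estimated on the layers.
  have hsplit : ∀ {F : Type} [NormedAddCommGroup F] (k : ℕ) (f : Plane → F),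
      (∀ y ∈ core Ω (δ k / (1 + M)), f y = 0) →
      sqNorm (volume.restrict Ω) f ≤ ∑ i, sqNorm (volume.restrict (𝒞.layer i (δ k))) f := by
    intro F _ k f hf
    have h1 : sqNorm (volume.restrict (core Ω (δ k / (1 + M)))) f = 0 := by
      have h2 : MeasurableSet (core Ω (δ k / (1 + M))) :=
        (hΩ.isCompact_core (div_pos (hδpos k) (by positivity))).measurableSet
      rw [sqNorm, setLIntegral_congr_fun h2 (g := fun _ => 0) fun y hy => by simp [hf y hy],
        lintegral_zero]
    refine (sqNorm_mono_set (𝒞.subset_core_union_layers hΩ hM (hδr k)) f).trans ?_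
    refine (sqNorm_union_le _ _ f).trans ?_
    rw [h1, zero_add]
    exact sqNorm_iUnion_le _ f
  have hfn : ∀ k, sqNorm (volume.restrict Ω) (fun x => χ k x • u.fn x) ≤
      ENNReal.ofReal (8 * 𝒞.r₀ ^ 2) * b k := by
    intro k
    refine (hsplit k _ fun y hy => ?_).trans ?_
    · rw [(hχ0 k y hy.2).self_of_nhds, Pi.zero_apply, zero_smul]
    · rw [hb, Finset.mul_sum]
      refine Finset.sum_le_sum fun i _ => ?_
      have h1 : sqNorm (volume.restrict (𝒞.layer i (δ k))) (fun x => χ k x • u.fn x) ≤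
          4 * sqNorm (volume.restrict (𝒞.layer i (δ k))) u.fn := by
        rw [sqNorm, sqNorm, ← lintegral_const_mul' _ _ (by simp)]
        refine lintegral_mono fun x => ?_
        rw [enorm_smul, mul_pow]
        gcongr
        rw [← ofReal_norm, Real.norm_eq_abs]
        refine (pow_le_pow_left₀ zero_le (ENNReal.ofReal_le_ofReal (hχb k x)) 2).trans ?_
        norm_num
      refine h1.trans ((mul_le_mul_right
        (sqNorm_layer_le_of_isTrace_zero hΩ hM 𝒞 hu i (hδpos k).le (hδr k)) 4).trans ?_)
      rw [← mul_assoc]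
      gcongr
      rw [ENNReal.ofReal_mul (by norm_num), ENNReal.ofReal_pow hr.le, ← mul_assoc]
      norm_num
      gcongr
      exact hδr k
  -- Here the factor `1 / δ` of the gradient of the cutoff meets the bound of order `δ` on `u`.
  have hgr : ∀ k, sqNorm (volume.restrict Ω) (prodGrad (χ k) u.fn u.grad) ≤
      ENNReal.ofReal (8 + 72 * (1 + M) ^ 2) * b k := by
    intro k
    refine (hsplit k _ fun y hy => prodGrad_eq_zero (hχ0 k y hy.2) _ _).trans ?_
    rw [hb, Finset.mul_sum]
    refine Finset.sum_le_sum fun i _ => ?_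
    have hle : (volume : Measure Plane).restrict (𝒞.layer i (δ k)) ≤ volume.restrict Ω :=
      Measure.restrict_mono (𝒞.layer_subset hM i (hδr k)) le_rfl
    refine (sqNorm_prodGrad_le (A := 2) (𝒞.measurableSet_layer i _) (fun x _ => hχb k x)
      (fun j x _ => hχd k j x) u.fn (u.memLp_grad.1.mono_measure hle)).trans ?_
    rw [ENNReal.ofReal_add (by norm_num) (by positivity), add_mul]
    refine add_le_add (le_of_eq (by norm_num)) ?_
    refine (mul_le_mul_right (sqNorm_layer_le_of_isTrace_zero hΩ hM 𝒞 hu i (hδpos k).le (hδr k))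
      _).trans (le_of_eq ?_)
    rw [← mul_assoc]
    congr 1
    have h2 : (2 : ℝ≥0∞) = ENNReal.ofReal 2 := by simp
    rw [h2, ← ENNReal.ofReal_pow (hδpos k).le, ← ENNReal.ofReal_mul (by norm_num),
      ← ENNReal.ofReal_mul (by positivity)]
    congr 1
    have := (hδpos k).ne'
    field_simp
    norm_num
  have hlim : Tendsto (fun k => (W.toPair hΩ hM 𝒞 (v k)).1) atTop
      (𝓝 (W.toPair hΩ hM 𝒞 u).1) := by
    rw [tendsto_pair_iff, convLp_coeFn_iff, convLp_coeFn_iff, convLp_iff_sqNorm, convLp_iff_sqNorm]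
    have hb1 := ENNReal.Tendsto.const_mul (a := ENNReal.ofReal (8 * 𝒞.r₀ ^ 2)) hb0
      (Or.inr ENNReal.ofReal_ne_top)
    have hb2 := ENNReal.Tendsto.const_mul (a := ENNReal.ofReal (8 + 72 * (1 + M) ^ 2)) hb0
      (Or.inr ENNReal.ofReal_ne_top)
    rw [mul_zero] at hb1 hb2
    constructor
    · refine tendsto_of_tendsto_of_tendsto_of_le_of_le tendsto_const_nhds hb1 (fun _ => zero_le)
        fun k => le_trans (le_of_eq ?_) (hfn k)
      refine lintegral_congr_ae ?_
      filter_upwards [(W.toPair_fst hΩ hM 𝒞 (v k)), W.toPair_fst hΩ hM 𝒞 u, hv1 k] with x h1 h2 h3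
      rw [Pi.sub_apply, h1, h2, h3, sub_smul, one_smul, sub_sub_cancel_left, enorm_neg]
    · refine tendsto_of_tendsto_of_tendsto_of_le_of_le tendsto_const_nhds hb2 (fun _ => zero_le)
        fun k => le_trans (le_of_eq ?_) (hgr k)
      refine lintegral_congr_ae ?_
      filter_upwards [hv2 k] with x h1
      rw [prodGrad_one_sub] at h1
      have h2 : (W.toPair hΩ hM 𝒞 (v k)).1.snd x = (v k).grad x := rfl
      have h3 : (W.toPair hΩ hM 𝒞 u).1.snd x = u.grad x := rfl
      rw [Pi.sub_apply, h2, h3, h1, Pi.sub_apply, sub_sub_cancel_left, enorm_neg]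
  have hmem : (W.toPair hΩ hM 𝒞 u).1 ∈ sobolevPairs Ω (frontier Ω) m :=
    (smoothPairs Ω (frontier Ω) m).isClosed_topologicalClosure.mem_of_tendsto hlim
      (Eventually.of_forall fun k => (W.toPair hΩ hM 𝒞 (v k)).2)
  obtain ⟨w, hw1, hw2⟩ := exists_W_of_mem_sobolevPairs hΩ hmem
  exact ⟨w, hw1.trans (W.toPair_fst hΩ hM 𝒞 u), hw2⟩

end VanishingTrace

/-! ### The form -/

section Form

variable {m : ℕ} {Ω D : Set Plane} {M : ℝ} (a : Coeff m)

lemma Coeff.density_add_left (x : Plane) (P P' Q : GradVec m) :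
    a.density x (P + P') Q = a.density x P Q + a.density x P' Q := by
  simp only [Coeff.density, PiLp.add_apply, mul_add, add_mul, Finset.sum_add_distrib]

lemma Coeff.density_add_right (x : Plane) (P Q Q' : GradVec m) :
    a.density x P (Q + Q') = a.density x P Q + a.density x P Q' := by
  simp only [Coeff.density, PiLp.add_apply, mul_add, Finset.sum_add_distrib]

lemma Coeff.density_smul_left (x : Plane) (c : ℝ) (P Q : GradVec m) :
    a.density x (c • P) Q = c * a.density x P Q := by
  simp only [Coeff.density, PiLp.smul_apply, smul_eq_mul, Finset.mul_sum]
  refine Finset.sum_congr rfl fun i _ => Finset.sum_congr rfl fun j _ => Finset.sum_congr rfl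
    fun α _ => Finset.sum_congr rfl fun β _ => ?_
  ring

lemma Coeff.density_smul_right (x : Plane) (c : ℝ) (P Q : GradVec m) :
    a.density x P (c • Q) = c * a.density x P Q := by
  simp only [Coeff.density, PiLp.smul_apply, smul_eq_mul, Finset.mul_sum]
  refine Finset.sum_congr rfl fun i _ => Finset.sum_congr rfl fun j _ => Finset.sum_congr rfl
    fun α _ => Finset.sum_congr rfl fun β _ => ?_
  ring

lemma Coeff.abs_density_le {x : Plane} (hx : ∀ i j α β, |a i j α β x| ≤ M) (P Q : GradVec m) :
    |a.density x P Q| ≤ (4 * m ^ 2 * M) * (‖P‖ * ‖Q‖) := by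
  have h1 : ∀ i j α β, |a i j α β x * P (j, β) * Q (i, α)| ≤ M * (‖P‖ * ‖Q‖) := by
    intro i j α β
    rw [abs_mul, abs_mul, mul_assoc]
    have h0 : 0 ≤ M := (abs_nonneg _).trans (hx i j α β)
    have h2 := PiLp.norm_apply_le P (j, β)
    have h3 := PiLp.norm_apply_le Q (i, α)
    exact mul_le_mul (hx i j α β) (mul_le_mul h2 h3 (abs_nonneg _) (norm_nonneg _))
      (by positivity) h0
  have h2 : |a.density x P Q| ≤
      ∑ _i : Fin 2, ∑ _j : Fin 2, ∑ _α : Fin m, ∑ _β : Fin m, M * (‖P‖ * ‖Q‖) :=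
    (Finset.abs_sum_le_sum_abs _ _).trans <| Finset.sum_le_sum fun i _ =>
      (Finset.abs_sum_le_sum_abs _ _).trans <| Finset.sum_le_sum fun j _ =>
        (Finset.abs_sum_le_sum_abs _ _).trans <| Finset.sum_le_sum fun α _ =>
          (Finset.abs_sum_le_sum_abs _ _).trans <| Finset.sum_le_sum fun β _ => h1 i j α β
  refine h2.trans (le_of_eq ?_)
  simp only [Finset.sum_const, Finset.card_univ, Fintype.card_fin, nsmul_eq_mul]
  push_cast
  ring

variable {a} (hbdd : a.IsBounded Ω M)

include hbdd

lemma Coeff.IsBounded.ae_abs_le : ∀ᵐ x ∂volume.restrict Ω, ∀ i j α β, |a i j α β x| ≤ M := by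
  simp only [ae_all_iff]
  exact fun i j α β => (hbdd i j α β).2

lemma Coeff.IsBounded.integrable_density {P Q : Plane → GradVec m}
    (hP : MemLp P 2 (volume.restrict Ω)) (hQ : MemLp Q 2 (volume.restrict Ω)) :
    Integrable (fun x => a.density x (P x) (Q x)) (volume.restrict Ω) := by
  have hcoord : ∀ {R : Plane → GradVec m}, MemLp R 2 (volume.restrict Ω) → ∀ p,
      AEStronglyMeasurable (fun x => R x p) (volume.restrict Ω) := fun hR p =>
    (EuclideanSpace.proj (𝕜 := ℝ) p).continuous.comp_aestronglyMeasurable hR.1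
  have hm : AEStronglyMeasurable (fun x => a.density x (P x) (Q x)) (volume.restrict Ω) := by
    unfold Coeff.density
    refine Finset.aestronglyMeasurable_fun_sum _ fun i _ =>
      Finset.aestronglyMeasurable_fun_sum _ fun j _ =>
      Finset.aestronglyMeasurable_fun_sum _ fun α _ =>
      Finset.aestronglyMeasurable_fun_sum _ fun β _ => ?_
    exact ((hbdd i j α β).1.aestronglyMeasurable.mul (hcoord hP _)).mul (hcoord hQ _)
  have h1 : Integrable (fun x => ‖P x‖ * ‖Q x‖) (volume.restrict Ω) := hP.norm.integrable_mul hQ.norm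
  refine (h1.const_mul (4 * m ^ 2 * M)).mono' hm ?_
  filter_upwards [hbdd.ae_abs_le] with x hx
  exact a.abs_density_le hx _ _

/-- The form as a bounded bilinear form of the gradients. -/
lemma Coeff.IsBounded.exists_form : ∃ B : Lp (GradVec m) 2 (volume.restrict Ω) →L[ℝ]
    Lp (GradVec m) 2 (volume.restrict Ω) →L[ℝ] ℝ,
    ∀ P Q, B P Q = ∫ x in Ω, a.density x (P x) (Q x) := by
  have hi : ∀ P Q : Lp (GradVec m) 2 (volume.restrict Ω),
      Integrable (fun x => a.density x (P x) (Q x)) (volume.restrict Ω) := fun P Q =>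
    hbdd.integrable_density (Lp.memLp P) (Lp.memLp Q)
  let B : Lp (GradVec m) 2 (volume.restrict Ω) →ₗ[ℝ] Lp (GradVec m) 2 (volume.restrict Ω) →ₗ[ℝ] ℝ :=
    LinearMap.mk₂ ℝ (fun P Q => ∫ x in Ω, a.density x (P x) (Q x))
      (fun P P' Q => by
        rw [← integral_add (hi P Q) (hi P' Q)]
        refine integral_congr_ae ?_
        filter_upwards [Lp.coeFn_add P P'] with x hx
        rw [hx, Pi.add_apply, a.density_add_left])
      (fun c P Q => by
        rw [smul_eq_mul, ← integral_const_mul]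
        refine integral_congr_ae ?_
        filter_upwards [Lp.coeFn_smul c P] with x hx
        rw [hx, Pi.smul_apply, a.density_smul_left])
      (fun P Q Q' => by
        rw [← integral_add (hi P Q) (hi P Q')]
        refine integral_congr_ae ?_
        filter_upwards [Lp.coeFn_add Q Q'] with x hx
        rw [hx, Pi.add_apply, a.density_add_right])
      (fun c P Q => by
        rw [smul_eq_mul, ← integral_const_mul]
        refine integral_congr_ae ?_
        filter_upwards [Lp.coeFn_smul c Q] with x hx
        rw [hx, Pi.smul_apply, a.density_smul_right])
  have hB : ∀ P Q, ‖B P Q‖ ≤ |4 * m ^ 2 * M| * ‖P‖ * ‖Q‖ := by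
    intro P Q
    have h1 : Integrable (fun x => ‖P x‖ * ‖Q x‖) (volume.restrict Ω) :=
      (Lp.memLp P).norm.integrable_mul (Lp.memLp Q).norm
    have h2 : ‖B P Q‖ ≤ ∫ x in Ω, |4 * m ^ 2 * M| * (‖P x‖ * ‖Q x‖) := by
      refine norm_integral_le_of_norm_le (h1.const_mul _) ?_
      filter_upwards [hbdd.ae_abs_le] with x hx
      exact (a.abs_density_le hx _ _).trans
        (mul_le_mul_of_nonneg_right (le_abs_self _) (by positivity))
    have h3 : ∫ x in Ω, ‖P x‖ * ‖Q x‖ ≤ ‖P‖ * ‖Q‖ := by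
      have h4 : ⟪(Lp.memLp P).norm.toLp, (Lp.memLp Q).norm.toLp⟫_ℝ = ∫ x in Ω, ‖P x‖ * ‖Q x‖ := by
        rw [L2.inner_def]
        refine integral_congr_ae ?_
        filter_upwards [(Lp.memLp P).norm.coeFn_toLp, (Lp.memLp Q).norm.coeFn_toLp] with x h5 h6
        rw [h5, h6]
        simp [mul_comm]
      rw [← h4]
      refine (real_inner_le_norm _ _).trans (le_of_eq ?_)
      rw [Lp.norm_toLp, Lp.norm_toLp, eLpNorm_norm, eLpNorm_norm, Lp.norm_def, Lp.norm_def]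
    refine h2.trans ?_
    rw [integral_const_mul, mul_assoc |_|]
    exact mul_le_mul_of_nonneg_left h3 (abs_nonneg _)
  exact ⟨B.mkContinuous₂ _ hB, fun P Q => rfl⟩

end Form

/-! ### Gårding's inequality -/

section Garding

/-- A smooth quadratic partition of unity on a compact set. -/
lemma exists_quadratic_partition {K : Set Plane} (hK : IsCompact K) (U : Plane → Set Plane)
    (hUo : ∀ x, IsOpen (U x)) (hU : ∀ x ∈ K, x ∈ U x) :
    ∃ (t : Finset Plane) (η : t → Plane → ℝ), (∀ k : t, (k : Plane) ∈ K) ∧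
      (∀ k, ContDiff ℝ ∞ (η k)) ∧ (∀ k, tsupport (η k) ⊆ U k) ∧
      ∀ x ∈ K, ∑ k, η k x ^ 2 = 1 := by
  obtain ⟨t, htK, ht⟩ := hK.elim_nhds_subcover U fun x hx => (hUo x).mem_nhds (hU x hx)
  obtain ⟨f, hf⟩ := SmoothPartitionOfUnity.exists_isSubordinate (modelWithCornersSelf ℝ Plane)
    hK.isClosed (fun k : t => U k) (fun k => hUo k) (fun x hx => by
      obtain ⟨y, hy, hxy⟩ := mem_iUnion₂.1 (ht hx)
      exact mem_iUnion.2 ⟨⟨y, hy⟩, hxy⟩)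
  have hfs : ∀ k, ContDiff ℝ ∞ (f k) := fun k => (f k).contMDiff.contDiff
  -- The second term makes `S` positive everywhere, so that dividing by its root is smooth.
  set S : Plane → ℝ := fun x => ∑ k, f k x ^ 2 + (1 - ∑ k, f k x) ^ 2 with hS
  have hSs : ContDiff ℝ ∞ S :=
    (ContDiff.sum fun k _ => (hfs k).pow 2).add
      ((contDiff_const.sub (ContDiff.sum fun k _ => hfs k)).pow 2)
  have hSpos : ∀ x, 0 < S x := by
    intro x
    have h1 : 0 ≤ ∑ k, f k x ^ 2 := Finset.sum_nonneg fun k _ => sq_nonneg _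
    rcases h1.eq_or_lt with h2 | h2
    · have h3 : ∀ k, f k x = 0 := fun k =>
        pow_eq_zero_iff two_ne_zero |>.1
          ((Finset.sum_eq_zero_iff_of_nonneg fun k _ => sq_nonneg _).1 h2.symm k (Finset.mem_univ k))
      simp [hS, h3]
    · exact add_pos_of_pos_of_nonneg h2 (sq_nonneg _)
  refine ⟨t, fun k x => f k x / Real.sqrt (S x), fun k => htK k k.2, fun k => ?_, fun k => ?_, ?_⟩
  · exact (hfs k).div (hSs.sqrt fun x => (hSpos x).ne') fun x => (Real.sqrt_pos.2 (hSpos x)).ne'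
  · refine (closure_mono fun x hx => ?_).trans (hf k)
    intro h
    exact hx (by simp only; rw [h, zero_div])
  · intro x hx
    have h1 : ∑ k, f k x = 1 := by
      rw [← finsum_eq_sum_of_fintype]
      exact f.sum_eq_one hx
    have h2 : S x = ∑ k, f k x ^ 2 := by
      simp only [hS, h1, sub_self, zero_pow two_ne_zero, add_zero]
    simp only [div_pow, Real.sq_sqrt (hSpos x).le, ← Finset.sum_div]
    rw [← h2, div_self (hSpos x).ne']

variable {m : ℕ} {Ω : Set Plane} {M : ℝ}

lemma Coeff.sum_density {κ : Type*} [Fintype κ] (a : Coeff m) (x : Plane) (P : κ → GradVec m) :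
    ∑ k, a.density x (P k) (P k) =
      ∑ i, ∑ j, ∑ α, ∑ β, a i j α β x * ∑ k, P k (j, β) * P k (i, α) := by
  simp only [Coeff.density]
  rw [Finset.sum_comm]
  refine Finset.sum_congr rfl fun i _ => ?_
  rw [Finset.sum_comm]
  refine Finset.sum_congr rfl fun j _ => ?_
  rw [Finset.sum_comm]
  refine Finset.sum_congr rfl fun α _ => ?_
  rw [Finset.sum_comm]
  refine Finset.sum_congr rfl fun β _ => ?_
  simp only [Finset.mul_sum, mul_assoc]

section Localization

variable {κ : Type*} [Fintype κ] {η : κ → Plane → ℝ} {x : Plane}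
  (h1 : ∑ k, η k x ^ 2 = 1) (h2 : ∀ i, ∑ k, η k x * partialDeriv i (η k) x = 0)

include h1 h2

/-- The cross terms of the product rule cancel in the sum over a quadratic partition of unity. -/
lemma sum_prodGrad_mul_prodGrad (v : Plane → Vec m) (G : Plane → GradVec m)
    (p q : Fin 2 × Fin m) :
    ∑ k, prodGrad (η k) v G x p * prodGrad (η k) v G x q =
      G x p * G x q + ∑ k, prodGrad (η k) v 0 x p * prodGrad (η k) v 0 x q := by
  have h3 : ∀ k, prodGrad (η k) v G x p * prodGrad (η k) v G x q =
      η k x ^ 2 * (G x p * G x q) + η k x * partialDeriv p.1 (η k) x * (v x p.2 * G x q) +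
      η k x * partialDeriv q.1 (η k) x * (v x q.2 * G x p) +
      prodGrad (η k) v 0 x p * prodGrad (η k) v 0 x q := by
    intro k
    simp only [prodGrad_apply, Pi.zero_apply, PiLp.zero_apply]
    ring
  simp only [h3, Finset.sum_add_distrib, ← Finset.sum_mul, h1, h2]
  ring

lemma norm_sq_le_sum_prodGrad (v : Plane → Vec m) (G : Plane → GradVec m) :
    ‖G x‖ ^ 2 ≤ ∑ k, ‖prodGrad (η k) v G x‖ ^ 2 := by
  simp only [EuclideanSpace.norm_sq_eq, Real.norm_eq_abs, sq_abs]
  rw [Finset.sum_comm]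
  refine Finset.sum_le_sum fun p _ => ?_
  have h3 := sum_prodGrad_mul_prodGrad h1 h2 v G p p
  simp only [← sq] at h3
  rw [h3]
  exact le_add_of_nonneg_right (Finset.sum_nonneg fun k _ => sq_nonneg _)

lemma Coeff.sum_density_prodGrad (a : Coeff m) (v : Plane → Vec m) (G : Plane → GradVec m) :
    ∑ k, a.density x (prodGrad (η k) v G x) (prodGrad (η k) v G x) =
      a.density x (G x) (G x) +
        ∑ k, a.density x (prodGrad (η k) v 0 x) (prodGrad (η k) v 0 x) := by
  rw [a.sum_density, a.sum_density]
  simp only [sum_prodGrad_mul_prodGrad h1 h2 v G, mul_add, Finset.sum_add_distrib, Coeff.density,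
    mul_assoc]

end Localization

lemma sum_mul_partialDeriv_eq_zero {κ : Type*} [Fintype κ] {η : κ → Plane → ℝ}
    (hη : ∀ k, ContDiff ℝ ∞ (η k)) (hΩ : IsOpen Ω) (h : ∀ x ∈ Ω, ∑ k, η k x ^ 2 = 1)
    {x : Plane} (hx : x ∈ Ω) (i : Fin 2) : ∑ k, η k x * partialDeriv i (η k) x = 0 := by
  have h1 : HasFDerivAt (fun y => ∑ k, η k y ^ 2)
      (∑ k, (2 * η k x ^ 1) • fderiv ℝ (η k) x) x := by
    refine HasFDerivAt.fun_sum fun k _ => ?_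
    have h2 := (((hη k).differentiable (by simp)) x).hasFDerivAt.pow 2
    simpa using h2
  have h2 : (fun y => ∑ k, η k y ^ 2) =ᶠ[𝓝 x] fun _ => 1 :=
    eventually_of_mem (hΩ.mem_nhds hx) h
  have h3 := (h1.congr_of_eventuallyEq h2.symm).unique (hasFDerivAt_const (1 : ℝ) x)
  have h4 := congrArg (fun L : Plane →L[ℝ] ℝ => L (EuclideanSpace.single i 1)) h3
  simp only [pow_one, FunLike.coe_sum, Finset.sum_apply, FunLike.coe_smul,
    Pi.smul_apply, smul_eq_mul, zero_apply, mul_assoc, ← Finset.mul_sum] at h4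
  unfold partialDeriv
  linarith

lemma isOpen_rect (T : Plane ≃ₗᵢ[ℝ] Plane) (x : Plane) (r : ℝ) : IsOpen (rect M T x r) := by
  have h0 : Continuous fun y : Plane => |T y 0 - T x 0| := by fun_prop
  have h1 : Continuous fun y : Plane => |T y 1 - T x 1| := by fun_prop
  exact (isOpen_lt h0 continuous_const).inter (isOpen_lt h1 continuous_const)

/-- Around every point, one of the local domains is a neighborhood relative to `Ω`. -/
lemma exists_localDomain (hΩ : IsLipschitzDomain Ω M) (hM : 0 < M) (𝒞 : CoordCover Ω M)
    {loc : Plane → ℝ → Set Plane}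
    (hloc : ∀ x ∈ closure Ω, ∀ ρ : ℝ, 0 < ρ → ρ < 𝒞.r₀ → 𝒞.IsLocalDomain x ρ (loc x ρ))
    {x : Plane} (hx : x ∈ closure Ω) :
    ∃ (ρ : ℝ) (U : Set Plane), 0 < ρ ∧ ρ < 𝒞.r₀ ∧ IsOpen U ∧ x ∈ U ∧ loc x ρ = U ∩ Ω := by
  have hr := 𝒞.r₀_pos hΩ
  by_cases hxΩ : x ∈ Ω
  · have hd : 0 < Metric.infDist x (frontier Ω) :=
      (isClosed_frontier.notMem_iff_infDist_pos hΩ.frontier_nonempty).1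
        fun h => hΩ.notMem_of_mem_frontier h hxΩ
    obtain ⟨s, hs, hsΩ⟩ := Metric.isOpen_iff.1 hΩ.isOpen x hxΩ
    obtain ⟨ρ, hρ, hρ'⟩ := exists_between (lt_min hr (lt_min hd hs))
    obtain ⟨h1, h2, h3⟩ : ρ < 𝒞.r₀ ∧ ρ < Metric.infDist x (frontier Ω) ∧ ρ < s := by
      simpa only [lt_min_iff] using hρ'
    refine ⟨ρ, Metric.ball x ρ, hρ, h1, Metric.isOpen_ball, Metric.mem_ball_self hρ, ?_⟩
    rcases hloc x hx ρ hρ h1 with h | h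
    · rw [h.2, inter_eq_left.2 ((Metric.ball_subset_ball h3.le).trans hsΩ)]
    · exact absurd h.1 (not_le.2 h2)
  · have hxf : x ∈ frontier Ω := by
      rw [hΩ.isOpen.frontier_eq]
      exact ⟨hx, hxΩ⟩
    have hρ : 0 < 𝒞.r₀ / 2 := by positivity
    rcases hloc x hx (𝒞.r₀ / 2) hρ (by linarith) with h | h
    · have h1 := h.1
      rw [Metric.infDist_zero_of_mem hxf] at h1
      linarith
    · obtain ⟨-, i, hi, hU⟩ := h
      have hri := 𝒞.radius_pos i
      have h1 : x ∈ frontier Ω ∩ rect M (𝒞.frame i) (𝒞.center i) (100 * 𝒞.radius i) :=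
        ⟨hxf, hi.1.trans_le (by linarith), hi.2.trans_le (by gcongr; norm_num)⟩
      rw [(𝒞.isCoordRect i).boundary] at h1
      have h2 : 𝒞.proj i x = x := by
        have h3 : 𝒞.frame i x 1 = 𝒞.graph i (𝒞.frame i x 0) := h1.1
        have h4 := pt_frame (𝒞.frame i) x
        rwa [h3] at h4
      rw [h2] at hU
      refine ⟨𝒞.r₀ / 2, _, hρ, by linarith, isOpen_rect _ _ _, ⟨?_, ?_⟩, hU⟩
      · rw [sub_self, abs_zero]
        exact hρ
      · rw [sub_self, abs_zero]
        positivity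

lemma prodGrad_eq_zero_of_notMem_tsupport {χ : Plane → ℝ} {x : Plane} (h : x ∉ tsupport χ)
    (v : Plane → Vec m) (G : Plane → GradVec m) : prodGrad χ v G x = 0 :=
  prodGrad_eq_zero (notMem_tsupport_iff_eventuallyEq.1 h) v G

/-- The local ellipticity condition, applied to the product with a function supported in the local
domain. -/
lemma Coeff.IsLocallyElliptic.mul_le {a : Coeff m} (hΩ : IsLipschitzDomain Ω M) (hM : 0 < M)
    (𝒞 : CoordCover Ω M) {loc : Plane → ℝ → Set Plane}
    (hell : a.IsLocallyElliptic Ω M 𝒞.r₀ loc) {x : Plane} (hx : x ∈ closure Ω) {ρ : ℝ} (hρ : 0 < ρ)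
    (hρr : ρ < 𝒞.r₀) {U : Set Plane} (hU : loc x ρ = U ∩ Ω) {χ : Plane → ℝ}
    (hχ : ContDiff ℝ ∞ χ) (hχU : tsupport χ ⊆ U) (u : W Ω ∅ m) :
    M⁻¹ * ∫ y in Ω, ‖prodGrad χ u.fn u.grad y‖ ^ 2 ≤
      ∫ y in Ω, (a.density y (prodGrad χ u.fn u.grad y) (prodGrad χ u.fn u.grad y) +
        (ρ ^ 2)⁻¹ * ‖χ y • u.fn y‖ ^ 2) := by
  obtain ⟨v, hv1, hv2⟩ := W.exists_mul (D' := ∅) hΩ hM 𝒞 hχ (fun φ _ => by simp [EventuallyEq]) u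
  have h := hell x hx ρ hρ hρr v 0
  have hsub : loc x ρ ⊆ Ω := by
    rw [hU]
    exact inter_subset_right
  have hle := ae_mono (Measure.restrict_mono (μ := (volume : Measure Plane)) hsub le_rfl)
  have hzero : ∀ y ∈ Ω \ loc x ρ, prodGrad χ u.fn u.grad y = 0 ∧ χ y = 0 := by
    intro y hy
    have h1 : y ∉ tsupport χ := fun h1 => hy.2 (hU ▸ ⟨hχU h1, hy.1⟩)
    exact ⟨prodGrad_eq_zero_of_notMem_tsupport h1 _ _, image_eq_zero_of_notMem_tsupport h1⟩
  have e1 : ∫ y in loc x ρ, ‖v.grad y‖ ^ 2 = ∫ y in Ω, ‖prodGrad χ u.fn u.grad y‖ ^ 2 := by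
    rw [setIntegral_eq_of_subset_of_forall_sdiff_eq_zero hΩ.isOpen.measurableSet hsub]
    · refine integral_congr_ae ?_
      filter_upwards [hle hv2] with y hy
      rw [hy]
    · intro y hy
      rw [(hzero y hy).1, norm_zero, zero_pow two_ne_zero]
  have e2 : ∫ y in loc x ρ, (a.density y (v.grad y) (v.grad y) +
      (ρ ^ 2)⁻¹ * ‖v.fn y - 0‖ ^ 2) =
      ∫ y in Ω, (a.density y (prodGrad χ u.fn u.grad y) (prodGrad χ u.fn u.grad y) +
        (ρ ^ 2)⁻¹ * ‖χ y • u.fn y‖ ^ 2) := by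
    rw [setIntegral_eq_of_subset_of_forall_sdiff_eq_zero hΩ.isOpen.measurableSet hsub]
    · refine integral_congr_ae ?_
      filter_upwards [hle hv1, hle hv2] with y hy1 hy2
      rw [hy1, hy2, sub_zero]
    · intro y hy
      rw [(hzero y hy).1, (hzero y hy).2]
      simp [Coeff.density]
  rwa [e1, e2] at h

/-- Gårding's inequality: local ellipticity implies coercivity up to a multiple of the norm in
`L²(Ω)`. The local inequalities are applied to `η_k u` for a quadratic partition of unity `η_k`; in
their sum, the terms that contain both `u` and `∇u` cancel. -/
lemma Coeff.IsLocallyElliptic.exists_garding {a : Coeff m} (hΩ : IsLipschitzDomain Ω M)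
    (hM : 0 < M) (𝒞 : CoordCover Ω M) {loc : Plane → ℝ → Set Plane}
    (hloc : ∀ x ∈ closure Ω, ∀ ρ : ℝ, 0 < ρ → ρ < 𝒞.r₀ → 𝒞.IsLocalDomain x ρ (loc x ρ))
    (hbdd : a.IsBounded Ω M) (hell : a.IsLocallyElliptic Ω M 𝒞.r₀ loc) :
    ∃ Λ : ℝ, 0 ≤ Λ ∧ ∀ u : W Ω ∅ m,
      M⁻¹ * ∫ x in Ω, ‖u.grad x‖ ^ 2 ≤ a.form u u + Λ * ∫ x in Ω, ‖u.fn x‖ ^ 2 := by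
  have hex : ∀ x : Plane, ∃ (ρ : ℝ) (U : Set Plane), IsOpen U ∧ (x ∈ closure Ω →
      0 < ρ ∧ ρ < 𝒞.r₀ ∧ x ∈ U ∧ loc x ρ = U ∩ Ω) := by
    intro x
    by_cases hx : x ∈ closure Ω
    · obtain ⟨ρ, U, h1, h2, h3, h4⟩ := exists_localDomain hΩ hM 𝒞 hloc hx
      exact ⟨ρ, U, h3, fun _ => ⟨h1, h2, h4⟩⟩
    · exact ⟨0, univ, isOpen_univ, fun h => absurd h hx⟩
  choose ρ U hUo hU using hex
  obtain ⟨t, η, ht, hη, hηU, hη1⟩ := exists_quadratic_partition hΩ.isBounded.isCompact_closure U hUo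
    fun x hx => (hU x hx).2.2.1
  have hη1' : ∀ x ∈ Ω, ∑ k, η k x ^ 2 = 1 := fun x hx => hη1 x (subset_closure hx)
  have hη2 : ∀ x ∈ Ω, ∀ i, ∑ k, η k x * partialDeriv i (η k) x = 0 := fun x hx i =>
    sum_mul_partialDeriv_eq_zero hη hΩ.isOpen hη1' hx i
  choose A hA hA' using fun k => exists_bound_on_bounded (hη k) hΩ.isBounded
  -- The terms with two derivatives on the partition of unity, and those from the local inequalities.
  set Λ : ℝ := ∑ k, (4 * m ^ 2 * M * (4 * A k ^ 2) + (ρ k ^ 2)⁻¹ * A k ^ 2) with hΛ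
  refine ⟨Λ, by positivity, fun u => ?_⟩
  have hGm := u.memLp_grad
  have hum := u.memLp_fn hΩ hM 𝒞
  have hmeas := hΩ.isOpen.measurableSet
  choose w hw1 hw2 using fun k =>
    W.exists_mul (D' := ∅) hΩ hM 𝒞 (hη k) (fun φ _ => by simp [EventuallyEq]) u
  set P : t → Plane → GradVec m := fun k => prodGrad (η k) u.fn u.grad with hP
  have hPm : ∀ k, MemLp (P k) 2 (volume.restrict Ω) := fun k =>
    (memLp_congr_ae (hw2 k)).1 (w k).memLp_grad
  have hηm : ∀ k, MemLp (fun x => η k x • u.fn x) 2 (volume.restrict Ω) := fun k =>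
    (memLp_congr_ae (hw1 k)).1 ((w k).memLp_fn hΩ hM 𝒞)
  have hi1 : ∀ k, Integrable (fun x => ‖P k x‖ ^ 2) (volume.restrict Ω) := fun k =>
    (hPm k).integrable_norm_pow two_ne_zero
  have hi2 : ∀ k, Integrable (fun x => a.density x (P k x) (P k x) +
      (ρ k ^ 2)⁻¹ * ‖η k x • u.fn x‖ ^ 2) (volume.restrict Ω) := fun k =>
    (hbdd.integrable_density (hPm k) (hPm k)).add
      (((hηm k).integrable_norm_pow two_ne_zero).const_mul _)
  have hi3 := hGm.integrable_norm_pow two_ne_zero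
  have hi4 := hum.integrable_norm_pow two_ne_zero
  have hsum : M⁻¹ * ∑ k, ∫ x in Ω, ‖P k x‖ ^ 2 ≤ ∑ k, ∫ x in Ω,
      (a.density x (P k x) (P k x) + (ρ k ^ 2)⁻¹ * ‖η k x • u.fn x‖ ^ 2) := by
    rw [Finset.mul_sum]
    refine Finset.sum_le_sum fun k _ => ?_
    obtain ⟨h1, h2, -, h3⟩ := hU k (ht k)
    exact hell.mul_le hΩ hM 𝒞 (ht k) h1 h2 h3 (hη k) (hηU k) u
  have hleft : ∫ x in Ω, ‖u.grad x‖ ^ 2 ≤ ∑ k, ∫ x in Ω, ‖P k x‖ ^ 2 := by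
    rw [← integral_finsetSum _ fun k _ => hi1 k]
    refine integral_mono_ae hi3 (integrable_finsetSum _ fun k _ => hi1 k) ?_
    filter_upwards [ae_restrict_mem hmeas] with x hx
    exact norm_sq_le_sum_prodGrad (hη1' x hx) (hη2 x hx) u.fn u.grad
  have hright : ∑ k, ∫ x in Ω,
      (a.density x (P k x) (P k x) + (ρ k ^ 2)⁻¹ * ‖η k x • u.fn x‖ ^ 2) ≤
      a.form u u + Λ * ∫ x in Ω, ‖u.fn x‖ ^ 2 := by
    rw [← integral_finsetSum _ fun k _ => hi2 k, Coeff.form, ← integral_const_mul,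
      ← integral_add (hbdd.integrable_density hGm hGm) (hi4.const_mul _)]
    refine integral_mono_ae (integrable_finsetSum _ fun k _ => hi2 k)
      ((hbdd.integrable_density hGm hGm).add (hi4.const_mul _)) ?_
    filter_upwards [ae_restrict_mem hmeas, hbdd.ae_abs_le] with x hx hax
    rw [Finset.sum_add_distrib, a.sum_density_prodGrad (hη1' x hx) (hη2 x hx), add_assoc,
      ← Finset.sum_add_distrib, hΛ, Finset.sum_mul]
    refine add_le_add le_rfl (Finset.sum_le_sum fun k _ => ?_)
    rw [add_mul]
    refine add_le_add ?_ ?_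
    · refine (le_abs_self _).trans ((a.abs_density_le hax _ _).trans ?_)
      rw [mul_assoc (4 * (m : ℝ) ^ 2 * M), ← sq]
      refine mul_le_mul_of_nonneg_left ?_ (by positivity)
      refine (norm_prodGrad_sq_le (η k) u.fn 0 x).trans ?_
      have h3 := sq_le_sq' (abs_le.1 (hA' k 0 x hx)).1 (abs_le.1 (hA' k 0 x hx)).2
      have h4 := sq_le_sq' (abs_le.1 (hA' k 1 x hx)).1 (abs_le.1 (hA' k 1 x hx)).2
      rw [Pi.zero_apply, norm_zero, zero_pow two_ne_zero, mul_zero, zero_add, Fin.sum_univ_two]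
      exact mul_le_mul_of_nonneg_right (by linarith) (sq_nonneg _)
    · rw [norm_smul, mul_pow, mul_assoc, Real.norm_eq_abs, sq_abs]
      have h3 := sq_le_sq' (abs_le.1 (hA k x hx)).1 (abs_le.1 (hA k x hx)).2
      gcongr
  exact (mul_le_mul_of_nonneg_left hleft (by positivity)).trans (hsum.trans hright)

end Garding

/-! ### Coercivity up to finitely many functionals -/

section FiniteRank

variable {m : ℕ} {Ω D : Set Plane} {M : ℝ}

lemma integral_norm_sq_eq {X F : Type*} [MeasurableSpace X] [NormedAddCommGroup F] {μ : Measure X}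
    {f : X → F} (hf : AEStronglyMeasurable f μ) : ∫ x, ‖f x‖ ^ 2 ∂μ = (sqNorm μ f).toReal := by
  rw [integral_eq_lintegral_of_nonneg_ae (ae_of_all _ fun x => sq_nonneg _) (hf.norm.pow 2)]
  congr 1
  refine lintegral_congr fun x => ?_
  rw [ENNReal.ofReal_pow (norm_nonneg _), ofReal_norm]

lemma norm_setIntegral_sq {φ : Plane → Vec m} {Q : Set Plane} (hφ : IntegrableOn φ Q) :
    ‖∫ y in Q, φ y‖ ^ 2 = ∑ α, (∫ y in Q, φ y α) ^ 2 := by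
  rw [EuclideanSpace.norm_sq_eq]
  refine Finset.sum_congr rfl fun α _ => ?_
  rw [Real.norm_eq_abs, sq_abs]
  have h := (EuclideanSpace.proj (𝕜 := ℝ) α : Vec m →L[ℝ] ℝ).integral_comp_comm hφ
  exact congrArg (· ^ 2) h.symm

/-- Rellich's theorem in quantitative form: up to an arbitrarily small multiple of the Sobolev norm,
the norm in `L²(Ω)` is controlled by finitely many functionals. -/
lemma exists_functionals (hΩ : IsLipschitzDomain Ω M) (hM : 0 < M) (𝒞 : CoordCover Ω M) (m : ℕ)
    {ε : ℝ} (hε : 0 < ε) :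
    ∃ (κ : Type) (_ : Fintype κ) (ℓ : κ → StrongDual ℝ (PairSpace Ω m)),
      ∀ p ∈ sobolevPairs Ω D m, ‖p.fst‖ ^ 2 ≤ ε * ‖p‖ ^ 2 + ∑ k, ℓ k p ^ 2 := by
  have hfin := hΩ.isFiniteMeasure
  obtain ⟨κ, hκ, Q, C, hC, hQ, h⟩ := exists_averages hΩ hM 𝒞 (ε := ENNReal.ofReal ε)
    (ENNReal.ofReal_pos.2 hε).ne'
  have hw : ∀ k, MemLp ((Q k).indicator fun _ => (1 : ℝ)) 2 (volume.restrict Ω) := fun k =>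
    (memLp_const 1).indicator (hQ k).1
  choose L hL using fun (k : κ) (α : Fin m) => exists_dual_eq_integral (hw k) α
  have hL' : ∀ k α (f : Lp (Vec m) 2 (volume.restrict Ω)), L k α f = ∫ y in Q k, f y α := by
    intro k α f
    rw [hL, ← Measure.restrict_restrict_of_subset (hQ k).2, ← integral_indicator (hQ k).1]
    refine integral_congr_ae (ae_of_all _ fun y => ?_)
    by_cases hy : y ∈ Q k <;> simp [hy]
  obtain ⟨ℓ, hℓ⟩ : ∃ ℓ : κ × Fin m → StrongDual ℝ (PairSpace Ω m),
      ∀ k p, ℓ k p = Real.sqrt C.toReal * L k.1 k.2 p.fst :=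
    ⟨fun k => Real.sqrt C.toReal • (L k.1 k.2).comp (WithLp.fstL 2 ℝ _ _), fun _ _ => rfl⟩
  refine ⟨κ × Fin m, inferInstance, ℓ, fun p hp => ?_⟩
  refine sobolevPairs_induction hΩ
    (P := fun p => ‖p.fst‖ ^ 2 ≤ ε * ‖p‖ ^ 2 + ∑ k, ℓ k p ^ 2) ?_ ?_ hp
  · have hcont : Continuous fun p : PairSpace Ω m => p.fst := WithLp.continuous_fst 2 _ _
    refine isClosed_le (hcont.norm.pow 2) ((continuous_norm.pow 2).const_mul ε |>.add ?_)
    exact continuous_finsetSum _ fun k _ => (ℓ k).continuous.pow 2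
  · intro φ hφ
    have e1 : ‖(memLp_smooth hΩ hφ).toLp‖ ^ 2 = (sqNorm (volume.restrict Ω) φ).toReal := by
      rw [norm_sq_eq_toReal_sqNorm, sqNorm_congr (memLp_smooth hΩ hφ).coeFn_toLp]
    have e2 : ‖(memLp_classicalGrad hΩ hφ).toLp‖ ^ 2 =
        (sqNorm (volume.restrict Ω) (classicalGrad φ)).toReal := by
      rw [norm_sq_eq_toReal_sqNorm, sqNorm_congr (memLp_classicalGrad hΩ hφ).coeFn_toLp]
    have e3 : ∀ k : κ, ∑ α, (L k α (memLp_smooth hΩ hφ).toLp) ^ 2 = ‖∫ y in Q k, φ y‖ ^ 2 := by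
      intro k
      have h1 : IntegrableOn φ Ω := (memLp_smooth hΩ hφ).integrable (by norm_num)
      rw [norm_setIntegral_sq (h1.mono_set (hQ k).2)]
      refine Finset.sum_congr rfl fun α _ => ?_
      rw [hL']
      congr 1
      refine integral_congr_ae ?_
      filter_upwards [ae_eq_mono (hQ k).2 (memLp_smooth hΩ hφ).coeFn_toLp] with y hy
      rw [hy]
    have f1 := ((sqNorm_lt_top_iff_memLp (memLp_smooth hΩ hφ).1).2 (memLp_smooth hΩ hφ)).ne
    have f2 := ((sqNorm_lt_top_iff_memLp (memLp_classicalGrad hΩ hφ).1).2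
      (memLp_classicalGrad hΩ hφ)).ne
    have h1 := h hφ
    have h2 : ∑ k, ‖∫ y in Q k, φ y‖ₑ ^ 2 ≠ ⊤ :=
      ENNReal.sum_ne_top.2 fun k _ => ENNReal.pow_ne_top enorm_ne_top
    have h3 := ENNReal.toReal_mono (ENNReal.add_ne_top.2 ⟨ENNReal.mul_ne_top ENNReal.ofReal_ne_top
      (ENNReal.add_ne_top.2 ⟨f1, f2⟩), ENNReal.mul_ne_top hC h2⟩) h1
    rw [ENNReal.toReal_add (ENNReal.mul_ne_top ENNReal.ofReal_ne_top
      (ENNReal.add_ne_top.2 ⟨f1, f2⟩)) (ENNReal.mul_ne_top hC h2), ENNReal.toReal_mul,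
      ENNReal.toReal_mul, ENNReal.toReal_ofReal hε.le, ENNReal.toReal_add f1 f2,
      ENNReal.toReal_sum fun k _ => ENNReal.pow_ne_top enorm_ne_top] at h3
    simp only [ENNReal.toReal_pow, toReal_enorm] at h3
    rw [WithLp.prod_norm_sq_eq_of_L2]
    simp only [WithLp.toLp_fst, WithLp.toLp_snd, e1, e2]
    refine h3.trans (add_le_add le_rfl (le_of_eq ?_))
    rw [Finset.mul_sum, Fintype.sum_prod_type]
    refine Finset.sum_congr rfl fun k _ => ?_
    rw [← e3, Finset.mul_sum]
    refine Finset.sum_congr rfl fun α _ => ?_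
    rw [hℓ, mul_pow, Real.sq_sqrt ENNReal.toReal_nonneg, WithLp.toLp_fst]

end FiniteRank

/-! ### The weak Neumann problem -/

section Neumann

variable {m : ℕ} {Ω D : Set Plane} {M : ℝ}

lemma W.norm_sq_eq_integral (u : W Ω D m) : ‖u‖ ^ 2 = ∫ x in Ω, ‖u.grad x‖ ^ 2 := by
  rw [integral_norm_sq_eq u.memLp_grad.1, W.norm_def, norm_sq_eq_toReal_sqNorm]
  rfl

lemma inner_Lp_eq_integral (g h : Lp (Vec m) 2 (arcLength Ω)) :
    ⟪g, h⟫_ℝ = ∫ x, ∑ α, g x α * h x α ∂arcLength Ω := by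
  rw [L2.inner_def]
  refine integral_congr_ae (ae_of_all _ fun x => ?_)
  simp only [PiLp.inner_apply, RCLike.inner_apply, conj_trivial]
  exact Finset.sum_congr rfl fun α _ => mul_comm _ _

lemma Coeff.form_congr {a : Coeff m} {D' : Set Plane} {u φ : W Ω D m} {u' φ' : W Ω D' m}
    (h1 : W.gradL u = W.gradL u') (h2 : W.gradL φ = W.gradL φ') : a.form u φ = a.form u' φ' := by
  unfold Coeff.form W.grad
  rw [h1, h2]

variable (hΩ : IsLipschitzDomain Ω M) (hM : 0 < M) (𝒞 : CoordCover Ω M) {a : Coeff m}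

include hΩ hM 𝒞

/-- Coercivity on the functions that vanish on the boundary: a solution of the homogeneous Neumann
problem with vanishing trace is zero. -/
lemma Coeff.IsCoercive.eq_zero (hcoer : a.IsCoercive Ω (frontier Ω) M) {u : W Ω ∅ m}
    (hu : a.form u u = 0) (ht : IsTrace u 0) : u = 0 := by
  obtain ⟨v, -, hv⟩ := W.exists_of_isTrace_zero hΩ hM 𝒞 ht
  refine W.eq_zero_of_isTrace_zero hΩ hM 𝒞 ht ?_
  have h1 := hcoer v
  rw [← W.norm_sq_eq_integral, Coeff.form_congr hv hv, hu, W.norm_def, hv, ← W.norm_def] at h1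
  have h2 : 0 < M⁻¹ := inv_pos.2 hM
  exact pow_eq_zero_iff two_ne_zero |>.1
    (le_antisymm (nonpos_of_mul_nonpos_right h1 h2) (sq_nonneg _))

/-- The trace as a linear map into the trace space. -/
lemma exists_trace_map : ∃ T : W Ω ∅ m →ₗ[ℝ] TraceSpace Ω m,
    ∀ (u : W Ω ∅ m) (g : Lp (Vec m) 2 (arcLength Ω)) (hg : IsTrace u g),
      T u = TraceSpace.of hg := by
  obtain ⟨τ, hτ⟩ := exists_trace_operator hΩ hM 𝒞 m
  have ht : ∀ u : W Ω ∅ m, IsTrace u (τ (W.toPair hΩ hM 𝒞 u)) := fun u => (hτ u _).2 rfl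
  refine ⟨⟨⟨fun u => TraceSpace.of (ht u), fun u v => Subtype.ext ?_⟩,
    fun c u => Subtype.ext ?_⟩, fun u g hg => Subtype.ext ((hτ u g).1 hg)⟩
  · change τ _ = τ _ + τ _
    rw [map_add, map_add]
  · change τ _ = c • τ _
    rw [map_smul, map_smul]

lemma W.norm_le_norm_toPair (u : W Ω D m) : ‖u‖ ≤ ‖W.toPair hΩ hM 𝒞 u‖ := by
  refine le_of_sq_le_sq ?_ (norm_nonneg _)
  rw [W.norm_toPair_sq]
  exact le_add_of_nonneg_left (sq_nonneg _)

lemma W.eLpNorm_le_norm_toPair (u : W Ω D m) :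
    (eLpNorm u.fn 2 (volume.restrict Ω)).toReal ≤ ‖W.toPair hΩ hM 𝒞 u‖ := by
  refine le_of_sq_le_sq ?_ (norm_nonneg _)
  rw [W.norm_toPair_sq]
  exact le_add_of_nonneg_right (sq_nonneg _)

/-- The right-hand side of the weak formulation as a bounded functional on the Hilbert space. -/
lemma exists_functional_of_data (f : WDual Ω m) (f_N : TraceDual Ω m) :
    ∃ F : StrongDual ℝ (sobolevPairs Ω ∅ m), ‖F‖ ≤ ‖f‖ + ‖f_N‖ ∧
      ∀ (φ : W Ω ∅ m) (g : Lp (Vec m) 2 (arcLength Ω)) (hg : IsTrace φ g),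
        F (W.toPair hΩ hM 𝒞 φ) = - f φ + f_N (TraceSpace.of hg) := by
  obtain ⟨T, hT⟩ := exists_trace_map (m := m) hΩ hM 𝒞
  obtain ⟨F, hF⟩ : ∃ F : sobolevPairs Ω ∅ m →ₗ[ℝ] ℝ,
      ∀ u, F (W.toPair hΩ hM 𝒞 u) = - f u + f_N (T u) :=
    ⟨(-(f : W Ω ∅ m →ₗ[ℝ] ℝ) + (f_N : TraceSpace Ω m →ₗ[ℝ] ℝ).comp T).comp
      (W.toPair hΩ hM 𝒞).symm.toLinearMap, fun u => by simp⟩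
  have hb : ∀ p, ‖F p‖ ≤ (‖f‖ + ‖f_N‖) * ‖p‖ := by
    intro p
    obtain ⟨u, rfl⟩ := (W.toPair hΩ hM 𝒞).surjective p
    have h1 := u.norm_le_norm_toPair hΩ hM 𝒞
    have h2 : ‖T u‖ ≤ ‖u‖ := by
      obtain ⟨g, hg⟩ := exists_isTrace hΩ hM 𝒞 u
      rw [hT u g hg]
      exact TraceSpace.quotNorm_le (g := TraceSpace.of hg) hg
    have h3 : ‖- f u + f_N (T u)‖ ≤ ‖f u‖ + ‖f_N (T u)‖ :=
      (norm_add_le _ _).trans_eq (by rw [norm_neg])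
    have h4 := f.le_opNorm u
    have h5 : ‖f_N (T u)‖ ≤ ‖f_N‖ * ‖u‖ :=
      (f_N.le_opNorm _).trans (mul_le_mul_of_nonneg_left h2 (norm_nonneg _))
    have h6 := mul_le_mul_of_nonneg_left h1 (add_nonneg (norm_nonneg f) (norm_nonneg f_N))
    rw [hF]
    linarith
  refine ⟨F.mkContinuous _ hb, F.mkContinuous_norm_le (by positivity) hb, fun φ g hg => ?_⟩
  rw [LinearMap.mkContinuous_apply, hF, hT φ g hg]

set_option maxHeartbeats 1000000 in
lemma Coeff.IsBounded.exists_form_pairs (hbdd : a.IsBounded Ω M) :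
    ∃ B : sobolevPairs Ω D m →L[ℝ] sobolevPairs Ω D m →L[ℝ] ℝ,
      ∀ u φ : W Ω D m, B (W.toPair hΩ hM 𝒞 u) (W.toPair hΩ hM 𝒞 φ) = a.form u φ := by
  obtain ⟨B, hB⟩ := hbdd.exists_form
  obtain ⟨G, hG⟩ : ∃ G : sobolevPairs Ω D m →L[ℝ] Lp (GradVec m) 2 (volume.restrict Ω),
      ∀ u, G (W.toPair hΩ hM 𝒞 u) = W.gradL u :=
    let π : PairSpace Ω m →L[ℝ] Lp (GradVec m) 2 (volume.restrict Ω) := WithLp.sndL 2 ℝ _ _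
    ⟨π.comp (sobolevPairs Ω D m).subtypeL, W.toPair_snd hΩ hM 𝒞⟩
  refine ⟨B.bilinearComp G G, fun u φ => ?_⟩
  rw [ContinuousLinearMap.bilinearComp_apply, hG, hG, hB]
  rfl

set_option maxHeartbeats 600000 in
/-- The form is coercive on the Hilbert space up to finitely many functionals. -/
lemma exists_coercive_add_finiteRank {loc : Plane → ℝ → Set Plane}
    (hloc : ∀ x ∈ closure Ω, ∀ ρ : ℝ, 0 < ρ → ρ < 𝒞.r₀ → 𝒞.IsLocalDomain x ρ (loc x ρ))
    (hbdd : a.IsBounded Ω M) (hell : a.IsLocallyElliptic Ω M 𝒞.r₀ loc) :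
    ∃ (c : ℝ) (κ : Type) (_ : Fintype κ) (ℓ : κ → StrongDual ℝ (sobolevPairs Ω ∅ m)), 0 < c ∧
      ∀ u : W Ω ∅ m, c * ‖W.toPair hΩ hM 𝒞 u‖ ^ 2 ≤
        a.form u u + ∑ k, ℓ k (W.toPair hΩ hM 𝒞 u) ^ 2 := by
  obtain ⟨Λ, hΛ, hgarding⟩ := hell.exists_garding hΩ hM 𝒞 hloc hbdd
  have hMinv : 0 < M⁻¹ := inv_pos.2 hM
  set c := M⁻¹ / 2 with hc
  set b := Λ + M⁻¹ with hb
  have hb0 : 0 < b := by positivity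
  -- The small multiple of the Sobolev norm is half of what Gårding's inequality provides.
  obtain ⟨κ, hκ, ℓ, hℓ⟩ := exists_functionals (D := ∅) hΩ hM 𝒞 m (ε := c / b) (by positivity)
  obtain ⟨ℓ', hℓ'⟩ : ∃ ℓ' : κ → StrongDual ℝ (sobolevPairs Ω ∅ m),
      ∀ k p, ℓ' k p = Real.sqrt b * ℓ k p.1 :=
    ⟨fun k => Real.sqrt b • (ℓ k).comp (sobolevPairs Ω ∅ m).subtypeL, fun _ _ => rfl⟩
  refine ⟨c, κ, hκ, ℓ', by positivity, fun u => ?_⟩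
  have h1 := hgarding u
  have h2 := hℓ _ (W.toPair hΩ hM 𝒞 u).2
  have h5 := W.norm_toPair_sq hΩ hM 𝒞 u
  have h4 : (eLpNorm u.fn 2 (volume.restrict Ω)).toReal ^ 2 = ∫ x in Ω, ‖u.fn x‖ ^ 2 := by
    rw [integral_norm_sq_eq u.aestronglyMeasurable_fn, ← eLpNorm_two_sq, ENNReal.toReal_pow]
  have h3 : ‖(W.toPair hΩ hM 𝒞 u).1.fst‖ ^ 2 = ∫ x in Ω, ‖u.fn x‖ ^ 2 := by
    rw [integral_norm_sq_eq u.aestronglyMeasurable_fn, norm_sq_eq_toReal_sqNorm,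
      sqNorm_congr (W.toPair_fst hΩ hM 𝒞 u)]
  rw [← W.norm_sq_eq_integral] at h1
  rw [h4] at h5
  rw [h3, ← Submodule.coe_norm] at h2
  have h6 : ∑ k, ℓ' k (W.toPair hΩ hM 𝒞 u) ^ 2 =
      b * ∑ k, ℓ k (W.toPair hΩ hM 𝒞 u).1 ^ 2 := by
    rw [Finset.mul_sum]
    refine Finset.sum_congr rfl fun k _ => ?_
    rw [hℓ', mul_pow, Real.sq_sqrt hb0.le]
  rw [h6]
  generalize ∑ k, ℓ k (W.toPair hΩ hM 𝒞 u).1 ^ 2 = s at h2 ⊢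
  generalize ∫ x in Ω, ‖u.fn x‖ ^ 2 = N at h1 h2 h5
  generalize ‖W.toPair hΩ hM 𝒞 u‖ ^ 2 = H at h2 h5 ⊢
  have h7 := mul_le_mul_of_nonneg_left h2 hb0.le
  have h8 : b * (c / b * H) = c * H := by field_simp
  rw [mul_add, h8] at h7
  have h9 : c * H + c * H = M⁻¹ * N + M⁻¹ * ‖u‖ ^ 2 := by
    rw [h5, hc]
    ring
  have h10 : b * N = Λ * N + M⁻¹ * N := by
    rw [hb]
    ring
  linarith

end Neumann

end NeumannProblem

end

open NeumannProblem

set_option maxHeartbeats 2000000 in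
theorem theorem5p2 (m : ℕ) (Ω : Set Plane) (M : ℝ) (hM : 0 < M)
    (hΩ : IsLipschitzDomain Ω M) (𝒞 : CoordCover Ω M)
    (loc : Plane → ℝ → Set Plane)
    (hloc : ∀ x ∈ closure Ω, ∀ ρ : ℝ, 0 < ρ → ρ < 𝒞.r₀ → 𝒞.IsLocalDomain x ρ (loc x ρ))
    (a : Coeff m) (hbdd : a.IsBounded Ω M)
    (hell : a.IsLocallyElliptic Ω M 𝒞.r₀ loc)
    (hcoer : a.IsCoercive Ω (frontier Ω) M) :
    ∃ C : ℝ, ∀ (f : WDual Ω m) (f_N : TraceDual Ω m), a.Compatible f f_N →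
      (∃! u : W Ω ∅ m, a.IsWeakSolution f f_N u) ∧
      ∀ u : W Ω ∅ m, a.IsWeakSolution f f_N u →
        MeasureTheory.MemLp u.fn 2 (MeasureTheory.volume.restrict Ω) ∧
        (MeasureTheory.eLpNorm u.fn 2 (MeasureTheory.volume.restrict Ω)).toReal + ‖u‖ ≤
          C * (‖f‖ + ‖f_N‖) := by
  obtain ⟨B, hB⟩ := hbdd.exists_form_pairs (D := ∅) hΩ hM 𝒞
  obtain ⟨c, κ, hκ, ℓ, hc, hcoercive⟩ :=
    exists_coercive_add_finiteRank hΩ hM 𝒞 hloc hbdd hell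
  obtain ⟨τ, hτ⟩ := exists_trace_operator hΩ hM 𝒞 m
  have hsurj := (W.toPair (D := ∅) (m := m) hΩ hM 𝒞).surjective
  have hinj : ∀ p, (∀ φ, B p φ = 0) → τ p = 0 → p = 0 := by
    intro p hp hp0
    obtain ⟨u, rfl⟩ := hsurj p
    rw [hcoer.eq_zero hΩ hM 𝒞 ((hB u u).symm.trans (hp _)) ((hτ u 0).2 hp0), map_zero]
  have hBp : ∀ p, c * ‖p‖ ^ 2 ≤ B p p + ∑ k, ℓ k p ^ 2 := by
    intro p
    obtain ⟨u, rfl⟩ := hsurj p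
    rw [hB]
    exact hcoercive u
  obtain ⟨C, hC, hmain⟩ := exists_bound_normalized_solution B ℓ hc hBp τ hinj
  refine ⟨2 * C, fun f f_N hcomp => ?_⟩
  obtain ⟨F, hFnorm, hF⟩ := exists_functional_of_data hΩ hM 𝒞 f f_N
  have ht : ∀ u : W Ω ∅ m, IsTrace u (τ (W.toPair hΩ hM 𝒞 u)) := fun u => (hτ u _).2 rfl
  have hFcomp : ∀ p, (∀ φ, B φ p = 0) → F p = 0 := by
    intro p hp
    obtain ⟨v, rfl⟩ := hsurj p
    have h1 := hcomp v (fun φ => (hB φ v).symm.trans (hp _)) _ (ht v)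
    rw [hF v _ (ht v)]
    linarith
  have hsol : ∀ u : W Ω ∅ m, a.IsWeakSolution f f_N u ↔
      (∀ φ, B (W.toPair hΩ hM 𝒞 u) φ = F φ) ∧
        ∀ v, (∀ φ, B v φ = 0) → inner ℝ (τ (W.toPair hΩ hM 𝒞 u)) (τ v) = 0 := by
    intro u
    constructor
    · intro h
      refine ⟨fun p => ?_, fun p hp => ?_⟩
      · obtain ⟨φ, rfl⟩ := hsurj p
        rw [hB, h.weak φ _ (ht φ), hF φ _ (ht φ)]
      · obtain ⟨v, rfl⟩ := hsurj p
        rw [inner_Lp_eq_integral]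
        exact h.normalized v (fun φ => (hB v φ).symm.trans (hp _)) _ _ (ht u) (ht v)
    · rintro ⟨h1, h2⟩
      refine ⟨fun φ g hg => ?_, fun v hv g h hg hh => ?_⟩
      · rw [← hB, h1, hF φ g hg]
      · rw [← inner_Lp_eq_integral, ← (hτ u g).1 hg, ← (hτ v h).1 hh]
        refine h2 _ fun p => ?_
        obtain ⟨φ, rfl⟩ := hsurj p
        rw [hB]
        exact hv φ
  obtain ⟨⟨p, hp, hpu⟩, hbound⟩ := hmain F hFcomp
  refine ⟨?_, fun u hu => ⟨u.memLp_fn hΩ hM 𝒞, ?_⟩⟩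
  · obtain ⟨u, rfl⟩ := hsurj p
    exact ⟨u, (hsol u).2 hp, fun v hv =>
      (W.toPair hΩ hM 𝒞).injective (hpu _ ((hsol v).1 hv))⟩
  · have h1 := hbound _ ((hsol u).1 hu).1 ((hsol u).1 hu).2
    have h2 := u.norm_le_norm_toPair hΩ hM 𝒞
    have h3 := u.eLpNorm_le_norm_toPair hΩ hM 𝒞
    have h4 := mul_le_mul_of_nonneg_left hFnorm hC
    linarith
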